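/- Let $k$ be an algebraically closed field of characteristic $p>0$, $P$ a finite abelian $p$-group, $L$ an abelian $p'$-subgroup of $\mathrm{Aut}(P)$ and $\alpha\in H^2(L,k^\times)$ (trivial action). Let $k_\alpha(P\rtimes L)$ be the twisted group algebra formed with $\alpha$ pulled back along $P\rtimes L\to L$. The *basic algebra* of a finite dimensional $k$-algebra $\Lambda$ is the algebra, unique up to isomorphism, of the form $\varepsilon\Lambda\varepsilon$ with $\varepsilon$ an idempotent such that $\Lambda\varepsilon\Lambda=\Lambda$ and $\varepsilon\Lambda\varepsilon/J(\varepsilon\Lambda\varepsilon)\cong k\times\dots\times k$. (a) There is a central extension $1\to Z\to H\xrightarrow{\pi} L\to 1$ of finite groups with $Z\le[H,H]$ and an injective homomorphism $\chi:Z\to k^\times$ that sends the class of the extension to $\alpha$. For every such extension, $k_\alpha(P\rtimes L)\cong k(P\rtimes H)e$, where $H$ acts on $P$ through $\pi$ and $e=|Z|^{-1}\sum_{z\in Z}\chi(z^{-1})z$. (b) There are elements $w_1,\dots,w_r\in kP$, homomorphisms $\psi_1,\dots,\psi_r:L\to k^\times$ and integers $n_1,\dots,n_r\ge1$ such that each $x\in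 L$ sends $w_i$ to $\psi_i(x)w_i$ and such that $kP=k[w_1,\dots,w_r]/(w_1^{p^{n_1}},\dots,w_r^{p^{n_r}})$. Regard the $\psi_i$ as characters of $H$ via $\pi$. Fix any data as in (a) and (b). Let $V$ be the set of homomorphisms $\varphi:Z(H)\to k^\times$ that extend $\chi$; for $\varphi\in V$ put $\varphi\psi_i=\varphi\cdot\psi_i|_{Z(H)}\in V$ and $e_\varphi=|Z(H)|^{-1}\sum_{h\in Z(H)}\varphi(h^{-1})h$. (c) There are $\varphi_0\in V$, homomorphisms $\xi_\varphi:H\to k^\times$ with $\xi_\varphi|_{Z(H)}=\varphi\varphi_0^{-1}$ and $\xi_{\varphi_0}=1$, and elements $g_{i,\varphi}\in H$ $(1\le i\le r,\ \varphi\in V)$ with $$\chi(hg_{i,\varphi}h^{-1}g_{i,\varphi}^{-1})=\xi_{\varphi\psi_i}(h)\,\xi_\varphi(h)^{-1}\psi_i(h)^{-1}\quad\text{for all }h\in H.$$ Fix any such choices. Then $g_{j,\varphi\psi_i}g_{i,\varphi}=g_{i,\varphi\psi_j}g_{j,\varphi}z_{i,j,\varphi}$ with $z_{i,j,\varphi}\in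 Z(H)$; put $$q_{i,j,\varphi}=(\varphi\psi_i\psi_j)(z_{i,j,\varphi})\;\psi_i(g_{j,\varphi})\;\psi_j(g_{i,\varphi})^{-1}\in k^\times .$$ Let $Q$ be the quiver with vertex set $V$ and one arrow $a_{i,\varphi}:\varphi\to\varphi\psi_i$ for each $i$ and $\varphi$. Let $J(kQ)$ be the ideal of the path algebra $kQ$ generated by the arrows (paths composed from right to left), and let $I$ be the two-sided ideal of $kQ$ generated by $$a_{j,\varphi\psi_i}a_{i,\varphi}-q_{i,j,\varphi}\,a_{i,\varphi\psi_j}a_{j,\varphi},\qquad a_{i,\varphi\psi_i^{p^{n_i}-1}}\cdots a_{i,\varphi\psi_i}a_{i,\varphi}\qquad(\text{all } i,j,\varphi).$$ (d) Then $I\le J(kQ)^2$; there is an injective multiplicative $k$-linear map $kQ/I\to k(P\rtimes H)$ sending the vertex $\varphi$ to $e_\varphi$ and $a_{i,\varphi}$ to $g_{i,\varphi}w_ie_\varphi$; $kQ/I$ is the basic algebra of $k_\alpha(P\rtimes L)$; and $|H:Z(H)|=m^2$ for an integer $m$ such that, for any basic algebra $\mathfrak A$ of $k_\alpha(P\rtimes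 L)$, $\mathfrak A\cong kQ/I$ and $k_\alpha(P\rtimes L)\cong \mathrm{Mat}_m(\mathfrak A)$. -/

import Mathlib

universe u v w t

noncomputable section

namespace QuantisedBlock

/-! ### Second cohomology with trivial coefficients -/

/-- The group `Z²(G, M)` of 2-cocycles, for the trivial action of `G` on `M`. -/
def cocycles (G : Type*) (M : Type*) [Group G] [CommGroup M] : Subgroup (G × G → M) where
  carrier := {a | ∀ x y z, a (x, y) * a (x * y, z) = a (y, z) * a (x, y * z)}
  mul_mem' := by
    intro a b ha hb x y z
    simp only [Set.mem_ofPred_eq] at ha hb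
    simp only [Pi.mul_apply]
    rw [mul_mul_mul_comm, ha, hb, mul_mul_mul_comm]
  one_mem' := by intro x y z; simp
  inv_mem' := by
    intro a ha x y z
    simp only [Set.mem_ofPred_eq] at ha
    simp only [Pi.inv_apply]
    rw [← mul_inv, ha, mul_inv]

/-- The group `B²(G, M)` of 2-coboundaries, as a subgroup of `Z²(G, M)`. -/
def coboundaries (G : Type*) (M : Type*) [Group G] [CommGroup M] : Subgroup (cocycles G M) where
  carrier := {a | ∃ c : G → M, ∀ x y, a.1 (x, y) = c x * c y * (c (x * y))⁻¹}
  mul_mem' := by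
    rintro a b ⟨c, hc⟩ ⟨d, hd⟩
    refine ⟨c * d, fun x y => ?_⟩
    simp only [Subgroup.coe_mul, Pi.mul_apply, hc, hd, mul_inv]
    simp only [mul_assoc, mul_left_comm, mul_comm]
  one_mem' := ⟨1, fun x y => by simp⟩
  inv_mem' := by
    rintro a ⟨c, hc⟩
    refine ⟨c⁻¹, fun x y => ?_⟩
    simp only [Subgroup.coe_inv, Pi.inv_apply, hc, mul_inv]

/-- The cohomology group `H²(G, M)`, for the trivial action of `G` on `M`. -/
abbrev H2 (G : Type*) (M : Type*) [Group G] [CommGroup M] : Type _ :=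
  cocycles G M ⧸ coboundaries G M

/-- Inflation of a cocycle along a group homomorphism `G → L`. -/
def inflate {G L M : Type*} [Group G] [Group L] [CommGroup M] (f : G →* L) (a : cocycles L M) :
    cocycles G M :=
  ⟨fun x => a.1 (f x.1, f x.2), fun x y z => by
    have h := a.2 (f x) (f y) (f z)
    simpa only [map_mul] using h⟩

/-! ### Twisted group algebras -/

/-- The twisted group algebra `k_a G` of a cocycle `a ∈ Z²(G, kˣ)`: the vector space with basis
`G`, where the product of the basis elements of `x` and `y` is `a (x, y)` times that of `x * y`. -/
def TwistedGroupAlgebra (k : Type v) {G : Type u} [Field k] [Group G] (_a : cocycles G kˣ) :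
    Type (max u v) :=
  G →₀ k

namespace TwistedGroupAlgebra

variable {k : Type v} {G : Type u} [Field k] [Group G] (a : cocycles G kˣ)

instance : AddCommGroup (TwistedGroupAlgebra k a) := inferInstanceAs (AddCommGroup (G →₀ k))

instance : Module k (TwistedGroupAlgebra k a) := inferInstanceAs (Module k (G →₀ k))

/-- The element `c · x` of the twisted group algebra, for a scalar `c` and a basis element `x`. -/
def of (x : G) (c : k) : TwistedGroupAlgebra k a := Finsupp.single x c

/-- The multiplication, as the bilinear extension of the product of basis elements. -/
def mulBilin : (G →₀ k) →ₗ[k] (G →₀ k) →ₗ[k] (G →₀ k) :=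
  Finsupp.lsum k fun x => LinearMap.toSpanSingleton k _
    (Finsupp.lsum k fun y => ((a.1 (x, y) : kˣ) : k) • Finsupp.lsingle (x * y))

instance : Mul (TwistedGroupAlgebra k a) := ⟨fun f g => mulBilin a f g⟩

instance : One (TwistedGroupAlgebra k a) := ⟨of a 1 ((a.1 (1, 1))⁻¹ : kˣ)⟩

theorem mul_def (f g : TwistedGroupAlgebra k a) : f * g = mulBilin a f g := rfl

theorem one_def : (1 : TwistedGroupAlgebra k a) = of a 1 ((a.1 (1, 1))⁻¹ : kˣ) := rfl

theorem of_mul_of (x y : G) (c d : k) :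
    of a x c * of a y d = of a (x * y) (c * d * (a.1 (x, y) : kˣ)) := by
  change mulBilin a (Finsupp.single x c) (Finsupp.single y d) =
    Finsupp.single (x * y) (c * d * (a.1 (x, y) : kˣ))
  simp only [mulBilin, Finsupp.lsum_single, LinearMap.toSpanSingleton_apply, LinearMap.smul_apply,
    Finsupp.lsingle_apply, Finsupp.smul_single, smul_eq_mul]
  congr 1
  ring

protected theorem add_mul' (f g h : TwistedGroupAlgebra k a) : (f + g) * h = f * h + g * h :=
  LinearMap.map_add₂ (mulBilin a) f g h

protected theorem mul_add' (f g h : TwistedGroupAlgebra k a) : f * (g + h) = f * g + f * h :=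
  map_add (mulBilin a f) g h

protected theorem zero_mul' (f : TwistedGroupAlgebra k a) : 0 * f = 0 :=
  LinearMap.map_zero₂ (mulBilin a) f

protected theorem mul_zero' (f : TwistedGroupAlgebra k a) : f * 0 = 0 :=
  map_zero (mulBilin a f)

@[elab_as_elim]
theorem induction {motive : TwistedGroupAlgebra k a → Prop} (f : TwistedGroupAlgebra k a)
    (zero : motive 0) (add : ∀ f g, motive f → motive g → motive (f + g))
    (basis : ∀ x c, motive (of a x c)) : motive f :=
  Finsupp.induction_linear (motive := motive) f zero add basis

protected theorem mul_assoc' (f g h : TwistedGroupAlgebra k a) : f * g * h = f * (g * h) := by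
  induction f using induction with
  | zero => simp only [TwistedGroupAlgebra.zero_mul']
  | add f₁ f₂ h₁ h₂ => simp only [TwistedGroupAlgebra.add_mul', h₁, h₂]
  | basis x b =>
    induction g using induction with
    | zero => simp only [TwistedGroupAlgebra.zero_mul', TwistedGroupAlgebra.mul_zero']
    | add f₁ f₂ h₁ h₂ =>
      simp only [TwistedGroupAlgebra.add_mul', TwistedGroupAlgebra.mul_add', h₁, h₂]
    | basis y c =>
      induction h using induction with
      | zero => simp only [TwistedGroupAlgebra.mul_zero']
      | add f₁ f₂ h₁ h₂ => simp only [TwistedGroupAlgebra.mul_add', h₁, h₂]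
      | basis z d =>
        simp only [of_mul_of, mul_assoc x y z]
        congr 1
        have h := congrArg (fun t : kˣ => (t : k)) (a.2 x y z)
        simp only [Units.val_mul] at h
        linear_combination b * c * d * h

theorem apply_one_left (x : G) : a.1 (1, x) = a.1 (1, 1) := by
  have h := a.2 1 1 x
  simp only [one_mul] at h
  exact (mul_right_cancel (h.trans (mul_comm _ _))).symm

theorem apply_one_right (x : G) : a.1 (x, 1) = a.1 (1, 1) := by
  have h := a.2 x 1 1
  simp only [mul_one] at h
  exact mul_right_cancel h

protected theorem one_mul' (f : TwistedGroupAlgebra k a) : 1 * f = f := by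
  induction f using induction with
  | zero => simp only [TwistedGroupAlgebra.mul_zero']
  | add f₁ f₂ h₁ h₂ => simp only [TwistedGroupAlgebra.mul_add', h₁, h₂]
  | basis x c =>
    rw [one_def, of_mul_of, apply_one_left a x, one_mul]
    congr 1
    rw [mul_comm, ← mul_assoc, Units.mul_inv, one_mul]

protected theorem mul_one' (f : TwistedGroupAlgebra k a) : f * 1 = f := by
  induction f using induction with
  | zero => simp only [TwistedGroupAlgebra.zero_mul']
  | add f₁ f₂ h₁ h₂ => simp only [TwistedGroupAlgebra.add_mul', h₁, h₂]
  | basis x c =>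
    rw [one_def, of_mul_of, apply_one_right a x, mul_one, mul_assoc, Units.inv_mul, mul_one]

instance : Ring (TwistedGroupAlgebra k a) :=
  { (inferInstance : AddCommGroup (TwistedGroupAlgebra k a)) with
    mul := (· * ·)
    one := 1
    left_distrib := TwistedGroupAlgebra.mul_add' a
    right_distrib := TwistedGroupAlgebra.add_mul' a
    zero_mul := TwistedGroupAlgebra.zero_mul' a
    mul_zero := TwistedGroupAlgebra.mul_zero' a
    mul_assoc := TwistedGroupAlgebra.mul_assoc' a
    one_mul := TwistedGroupAlgebra.one_mul' a
    mul_one := TwistedGroupAlgebra.mul_one' a }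

instance : Algebra k (TwistedGroupAlgebra k a) :=
  Algebra.ofModule
    (fun r f g => LinearMap.map_smul₂ (mulBilin a) r f g)
    (fun r f g => map_smul (mulBilin a f) r g)

end TwistedGroupAlgebra

/-- The twisted group algebra `k_a (P ⋊ L)`, for a subgroup `L` of `Aut(P)` and `a ∈ Z²(L, kˣ)`
pulled back along `P ⋊ L → L`. -/
abbrev TwistedSemidirect {k : Type v} {P : Type u} [Field k] [Group P] {L : Subgroup (MulAut P)}
    (a : cocycles L kˣ) : Type (max u v) :=
  TwistedGroupAlgebra k (inflate (SemidirectProduct.rightHom : P ⋊[L.subtype] L →* L) a)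

/-! ### Basic algebras -/

/-- A finite dimensional `k`-algebra `A` is (split) basic if `A / J(A)` is isomorphic to a finite
product of copies of `k`, where `J(A)` is the Jacobson radical. -/
def IsBasic (k : Type*) (A : Type*) [Field k] [Ring A] [Algebra k A] : Prop :=
  Module.Finite k A ∧ ∃ (n : ℕ) (f : A →ₐ[k] (Fin n → k)),
    Function.Surjective f ∧ ∀ x, f x = 0 ↔ x ∈ Ring.jacobson A

/-- `A` is the basic algebra of `Λ` (which determines `A` up to isomorphism): `A` is basic, and
isomorphic to `ε Λ ε` for an idempotent `ε` of `Λ` that is full, that is, `Λ ε Λ = Λ`. -/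
def IsBasicAlgebraOf (k : Type*) (Λ : Type*) (A : Type*) [Field k] [Ring Λ] [Algebra k Λ]
    [Ring A] [Algebra k A] : Prop :=
  IsBasic k A ∧ ∃ ε : Λ, IsIdempotentElem ε ∧ TwoSidedIdeal.span {ε} = ⊤ ∧
    ∃ f : A →ₙₐ[k] Λ, Function.Injective f ∧ Set.range f = {x | ∃ y, x = ε * y * ε}

/-! ### Path algebras of finite quivers -/

/-- The defining relations of the path algebra, on the vertices (`Sum.inl`) and the arrows
(`Sum.inr`) of a quiver. -/
inductive PathRel (k : Type*) {V E : Type*} [Field k] [Fintype V] (src tgt : E → V) :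
    FreeAlgebra k (V ⊕ E) → FreeAlgebra k (V ⊕ E) → Prop
  | idem (v : V) : PathRel k src tgt
      (FreeAlgebra.ι k (Sum.inl v) * FreeAlgebra.ι k (Sum.inl v)) (FreeAlgebra.ι k (Sum.inl v))
  | orth (v v' : V) (h : v ≠ v') : PathRel k src tgt
      (FreeAlgebra.ι k (Sum.inl v) * FreeAlgebra.ι k (Sum.inl v')) 0
  | total : PathRel k src tgt (∑ v : V, FreeAlgebra.ι k (Sum.inl v)) 1
  | source (x : E) : PathRel k src tgt
      (FreeAlgebra.ι k (Sum.inr x) * FreeAlgebra.ι k (Sum.inl (src x))) (FreeAlgebra.ι k (Sum.inr x))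
  | target (x : E) : PathRel k src tgt
      (FreeAlgebra.ι k (Sum.inl (tgt x)) * FreeAlgebra.ι k (Sum.inr x)) (FreeAlgebra.ι k (Sum.inr x))

/-- The path algebra `kQ` of a quiver `Q` with finite vertex set `V`, arrow set `E`, and source and
target maps `src`, `tgt`. Paths compose from right to left: a product `y * x` of arrows can only
be non-zero if `tgt x = src y`. -/
abbrev PathAlgebra (k : Type*) {V E : Type*} [Field k] [Fintype V] (src tgt : E → V) : Type _ :=
  RingQuot (PathRel k src tgt)

namespace PathAlgebra

variable (k : Type*) {V E : Type*} [Field k] [Fintype V] (src tgt : E → V)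

/-- The idempotent of a vertex. -/
def vertex (v : V) : PathAlgebra k src tgt :=
  RingQuot.mkAlgHom k (PathRel k src tgt) (FreeAlgebra.ι k (Sum.inl v))

/-- The element of an arrow. -/
def arrow (x : E) : PathAlgebra k src tgt :=
  RingQuot.mkAlgHom k (PathRel k src tgt) (FreeAlgebra.ι k (Sum.inr x))

/-- The two-sided ideal `J(kQ)` generated by the arrows. -/
def arrowIdeal : TwoSidedIdeal (PathAlgebra k src tgt) :=
  TwoSidedIdeal.span (Set.range (arrow k src tgt))

/-- The square `J²(kQ)` of the arrow ideal. -/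
def arrowIdealSq : TwoSidedIdeal (PathAlgebra k src tgt) :=
  TwoSidedIdeal.span
    {x | ∃ y ∈ arrowIdeal k src tgt, ∃ z ∈ arrowIdeal k src tgt, x = y * z}

end PathAlgebra

/-! ### The central extension -/

/-- A central extension `1 → Z → H → L → 1` of the group `L` by a finite group `Z ≤ [H, H]`,
with a faithful linear character `χ` of `Z` (so that `Z` is cyclic, of order invertible in `k`),
which sends the class of the extension to `α`. Here `Z` is the kernel of `π`. -/
structure TwistExtension {L : Type u} {k : Type v} [Group L] [Field k] (α : H2 L kˣ) where
  H : Type w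
  [group : Group H]
  [finite : Finite H]
  π : H →* L
  surjective : Function.Surjective π
  central : π.ker ≤ Subgroup.center H
  ker_le_commutator : π.ker ≤ commutator H
  χ : π.ker →* kˣ
  faithful : Function.Injective χ
  realises : ∃ (s : L → H) (hs : ∀ x, π (s x) = x) (c : cocycles L kˣ),
    (∀ x y, c.1 (x, y) = χ ⟨s x * s y * (s (x * y))⁻¹, by simp [MonoidHom.mem_ker, hs]⟩) ∧
      QuotientGroup.mk c = α

namespace TwistExtension

variable {L : Type u} {k : Type v} [Group L] [Field k] {α : H2 L kˣ}

instance (D : TwistExtension.{u, v, w} α) : Group D.H := D.group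

instance (D : TwistExtension.{u, v, w} α) : Finite D.H := D.finite

variable (D : TwistExtension.{u, v, w} α)

/-- The vertices: the characters `φ : Z(H) → kˣ` that extend `χ`. -/
abbrev Vertex : Type (max v w) :=
  {φ : Subgroup.center D.H →* kˣ // ∀ z : D.π.ker, φ ⟨z, D.central z.2⟩ = D.χ z}

instance : Fintype D.Vertex := Fintype.ofFinite _

/-- The vertex `φ ψ`, for a vertex `φ` and a linear character `ψ` of `L`, inflated to `H` and
restricted to `Z(H)`. -/
def shift (φ : D.Vertex) (ψ : L →* kˣ) : D.Vertex :=
  ⟨φ.1 * (ψ.comp D.π).comp (Subgroup.center D.H).subtype, fun z => by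
    have hz : D.π (z : D.H) = 1 := z.2
    simp [φ.2 z, hz]⟩

theorem shift_comm (φ : D.Vertex) (ψ ψ' : L →* kˣ) :
    D.shift (D.shift φ ψ) ψ' = D.shift (D.shift φ ψ') ψ := by
  apply Subtype.ext
  simp only [shift]
  exact mul_right_comm φ.1 _ _

variable [IsMulCommutative L]

theorem commutator_mem_ker (h g : D.H) : h * g * h⁻¹ * g⁻¹ ∈ D.π.ker := by
  have hc : D.π h * D.π g = D.π g * D.π h := IsMulCommutative.is_comm.comm _ _
  simp [MonoidHom.mem_ker, hc]

/-- The scalar `χ (h g h⁻¹ g⁻¹)`. -/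
def pairing (h g : D.H) : kˣ := D.χ ⟨h * g * h⁻¹ * g⁻¹, D.commutator_mem_ker h g⟩

theorem pairing_mul (h g g' : D.H) : D.pairing h (g * g') = D.pairing h g * D.pairing h g' := by
  unfold pairing
  rw [← map_mul]
  congr 1
  apply Subtype.ext
  have hc := Subgroup.mem_center_iff.mp (D.central (D.commutator_mem_ker h g')) g
  simp only [Subgroup.coe_mul]
  calc h * (g * g') * h⁻¹ * (g * g')⁻¹
      = h * g * h⁻¹ * (h * g' * h⁻¹ * g'⁻¹) * g⁻¹ := by group
    _ = h * g * h⁻¹ * g⁻¹ * (g * (h * g' * h⁻¹ * g'⁻¹)) * g⁻¹ := by group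
    _ = h * g * h⁻¹ * g⁻¹ * ((h * g' * h⁻¹ * g'⁻¹) * g) * g⁻¹ := by rw [hc]
    _ = _ := by group

theorem mem_center_of_pairing {b c : D.H} (h : ∀ x, D.pairing x b = D.pairing x c) :
    b⁻¹ * c ∈ Subgroup.center D.H := by
  rw [Subgroup.mem_center_iff]
  intro x
  have h1 : D.pairing x (b⁻¹ * c) = 1 := by
    have h2 := D.pairing_mul x b (b⁻¹ * c)
    rw [mul_inv_cancel_left, ← h x] at h2
    exact (mul_eq_left.mp h2.symm)
  have h3 := D.faithful (h1.trans (map_one D.χ).symm)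
  have h4 : x * (b⁻¹ * c) * x⁻¹ * (b⁻¹ * c)⁻¹ = 1 := congrArg Subtype.val h3
  exact mul_inv_eq_iff_eq_mul.mp (mul_inv_eq_one.mp h4)

end TwistExtension

/-! ### Coordinates on the group algebra of the normal subgroup -/

/-- Elements `w₁, …, w_r` of `kP` which are eigenvectors of `L` for linear characters `ψ₁, …, ψ_r`
and which present `kP` as `k[w₁, …, w_r] / (w₁ ^ (p ^ n₁), …, w_r ^ (p ^ n_r))` with all `n_i ≥ 1`.
Then the `w_i` are automatically a basis of a complement of `J²(kP)` in `J(kP)`. -/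
structure Coordinates (p : ℕ) (k : Type v) {P : Type u} [Field k] [CommGroup P]
    (L : Subgroup (MulAut P)) where
  r : ℕ
  w : Fin r → MonoidAlgebra k P
  ψ : Fin r → (L →* kˣ)
  n : Fin r → ℕ
  n_pos : ∀ i, 1 ≤ n i
  eigen : ∀ (x : L) (i : Fin r),
    MonoidAlgebra.mapDomain (fun y : P => (x : MulAut P) y) (w i) = ((ψ i x : kˣ) : k) • w i
  surjective : Function.Surjective (MvPolynomial.aeval (R := k) w)
  ker_eq : RingHom.ker (MvPolynomial.aeval (R := k) w) =
    Ideal.span (Set.range fun i => (MvPolynomial.X i : MvPolynomial (Fin r) k) ^ p ^ n i)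

/-! ### The quiver and its relations -/

/-- The choices that enter the relations: a base vertex `φ₀`, linear characters `ξ_φ` of `H` that
extend `φ φ₀⁻¹`, and elements `g_{i,φ}` of `H` with
`χ (h g_{i,φ} h⁻¹ g_{i,φ}⁻¹) = (ξ_{φψ_i} ξ_φ⁻¹ ψ_i⁻¹)(h)` for all `h` in `H`. -/
structure Choices {p : ℕ} {k : Type v} {P : Type u} [Field k] [CommGroup P]
    {L : Subgroup (MulAut P)} [IsMulCommutative L] {α : H2 L kˣ}
    (D : TwistExtension.{u, v, w} α) (C : Coordinates p k L) where
  φ₀ : D.Vertex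
  ξ : D.Vertex → (D.H →* kˣ)
  ξ_restrict : ∀ (φ : D.Vertex) (z : Subgroup.center D.H), ξ φ z = φ.1 z * (φ₀.1 z)⁻¹
  ξ_base : ξ φ₀ = 1
  g : Fin C.r → D.Vertex → D.H
  g_spec : ∀ (i : Fin C.r) (φ : D.Vertex) (h : D.H),
    D.pairing h (g i φ) = ξ (D.shift φ (C.ψ i)) h * (ξ φ h)⁻¹ * (C.ψ i (D.π h))⁻¹

namespace Choices

variable {p : ℕ} {k : Type v} {P : Type u} [Field k] [CommGroup P]
  {L : Subgroup (MulAut P)} [IsMulCommutative L] {α : H2 L kˣ}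
  {D : TwistExtension.{u, v, w} α} {C : Coordinates p k L} (X : Choices D C)

/-- The element `z_{i,j,φ}` of `Z(H)` with `g_{j,φψ_i} g_{i,φ} = g_{i,φψ_j} g_{j,φ} z_{i,j,φ}`. -/
def z (i j : Fin C.r) (φ : D.Vertex) : Subgroup.center D.H :=
  ⟨(X.g i (D.shift φ (C.ψ j)) * X.g j φ)⁻¹ * (X.g j (D.shift φ (C.ψ i)) * X.g i φ), by
    apply D.mem_center_of_pairing
    intro x
    rw [D.pairing_mul, D.pairing_mul, X.g_spec, X.g_spec, X.g_spec, X.g_spec,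
      D.shift_comm φ (C.ψ j) (C.ψ i)]
    generalize X.ξ (D.shift (D.shift φ (C.ψ i)) (C.ψ j)) x = t
    generalize X.ξ (D.shift φ (C.ψ i)) x = t₁
    generalize X.ξ (D.shift φ (C.ψ j)) x = t₂
    generalize X.ξ φ x = t₃
    generalize (C.ψ i) (D.π x) = t₄
    generalize (C.ψ j) (D.π x) = t₅
    calc t * t₂⁻¹ * t₄⁻¹ * (t₂ * t₃⁻¹ * t₅⁻¹)
        = t * t₃⁻¹ * t₄⁻¹ * t₅⁻¹ * (t₂⁻¹ * t₂) := by
          simp only [mul_assoc, mul_left_comm, mul_comm]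
      _ = t * t₃⁻¹ * t₄⁻¹ * t₅⁻¹ * (t₁⁻¹ * t₁) := by simp
      _ = t * t₁⁻¹ * t₅⁻¹ * (t₁ * t₃⁻¹ * t₄⁻¹) := by
          simp only [mul_assoc, mul_left_comm, mul_comm]⟩

/-- The quantum parameter
`q_{i,j,φ} = (φ ψ_i ψ_j)(z_{i,j,φ}) ψ_i(g_{j,φ}) ψ_j(g_{i,φ})⁻¹`. -/
def q (i j : Fin C.r) (φ : D.Vertex) : kˣ :=
  (D.shift (D.shift φ (C.ψ i)) (C.ψ j)).1 (X.z i j φ) *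
    C.ψ i (D.π (X.g j φ)) * (C.ψ j (D.π (X.g i φ)))⁻¹

end Choices

section Quiver

variable {p : ℕ} {k : Type v} {P : Type u} [Field k] [CommGroup P]
  {L : Subgroup (MulAut P)} {α : H2 L kˣ}
  (D : TwistExtension.{u, v, w} α) (C : Coordinates p k L)

/-- The path algebra `kQ` of the quiver `Q` with the vertices `φ` and with one arrow from `φ` to
`φ ψ_i` for each `φ` and each `i`. -/
abbrev QuiverAlgebra : Type _ :=
  PathAlgebra k (fun x : D.Vertex × Fin C.r => x.1)
    (fun x : D.Vertex × Fin C.r => D.shift x.1 (C.ψ x.2))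

/-- The arrow of type `i` from `φ` to `φ ψ_i`, in `kQ`. -/
def arrow (i : Fin C.r) (φ : D.Vertex) : QuiverAlgebra D C :=
  PathAlgebra.arrow k _ _ (φ, i)

/-- The path that starts at `φ` and consists of `m` arrows of type `i`, in `kQ`. -/
def arrowPower (i : Fin C.r) (φ : D.Vertex) : ℕ → QuiverAlgebra D C
  | 0 => PathAlgebra.vertex k _ _ φ
  | m + 1 => arrow D C i ((fun φ' => D.shift φ' (C.ψ i))^[m] φ) * arrowPower i φ m

/-- The two-sided ideal of `kQ` generated by the quantised commutation relations and the power
relations. -/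
def relationIdeal [IsMulCommutative L] {D : TwistExtension.{u, v, w} α} {C : Coordinates p k L}
    (X : Choices D C) : TwoSidedIdeal (QuiverAlgebra D C) :=
  TwoSidedIdeal.span
    ({x | ∃ i j φ, x = arrow D C j (D.shift φ (C.ψ i)) * arrow D C i φ -
        ((X.q i j φ : kˣ) : k) • (arrow D C i (D.shift φ (C.ψ j)) * arrow D C j φ)} ∪
      {x | ∃ i φ, x = arrowPower D C i φ (p ^ C.n i)})

/-- The quantised algebra `kQ / I`. -/
abbrev QuantisedAlgebra [IsMulCommutative L] {D : TwistExtension.{u, v, w} α}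
    {C : Coordinates p k L} (X : Choices D C) : Type _ :=
  (relationIdeal X).ringCon.Quotient

/-- The group `P ⋊ H`, a central extension of `P ⋊ L` by `Z`. -/
abbrev CoverGroup : Type (max u w) := P ⋊[L.subtype.comp D.π] D.H

/-- The idempotent `e = |Z|⁻¹ ∑ χ(z⁻¹) z` of `k(P ⋊ H)`. -/
def idempotent : MonoidAlgebra k (CoverGroup D) :=
  (Nat.card D.π.ker : k)⁻¹ • ∑ᶠ z : D.π.ker,
    ((D.χ z⁻¹ : kˣ) : k) • MonoidAlgebra.of k (CoverGroup D) (SemidirectProduct.inr (z : D.H))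

/-- The idempotent `e_φ = |Z(H)|⁻¹ ∑ φ(h⁻¹) h` of `k(P ⋊ H)`. -/
def vertexIdempotent (φ : D.Vertex) : MonoidAlgebra k (CoverGroup D) :=
  (Nat.card (Subgroup.center D.H) : k)⁻¹ • ∑ᶠ h : Subgroup.center D.H,
    ((φ.1 h⁻¹ : kˣ) : k) • MonoidAlgebra.of k (CoverGroup D) (SemidirectProduct.inr (h : D.H))

/-- The element `g_{i,φ} w_i e_φ` of `k(P ⋊ H)`. -/
def arrowElement [IsMulCommutative L] {D : TwistExtension.{u, v, w} α} {C : Coordinates p k L}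
    (X : Choices D C) (i : Fin C.r) (φ : D.Vertex) : MonoidAlgebra k (CoverGroup D) :=
  MonoidAlgebra.of k (CoverGroup D) (SemidirectProduct.inr (X.g i φ)) *
    MonoidAlgebra.mapDomain (fun y : P => (SemidirectProduct.inl y : CoverGroup D)) (C.w i) *
    vertexIdempotent D φ

end Quiver

end QuantisedBlock

end

open QuantisedBlock

/-! Write R for the twisted group algebra, V for the vertex set and K for kQ/I. By
`exists_projection_inclusion`, R is the direct factor k(P ⋊ H)e. As L is abelian, [H,H] lies in Z,
and as χ is faithful, the pairing χ(hgh⁻¹g⁻¹) is nondegenerate on H/Z(H). The idempotents e_φ are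
orthogonal with sum e, and w_i e_φ = e_{φψ_i} w_i. So g_{i,φ} w_i e_φ lies over an arrow φ → φψ_i,
and a direct computation gives the defining relations of K. This yields a homomorphism f : K → R
(`exists_quantised_map`).

The elements u(h) = ∑ ξ_φ(h)⁻¹ h e_φ give a homomorphism from H to the units of R under which Z(H)
acts by the scalars φ₀. Let B be their span. Nondegeneracy makes the average of the conjugates of a
non-central u(h) vanish, which forces B to be simple. Hence B ≅ Mat_m(k) with m² ≤ |H:Z(H)|
(`exists_algEquiv_matrix_range`). The equation imposed on g_{i,φ} is what makes g_{i,φ} w_i e_φ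
commute with every u(h) (`commute_diagonalHom_arrowElement`), so f and the inclusion of B combine to
a homomorphism K ⊗ B → R. It is surjective, because h e_φ, then w_i e_φ, then kP can be recovered
from f(K) and B. Now dim K ≤ |P||V|, while dim R = |P||L| = |P||V||H:Z(H)|. All inequalities are
therefore equalities, K ⊗ B ≅ R and R ≅ Mat_m(K) (`exists_algEquiv_matrix`).

The bound on dim K is a straightening argument (`SkewGenerated`): the vertices span a space of
coefficients, and the sums of all arrows of one type commute up to such coefficients. The same
calculus makes the arrow ideal of K nilpotent with quotient k^V, so K is basic. For an arbitrary
basic algebra εRε, the image of ε in each factor of ∏ Mat_m(k) is a rank one idempotent. It is thus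
equivalent to a matrix unit, and the equivalence lifts along the nil kernel
(`nonempty_algEquiv_of_isBasicAlgebraOf`).

Existence of the data. For H, the values a(x,y)a(y,x)⁻¹ generate a finite subgroup of kˣ, modulo
which the class of a is trivial because kˣ is divisible. For the coordinates, the elements x_j − 1
of a basis of P are replaced by suitable eigencomponents. For the g_{i,φ}, nondegeneracy and a count
of characters suffice. -/

noncomputable section

namespace QuantisedBlock

/-! ### Algebras generated by elements that commute up to a subspace of coefficients -/

section SkewMonomials

open Submodule
open scoped Pointwise

variable {k K ι : Type*} [Field k] [Ring K] [Algebra k K]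

theorem mul_list_prod_le {E : Submodule k K} {l : List (Submodule k K)}
    (h : ∀ X ∈ l, E * X ≤ X * E) : E * l.prod ≤ l.prod * E := by
  induction l with
  | nil => simp
  | cons X l ih =>
    rw [List.prod_cons, ← mul_assoc]
    calc E * X * l.prod ≤ X * E * l.prod := mul_le_mul_left (h X (by simp)) _
      _ = X * (E * l.prod) := mul_assoc _ _ _
      _ ≤ X * (l.prod * E) := mul_le_mul_right (ih fun Y hY => h Y (by simp [hY])) _
      _ = _ := (mul_assoc _ _ _).symm

theorem mul_pow_le_pow_mul {E X : Submodule k K} (h : E * X ≤ X * E) (n : ℕ) :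
    E * X ^ n ≤ X ^ n * E := by
  have := mul_list_prod_le (E := E) (l := List.replicate n X)
    (fun Y hY => by rwa [List.eq_of_mem_replicate hY])
  simpa using this

/-- Elements `a i` that commute up to coefficients in a subalgebra `E` (given as a subspace),
past which `E` can be moved, and that generate `K` together with `E`. -/
structure SkewGenerated (E : Submodule k K) (a : ι → K) : Prop where
  one_le : 1 ≤ E
  mul_le : E * E ≤ E
  coeff_mul_le : ∀ i, E * span k {a i} ≤ span k {a i} * E
  swap_le : ∀ i j, span k {a j} * span k {a i} ≤ span k {a i} * span k {a j} * E
  adjoin_eq_top : Algebra.adjoin k ((E : Set K) ∪ Set.range a) = ⊤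

namespace SkewGenerated

variable {E : Submodule k K} {a : ι → K} (h : SkewGenerated E a)
include h

/-- The criterion behind the spanning results below: only left multiplication by the generators has
to be tested. -/
theorem eq_top_of_mul_le {T : Submodule k K} (h1 : 1 ≤ T) (hE : E * T ≤ T)
    (ha : ∀ i, span k {a i} * T ≤ T) : T = ⊤ := by
  rw [eq_top_iff]
  have key : ∀ x ∈ Algebra.adjoin k ((E : Set K) ∪ Set.range a), ∀ t ∈ T, x * t ∈ T := by
    intro x hx
    induction hx using Algebra.adjoin_induction with
    | mem x hx =>
      rintro t ht
      rcases hx with hx | ⟨i, rfl⟩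
      · exact hE (mul_mem_mul hx ht)
      · exact ha i (mul_mem_mul (mem_span_singleton_self _) ht)
    | algebraMap c => intro t ht; rw [← Algebra.smul_def]; exact T.smul_mem c ht
    | add x y _ _ hx hy => intro t ht; rw [add_mul]; exact T.add_mem (hx t ht) (hy t ht)
    | mul x y _ _ hx hy => intro t ht; rw [mul_assoc]; exact hx _ (hy t ht)
  intro x _
  have := key x (by rw [h.adjoin_eq_top]; trivial) 1 (Submodule.one_le.mp h1)
  rwa [mul_one] at this

theorem coeff_mul_powers_le (i : ι) :
    E * (⨆ n : ℕ, span k {a i} ^ n) ≤ (⨆ n : ℕ, span k {a i} ^ n) * E := by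
  rw [mul_iSup, iSup_mul]
  exact iSup_mono fun n => mul_pow_le_pow_mul (h.coeff_mul_le i) n

/-- Each swap of a_j with one a_i leaves a coefficient on the right; it is moved past the remaining
a_i and absorbed by E·E ≤ E. -/
theorem mul_powers_le (i j : ι) :
    span k {a j} * (⨆ n : ℕ, span k {a i} ^ n) ≤
      (⨆ n : ℕ, span k {a i} ^ n) * (span k {a j} * E) := by
  rw [mul_iSup, iSup_mul]
  refine iSup_mono fun n => ?_
  induction n with
  | zero =>
    simp only [pow_zero, mul_one, one_mul]
    calc span k {a j} = span k {a j} * 1 := (mul_one _).symm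
      _ ≤ _ := mul_le_mul_right h.one_le _
  | succ n ih =>
    calc span k {a j} * span k {a i} ^ (n + 1)
        = span k {a j} * span k {a i} ^ n * span k {a i} := by rw [pow_succ, mul_assoc]
      _ ≤ span k {a i} ^ n * (span k {a j} * E) * span k {a i} := mul_le_mul_left ih _
      _ = span k {a i} ^ n * span k {a j} * (E * span k {a i}) := by simp only [mul_assoc]
      _ ≤ span k {a i} ^ n * span k {a j} * (span k {a i} * E) :=
        mul_le_mul_right (h.coeff_mul_le i) _
      _ = span k {a i} ^ n * (span k {a j} * span k {a i}) * E := by simp only [mul_assoc]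
      _ ≤ span k {a i} ^ n * (span k {a i} * span k {a j} * E) * E :=
        mul_le_mul_left (mul_le_mul_right (h.swap_le i j) _) _
      _ = span k {a i} ^ (n + 1) * span k {a j} * (E * E) := by
        simp only [mul_assoc, pow_succ]
      _ ≤ span k {a i} ^ (n + 1) * span k {a j} * E := mul_le_mul_right h.mul_le _
      _ = _ := mul_assoc _ _ _

/-- Straightening: ordered monomials with coefficients on the right span K. A new a_j travels
through the factors, leaving coefficients behind, until it meets its own powers. The list may repeat
indices; it only has to contain all of them. -/
theorem list_prod_mul_eq_top (l : List ι) (hl : ∀ i, i ∈ l) :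
    (l.map fun i => ⨆ n : ℕ, span k {a i} ^ n).prod * E = ⊤ := by
  set A : ι → Submodule k K := fun i => ⨆ n : ℕ, span k {a i} ^ n with hA
  have hone : ∀ i, 1 ≤ A i := fun i =>
    le_iSup_of_le (f := fun n : ℕ => span k {a i} ^ n) 0 (by simp)
  have hE : ∀ l : List ι, E * ((l.map A).prod * E) ≤ (l.map A).prod * E := fun l => by
    rw [← mul_assoc]
    calc E * (l.map A).prod * E ≤ (l.map A).prod * E * E :=
          mul_le_mul_left (mul_list_prod_le fun X hX => by
            obtain ⟨i, -, rfl⟩ := List.mem_map.mp hX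
            exact h.coeff_mul_powers_le i) _
      _ = (l.map A).prod * (E * E) := mul_assoc _ _ _
      _ ≤ _ := mul_le_mul_right h.mul_le _
  refine h.eq_top_of_mul_le ?_ (hE l) fun j => ?_
  · clear hl
    induction l with
    | nil => simpa using h.one_le
    | cons i l ih =>
      rw [List.map_cons, List.prod_cons, mul_assoc]
      calc (1 : Submodule k K) = 1 * 1 := (mul_one _).symm
        _ ≤ _ := mul_le_mul' (hone i) ih
  · have hj := hl j
    clear hl
    induction l with
    | nil => simp at hj
    | cons i l ih =>
      rw [List.map_cons, List.prod_cons]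
      rcases eq_or_ne i j with rfl | hij
      · have : span k {a i} * A i ≤ A i := by
          rw [hA, mul_iSup]
          exact iSup_le fun n => le_iSup_of_le (n + 1) (by rw [pow_succ'])
        rw [← mul_assoc, ← mul_assoc]
        exact mul_le_mul_left (mul_le_mul_left this _) _
      · have hjl : j ∈ l := by simpa [hij.symm] using hj
        calc span k {a j} * (A i * (l.map A).prod * E)
            = span k {a j} * A i * ((l.map A).prod * E) := by simp only [mul_assoc]
          _ ≤ A i * (span k {a j} * E) * ((l.map A).prod * E) :=
            mul_le_mul_left (h.mul_powers_le i j) _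
          _ = A i * (span k {a j} * (E * ((l.map A).prod * E))) := by simp only [mul_assoc]
          _ ≤ A i * (span k {a j} * ((l.map A).prod * E)) :=
            mul_le_mul_right (mul_le_mul_right (hE l) _) _
          _ ≤ A i * ((l.map A).prod * E) := mul_le_mul_right (ih hjl) _
          _ = _ := (mul_assoc _ _ _).symm

/-- In an ordered monomial the exponent of a_i may be taken below N_i, so counting ordered monomials
bounds the dimension. -/
theorem exists_finset_span_eq_top [Fintype ι] {N : ι → ℕ} (hN : ∀ i, a i ^ N i = 0)
    {e : Finset K} (he : span k (e : Set K) = E) :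
    ∃ s : Finset K, span k (s : Set K) = ⊤ ∧ s.card ≤ (∏ i, N i) * e.card := by
  classical
  have hA : ∀ i, (⨆ n : ℕ, span k {a i} ^ n) ≤
      span k (((Finset.range (N i)).image fun n => a i ^ n : Finset K) : Set K) := fun i => by
    refine iSup_le fun n => ?_
    rw [span_pow, Set.singleton_pow, span_singleton_le_iff_mem]
    by_cases hn : n < N i
    · exact subset_span (by simpa using ⟨n, hn, rfl⟩)
    · rw [← Nat.sub_add_cancel (not_lt.mp hn), pow_add, hN, mul_zero]
      exact zero_mem _
  have key : ∀ l : List ι, ∃ s : Finset K,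
      (l.map fun i => ⨆ n : ℕ, span k {a i} ^ n).prod ≤ span k (s : Set K) ∧
        s.card ≤ (l.map N).prod := by
    intro l
    induction l with
    | nil => exact ⟨{1}, by simp [one_eq_span], by simp⟩
    | cons i l ih =>
      obtain ⟨s, hs, hc⟩ := ih
      refine ⟨(Finset.range (N i)).image (fun n => a i ^ n) * s, ?_, ?_⟩
      · rw [List.map_cons, List.prod_cons, Finset.coe_mul, ← span_mul_span]
        exact mul_le_mul' (hA i) hs
      · rw [List.map_cons, List.prod_cons]
        exact Finset.card_mul_le.trans
          (Nat.mul_le_mul (Finset.card_image_le.trans (by simp)) hc)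
  obtain ⟨s, hs, hc⟩ := key Finset.univ.toList
  refine ⟨s * e, ?_, Finset.card_mul_le.trans (Nat.mul_le_mul_right _ ?_)⟩
  · rw [eq_top_iff, Finset.coe_mul, ← span_mul_span, he,
      ← h.list_prod_mul_eq_top Finset.univ.toList (by simp)]
    exact mul_le_mul_left hs _
  · simpa using hc

/-- Reordering a word costs only coefficients, which collect on the right. -/
theorem list_prod_mul_le_of_perm {l l' : List ι} (hl : l.Perm l') :
    (l.map fun i => span k {a i}).prod * E ≤ (l'.map fun i => span k {a i}).prod * E := by
  induction hl with
  | nil => exact le_rfl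
  | cons i _ ih =>
    simp only [List.map_cons, List.prod_cons, mul_assoc]
    exact mul_le_mul_right ih _
  | swap i j l =>
    simp only [List.map_cons, List.prod_cons]
    set X := (l.map fun i => span k {a i}).prod
    have hX : E * X ≤ X * E := mul_list_prod_le fun Y hY => by
      obtain ⟨i, -, rfl⟩ := List.mem_map.mp hY
      exact h.coeff_mul_le i
    calc span k {a j} * (span k {a i} * X) * E = span k {a j} * span k {a i} * (X * E) := by
          simp only [mul_assoc]
      _ ≤ span k {a i} * span k {a j} * E * (X * E) := mul_le_mul_left (h.swap_le i j) _
      _ = span k {a i} * span k {a j} * (E * X * E) := by simp only [mul_assoc]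
      _ ≤ span k {a i} * span k {a j} * (X * E * E) :=
        mul_le_mul_right (mul_le_mul_left hX _) _
      _ = span k {a i} * span k {a j} * X * (E * E) := by simp only [mul_assoc]
      _ ≤ span k {a i} * span k {a j} * X * E := mul_le_mul_right h.mul_le _
      _ = _ := by simp only [mul_assoc]
  | trans _ _ h₁ h₂ => exact h₁.trans h₂

/-- Pigeonhole: a word this long contains some a_i at least N_i times, and after reordering these
letters stand together. The `+ 1` covers the empty index type, where the zeroth power would be 1. -/
theorem iSup_pow_eq_bot [Fintype ι] {N : ι → ℕ} (hN : ∀ i, a i ^ N i = 0) :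
    (⨆ i, span k {a i}) ^ (∑ i, N i + 1) = ⊥ := by
  classical
  have hword : ∀ n, (⨆ i, span k {a i}) ^ n ≤
      ⨆ l : {l : List ι // l.length = n}, (l.1.map fun i => span k {a i}).prod := by
    intro n
    induction n with
    | zero => exact le_iSup_of_le ⟨[], rfl⟩ (by simp)
    | succ n ih =>
      rw [pow_succ']
      refine (mul_le_mul_right ih _).trans ?_
      rw [iSup_mul]
      refine iSup_le fun i => ?_
      rw [mul_iSup]
      refine iSup_le fun l => le_iSup_of_le ⟨i :: l.1, by simp [l.2]⟩ (by simp)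
  rw [eq_bot_iff]
  refine (hword _).trans (iSup_le fun ⟨l, hl⟩ => ?_)
  have hex : ∃ i, N i ≤ l.count i := by
    by_contra! hcon
    have h1 : l.length = ∑ i, l.count i := by
      simpa using (Multiset.sum_count_eq_card (s := Finset.univ) (m := (l : Multiset ι))
        (by simp)).symm
    have h2 : ∑ i, l.count i ≤ ∑ i, N i := Finset.sum_le_sum fun i _ => (hcon i).le
    omega
  obtain ⟨i, hi⟩ := hex
  have hsub : List.Sublist (List.replicate (N i) i) l :=
    (List.replicate_sublist_iff.mpr hi)
  obtain ⟨l', hl'⟩ := hsub.exists_perm_append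
  calc (l.map fun i => span k {a i}).prod = (l.map fun i => span k {a i}).prod * 1 :=
        (mul_one _).symm
    _ ≤ (l.map fun i => span k {a i}).prod * E := mul_le_mul_right h.one_le _
    _ ≤ _ := h.list_prod_mul_le_of_perm hl'
    _ = ⊥ := by
      have : span k {a i} ^ N i = ⊥ := by
        rw [span_pow, Set.singleton_pow, hN, span_singleton_eq_bot.mpr rfl]
      simp [this]

/-- With Y the span of the a_i, the right ideal YK has the coefficients as a supplement; for kQ/I
this gives the semisimple quotient. -/
theorem coeff_sup_eq_top : E ⊔ (⨆ i, span k {a i}) * ⊤ = ⊤ := by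
  have hY : E * (⨆ i, span k {a i}) ≤ (⨆ i, span k {a i}) * E := by
    rw [mul_iSup, iSup_mul]
    exact iSup_mono fun i => h.coeff_mul_le i
  refine h.eq_top_of_mul_le (h.one_le.trans le_sup_left) ?_ fun i => ?_
  · rw [Submodule.mul_sup]
    refine sup_le_sup h.mul_le ?_
    rw [← mul_assoc]
    refine (mul_le_mul_left hY _).trans ?_
    rw [mul_assoc]
    exact mul_le_mul_right le_top _
  · exact (mul_le_mul' (le_iSup (fun i => span k {a i}) i) le_top).trans le_sup_right

/-- This makes YK a two-sided ideal, so that its powers reduce to powers of Y. -/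
theorem top_mul_le : ⊤ * (⨆ i, span k {a i}) ≤ (⨆ i, span k {a i}) * ⊤ := by
  have hY : E * (⨆ i, span k {a i}) ≤ (⨆ i, span k {a i}) * E := by
    rw [mul_iSup, iSup_mul]
    exact iSup_mono fun i => h.coeff_mul_le i
  conv_lhs => rw [← h.coeff_sup_eq_top, Submodule.sup_mul]
  refine sup_le (hY.trans (mul_le_mul_right le_top _)) ?_
  rw [mul_assoc]
  exact mul_le_mul_right le_top _

theorem radical_pow_eq_bot [Fintype ι] {N : ι → ℕ} (hN : ∀ i, a i ^ N i = 0) :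
    ((⨆ i, span k {a i}) * ⊤) ^ (∑ i, N i + 1) = ⊥ := by
  have : ∀ n, ((⨆ i, span k {a i}) * ⊤) ^ n ≤ (⨆ i, span k {a i}) ^ n * ⊤ := by
    intro n
    induction n with
    | zero => simp
    | succ n ih =>
      set Y := ⨆ i, span k {a i}
      calc (Y * ⊤) ^ (n + 1) = (Y * ⊤) ^ n * (Y * ⊤) := pow_succ _ _
        _ ≤ Y ^ n * ⊤ * (Y * ⊤) := mul_le_mul_left ih _
        _ = Y ^ n * (⊤ * Y) * ⊤ := by simp only [mul_assoc]
        _ ≤ Y ^ n * (Y * ⊤) * ⊤ := mul_le_mul_left (mul_le_mul_right h.top_mul_le _) _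
        _ = Y ^ (n + 1) * (⊤ * ⊤) := by simp only [mul_assoc, pow_succ]
        _ ≤ _ := mul_le_mul_right le_top _
  rw [eq_bot_iff]
  refine (this _).trans ?_
  rw [h.iSup_pow_eq_bot hN, bot_mul]

end SkewGenerated

end SkewMonomials


/-! ### Basic algebras: recognition and uniqueness -/

section Basic

variable {k : Type*} [Field k]

theorem mem_jacobson_iff_of_nil_ker {A V : Type*} [Ring A] [Algebra k A] (f : A →ₐ[k] (V → k))
    (hnil : ∀ x, f x = 0 → IsNilpotent x) (x : A) : f x = 0 ↔ x ∈ Ring.jacobson A := by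
  rw [← Ideal.jacobson_bot, Ideal.mem_jacobson_iff]
  constructor
  · intro hx y
    obtain ⟨u, hu⟩ := (hnil (y * x) (by rw [map_mul, hx, mul_zero])).isUnit_one_add
    refine ⟨(u⁻¹ : Aˣ), ?_⟩
    have : (u⁻¹ : Aˣ) * (1 + y * x) = 1 := by rw [← hu, Units.inv_mul]
    rw [Ideal.mem_bot, mul_assoc, sub_eq_zero, ← this, mul_add, mul_one, add_comm]
  · intro hx
    by_contra hne
    obtain ⟨v, hv⟩ := Function.ne_iff.mp hne
    -- This scalar makes the v-th coordinate of 1 + yx vanish, so 1 + yx cannot have a left inverse.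
    obtain ⟨z, hz⟩ := hx (algebraMap k A (-(f x v)⁻¹))
    have := congrFun (congrArg f ((Ideal.mem_bot).mp hz)) v
    simp only [map_sub, map_add, map_mul, AlgHom.commutes, map_one, map_zero, Pi.sub_apply,
      Pi.add_apply, Pi.mul_apply, Pi.one_apply, Pi.zero_apply, Pi.algebraMap_apply,
      Algebra.algebraMap_self, RingHom.id_apply] at this hv
    rw [mul_assoc, neg_mul, inv_mul_cancel₀ hv] at this
    simp at this

theorem isBasic_of_nil_ker {A V : Type*} [Ring A] [Algebra k A] [Module.Finite k A] [Finite V]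
    (f : A →ₐ[k] (V → k)) (hf : Function.Surjective f) (hnil : ∀ x, f x = 0 → IsNilpotent x) :
    IsBasic k A := by
  obtain ⟨n, ⟨σ⟩⟩ := Finite.exists_equiv_fin V
  let e : (V → k) ≃ₐ[k] (Fin n → k) := AlgEquiv.piCongrLeft k (fun _ => k) σ
  refine ⟨inferInstance, n, (e : (V → k) →ₐ[k] (Fin n → k)).comp f, e.surjective.comp hf,
    fun x => ?_⟩
  rw [← mem_jacobson_iff_of_nil_ker f hnil]
  exact map_eq_zero_iff e e.injective

theorem isNilpotent_of_mem_jacobson {A : Type*} [Ring A] [Algebra k A] [Module.Finite k A] {x : A}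
    (hx : x ∈ Ring.jacobson A) : IsNilpotent x := by
  have : IsArtinianRing A := IsArtinianRing.of_finite k A
  obtain ⟨n, hn⟩ := IsSemiprimaryRing.isNilpotent (R := A)
  exact ⟨n, by simpa [hn] using Ideal.pow_mem_pow hx n⟩

theorem corner_mul_eq {Λ : Type*} [Ring Λ] {ε x s : Λ} (hε : IsIdempotentElem ε)
    (hx : x = ε * s * ε) : ε * x = x ∧ x * ε = x := by
  rw [hx]
  refine ⟨?_, ?_⟩
  · rw [← mul_assoc, ← mul_assoc, hε.eq]
  · rw [mul_assoc, hε.eq]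

/-- Corners at equivalent idempotents are isomorphic. -/
theorem nonempty_algEquiv_of_corners {Λ A B : Type*} [Ring Λ] [Algebra k Λ] [Ring A] [Algebra k A]
    [Ring B] [Algebra k B] {x y : Λ} (f : A →ₙₐ[k] Λ) (g : B →ₙₐ[k] Λ)
    (hf : Function.Injective f) (hg : Function.Injective g)
    (hx : IsIdempotentElem (x * y)) (hy : IsIdempotentElem (y * x))
    (hfr : Set.range f = {t | ∃ s, t = x * y * s * (x * y)})
    (hgr : Set.range g = {t | ∃ s, t = y * x * s * (y * x)}) : Nonempty (A ≃ₐ[k] B) := by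
  have hfa : ∀ a, x * y * f a = f a ∧ f a * (x * y) = f a := fun a => by
    obtain ⟨s, hs⟩ : f a ∈ {t | ∃ s, t = x * y * s * (x * y)} := hfr ▸ ⟨a, rfl⟩
    exact corner_mul_eq hx hs
  have hgb : ∀ b, y * x * g b = g b ∧ g b * (y * x) = g b := fun b => by
    obtain ⟨s, hs⟩ : g b ∈ {t | ∃ s, t = y * x * s * (y * x)} := hgr ▸ ⟨b, rfl⟩
    exact corner_mul_eq hy hs
  -- The isomorphism is t ↦ ytx with inverse t ↦ xty; it is multiplicative because xy is the
  -- identity of its corner.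
  have hex : ∀ a, ∃ b, g b = y * f a * x := fun a => by
    have : y * f a * x ∈ Set.range g := by
      rw [hgr]
      refine ⟨y * f a * x, ?_⟩
      calc y * f a * x = y * (x * y * f a * (x * y)) * x := by rw [(hfa a).1, (hfa a).2]
        _ = _ := by simp only [mul_assoc]
    exact this
  choose σ hσ using hex
  have hmul : ∀ a a', σ (a * a') = σ a * σ a' := fun a a' => hg (by
    rw [map_mul, hσ, hσ, hσ, map_mul]
    calc y * (f a * f a') * x = y * (f a * (x * y) * f a') * x := by rw [(hfa a).2]
      _ = _ := by simp only [mul_assoc])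
  let τ : A →ₗ[k] B :=
    { toFun := σ
      map_add' := fun a a' => hg (by simp only [map_add, hσ, mul_add, add_mul])
      map_smul' := fun c a => hg (by
        simp only [map_smul, hσ, mul_smul_comm, smul_mul_assoc, RingHom.id_apply]) }
  have hinj : Function.Injective τ := fun a a' h => hf (by
    have h' : y * f a * x = y * f a' * x := by rw [← hσ, ← hσ]; exact congrArg g h
    calc f a = x * y * f a * (x * y) := by rw [(hfa a).1, (hfa a).2]
      _ = x * (y * f a * x) * y := by simp only [mul_assoc]
      _ = x * y * f a' * (x * y) := by rw [h']; simp only [mul_assoc]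
      _ = f a' := by rw [(hfa a').1, (hfa a').2])
  have hsurj : Function.Surjective τ := fun b => by
    have : x * g b * y ∈ Set.range f := by
      rw [hfr]
      refine ⟨x * g b * y, ?_⟩
      calc x * g b * y = x * (y * x * g b * (y * x)) * y := by rw [(hgb b).1, (hgb b).2]
        _ = _ := by simp only [mul_assoc]
    obtain ⟨a, ha⟩ := this
    refine ⟨a, hg ((hσ a).trans ?_)⟩
    rw [ha]
    calc y * (x * g b * y) * x = y * x * g b * (y * x) := by simp only [mul_assoc]
      _ = g b := by rw [(hgb b).1, (hgb b).2]
  refine ⟨AlgEquiv.ofLinearEquiv (LinearEquiv.ofBijective τ ⟨hinj, hsurj⟩) ?_ hmul⟩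
  -- The embeddings are non-unital, so preservation of 1 is deduced from surjectivity: apply τ to
  -- a·1 where τ(a) = 1.
  obtain ⟨a, ha⟩ := hsurj 1
  have h1 : τ (a * 1) = τ a * τ 1 := hmul a 1
  rw [mul_one, ha, one_mul] at h1
  exact h1.symm

/-- Equivalence of idempotents can be lifted modulo a nil kernel. -/
theorem exists_mul_eq_of_map {Λ B : Type*} [Ring Λ] [Ring B] (π : Λ →+* B)
    (hnil : ∀ x, π x = 0 → IsNilpotent x) {ε ε' x₀ y₀ : Λ} (hε : IsIdempotentElem ε)
    (hε' : IsIdempotentElem ε') (h : π x₀ * π y₀ = π ε) (h' : π y₀ * π x₀ = π ε') :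
    ∃ x y, x * y = ε ∧ y * x = ε' := by
  have hbε : π ε * π ε = π ε := by rw [← map_mul, hε.eq]
  have hbε' : π ε' * π ε' = π ε' := by rw [← map_mul, hε'.eq]
  set x := ε * x₀ * ε' with hx
  set y := ε' * y₀ * ε with hy
  have hεx : ε * x = x := by rw [hx, ← mul_assoc, ← mul_assoc, hε.eq]
  have hxε : x * ε' = x := by rw [hx, mul_assoc, hε'.eq]
  have hεy : ε' * y = y := by rw [hy, ← mul_assoc, ← mul_assoc, hε'.eq]
  have hyε : y * ε = y := by rw [hy, mul_assoc, hε.eq]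
  have hπx : π x = π x₀ * π ε' := by
    rw [hx, map_mul, map_mul, ← h, mul_assoc (π x₀) (π y₀), h', mul_assoc, hbε']
  have hπy : π y = π y₀ * π ε := by
    rw [hy, map_mul, map_mul, ← h', mul_assoc (π y₀) (π x₀), h, mul_assoc, hbε]
  have hxy : π x * π y = π ε := by
    rw [hπx, hπy, ← h', ← mul_assoc, ← mul_assoc, h, mul_assoc (π ε), h, hbε, hbε]
  have hyx : π y * π x = π ε' := by
    rw [hπx, hπy, ← h, ← mul_assoc, ← mul_assoc, h', mul_assoc (π ε'), h', hbε', hbε']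
  have hn : π (ε - x * y) = 0 := by rw [map_sub, map_mul, hxy, sub_self]
  -- With u = 1 − (ε − xy) one has εu = xy, so replacing y by yu⁻¹ turns the congruence xy ≡ ε into
  -- an equality.
  obtain ⟨u, hu⟩ := (hnil _ hn).isUnit_one_sub
  have hεu : ε * u = x * y := by
    rw [hu, mul_sub, mul_sub, mul_one, hε.eq, ← mul_assoc, hεx, sub_sub_cancel]
  have hπu : π (u⁻¹ : Λˣ) = 1 := by
    have h1 : π u = 1 := by rw [hu, map_sub, hn, map_one, sub_zero]
    have h2 : π u * π (u⁻¹ : Λˣ) = 1 := by rw [← map_mul, Units.mul_inv, map_one]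
    rwa [h1, one_mul] at h2
  have h1 : x * (y * (u⁻¹ : Λˣ)) = ε := by
    rw [← mul_assoc, ← hεu, mul_assoc, Units.mul_inv, mul_one]
  refine ⟨x, y * (u⁻¹ : Λˣ), h1, ?_⟩
  set d := y * (u⁻¹ : Λˣ) * x with hd
  have hdd : d * d = d := by
    calc d * d = y * (u⁻¹ : Λˣ) * (x * (y * (u⁻¹ : Λˣ)) * x) := by
          simp only [hd, mul_assoc]
      _ = d := by rw [h1, hεx]
  have hed : ε' * d = d := by rw [hd, mul_assoc y, ← mul_assoc, hεy]
  have hde : d * ε' = d := by rw [hd, mul_assoc, hxε]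
  -- The other product d is an idempotent below ε'. The difference ε' − d is idempotent and lies in
  -- the nil kernel, hence is zero.
  have hid : IsIdempotentElem (ε' - d) := by
    unfold IsIdempotentElem
    rw [mul_sub, sub_mul, sub_mul, hε'.eq, hdd, hed, hde, sub_self, sub_zero]
  have hπd : π (ε' - d) = 0 := by
    rw [map_sub, hd, map_mul, map_mul, hπu, mul_one, hyx, sub_self]
  obtain ⟨n, hn⟩ := hnil _ hπd
  have : ε' - d = 0 := by
    have h3 := hid.pow_succ_eq n
    rw [pow_succ, hn, zero_mul] at h3
    exact h3.symm
  exact (sub_eq_zero.mp this).symm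

/-- An idempotent matrix over a field with commutative corner has rank at most one. -/
theorem exists_rank_one_of_commutative_corner {m : Type*} [Fintype m] [DecidableEq m]
    {ε : Matrix m m k} (hε : IsIdempotentElem ε) (h0 : ε ≠ 0)
    (hcomm : ∀ a b, ε * a * ε * b * ε = ε * b * ε * a * ε) (i₀ : m) :
    ∃ x y : Matrix m m k, x * y = ε ∧ y * x = Matrix.single i₀ i₀ 1 := by
  -- Commutativity of the corner is tested on matrix units only.
  have hentry : ∀ x s t u v y, ε x s * ε t u * ε v y = ε x u * ε v s * ε t y := by
    intro x s t u v y
    have := congrFun (congrFun (hcomm (Matrix.single s t 1) (Matrix.single u v 1)) x) y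
    have aux : ∀ s t u v,
        (ε * Matrix.single s t (1 : k) * ε * Matrix.single u v (1 : k) * ε) x y =
        ε x s * ε t u * ε v y := by
      intro s t u v
      rw [mul_assoc ε, mul_assoc ε, Matrix.single_mul_mul_single, mul_assoc, Matrix.mul_apply,
        Finset.sum_eq_single s]
      · rw [Matrix.single_mul_apply_same]; ring
      · intro b _ hb
        rw [Matrix.single_mul_apply_of_ne _ _ _ _ _ hb, mul_zero]
      · simp
    rwa [aux, aux] at this
  obtain ⟨t, u, hc⟩ : ∃ t u, ε t u ≠ 0 := by
    by_contra! hcon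
    exact h0 (Matrix.ext hcon)
  -- Around a non-zero entry at (t, u), ε is column u times a scaled row t; these are the two
  -- factors sought.
  have hrank : ∀ x s, ε x s = ε x u * ((ε t u)⁻¹ * ε t s) := by
    intro x s
    have := hentry x s t u t u
    field_simp
    apply mul_right_cancel₀ hc
    linear_combination this
  refine ⟨Matrix.of fun x j => if j = i₀ then ε x u else 0,
    Matrix.of fun j s => if j = i₀ then (ε t u)⁻¹ * ε t s else 0, ?_, ?_⟩
  · ext x s
    rw [Matrix.mul_apply, hrank x s]
    simp
  · ext i j
    rw [Matrix.mul_apply]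
    have hid : ∑ s, ε t s * ε s u = ε t u := by
      rw [← Matrix.mul_apply, hε.eq]
    by_cases hi : i = i₀
    · by_cases hj : j = i₀
      · subst hi; subst hj
        simp only [Matrix.of_apply, if_true, Matrix.single_apply_same, mul_assoc]
        rw [← Finset.mul_sum, hid, inv_mul_cancel₀ hc]
      · simp [hj, Matrix.single_apply_of_ne, Ne.symm hj]
    · simp [hi, Matrix.single_apply_of_ne, Ne.symm hi]

/-- A corner of a matrix algebra has no non-zero left ideals consisting of nilpotent elements. -/
theorem eq_zero_of_nilpotent_corner {m : Type*} [Fintype m] [DecidableEq m]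
    {ε y : Matrix m m k} (hy : ε * y = y) (hy' : y * ε = y)
    (hnil : ∀ a, IsNilpotent (ε * a * ε * y)) : y = 0 := by
  ext i j
  by_contra hij
  -- This matrix unit satisfies eye = y_{ij}e, hence M² = y_{ij}M for M = εeεy. With y_{ij} ≠ 0,
  -- nilpotency gives M = 0, and then ey = 0, a contradiction.
  set e : Matrix m m k := Matrix.single j i 1
  have hyey : e * y * e = y i j • e := by
    rw [Matrix.single_mul_mul_single, one_mul, mul_one, Matrix.smul_single, smul_eq_mul, mul_one]
  set M := ε * e * ε * y with hM
  have hM' : M = ε * (e * y) := by rw [hM, mul_assoc, hy, mul_assoc]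
  have hMM : M * M = y i j • M := by
    calc M * M = ε * (e * (y * ε) * e) * y := by rw [hM']; simp only [mul_assoc]
      _ = y i j • M := by
        rw [hy', hyey, hM', mul_smul_comm, smul_mul_assoc, mul_assoc]
  have hpow : ∀ n, M ^ (n + 1) = (y i j) ^ n • M := by
    intro n
    induction n with
    | zero => simp
    | succ n ih => rw [pow_succ, ih, smul_mul_assoc, hMM, smul_smul, pow_succ]
  obtain ⟨n, hn⟩ := hnil e
  have hM0 : M = 0 := by
    have := hpow n
    rw [pow_succ, hn, zero_mul] at this
    exact (smul_eq_zero.mp this.symm).resolve_left (pow_ne_zero _ hij)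
  have h1 : e * (y * M) = 0 := by rw [hM0, mul_zero, mul_zero]
  rw [hM', ← mul_assoc y, hy', ← mul_assoc y, ← mul_assoc, ← mul_assoc, hyey, smul_mul_assoc] at h1
  have h2 : e * y = 0 := (smul_eq_zero.mp h1).resolve_left hij
  have h3 := hyey
  rw [h2, zero_mul] at h3
  have h4 := congrFun (congrFun h3 j) i
  simp [e] at h4
  exact hij h4.symm

/-- Uniqueness of the basic algebra. In every matrix factor the image of ε is non-zero because ε is
full, and has commutative corner because A is commutative modulo its radical. So it has rank one and
is equivalent to the image of ε'; the equivalence lifts and identifies the corners. -/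
theorem nonempty_algEquiv_of_isBasicAlgebraOf {Λ A B V m : Type*} [Ring Λ] [Algebra k Λ] [Ring A]
    [Algebra k A] [Ring B] [Algebra k B] [Fintype m] [DecidableEq m] (hA : IsBasicAlgebraOf k Λ A)
    (π : Λ →ₐ[k] (V → Matrix m m k)) (hπ : Function.Surjective π)
    (hnil : ∀ x, π x = 0 → IsNilpotent x) {ε' : Λ} (hε' : IsIdempotentElem ε') (i₀ : m)
    (hπε' : ∀ v, π ε' v = Matrix.single i₀ i₀ 1) (g : B →ₙₐ[k] Λ) (hg : Function.Injective g)
    (hgr : Set.range g = {x | ∃ y, x = ε' * y * ε'}) : Nonempty (A ≃ₐ[k] B) := by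
  obtain ⟨⟨_, n, fA, hfA, hfAj⟩, ε, hε, hfull, f, hf, hfr⟩ := hA
  have hfa : ∀ a, ε * f a = f a ∧ f a * ε = f a := fun a => by
    obtain ⟨s, hs⟩ : f a ∈ {x | ∃ y, x = ε * y * ε} := hfr ▸ ⟨a, rfl⟩
    exact corner_mul_eq hε hs
  have hlift : ∀ x, ∃ a, f a = ε * x * ε := fun x => by
    have : ε * x * ε ∈ Set.range f := hfr ▸ ⟨x, rfl⟩
    exact this
  -- The radical of A is a nil left ideal, and a corner of a matrix algebra over a field has no
  -- non-zero one.
  have hjac : ∀ a, fA a = 0 → π (f a) = 0 := by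
    intro a ha
    funext v
    refine eq_zero_of_nilpotent_corner (ε := π ε v) ?_ ?_ fun M => ?_
    · rw [← Pi.mul_apply, ← map_mul, (hfa a).1]
    · rw [← Pi.mul_apply, ← map_mul, (hfa a).2]
    · obtain ⟨M', hM'⟩ := hπ (fun _ => M)
      obtain ⟨b, hb⟩ := hlift M'
      have hba : IsNilpotent (b * a) :=
        isNilpotent_of_mem_jacobson (k := k) ((hfAj _).mp (by rw [map_mul, ha, mul_zero]))
      have h1 : π ε v * M * π ε v * π (f a) v = π (f (b * a)) v := by
        rw [map_mul f, hb, map_mul, map_mul, map_mul, hM']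
        rfl
      obtain ⟨N, hN⟩ := hba
      refine ⟨N + 1, ?_⟩
      -- Exponents start at 1 because f need not preserve the unit.
      have h2 : ∀ c n, (π (f c) v) ^ (n + 1) = π (f (c ^ (n + 1))) v := by
        intro c n
        induction n with
        | zero => simp
        | succ n ih => rw [pow_succ, ih, pow_succ c (n + 1), map_mul f, map_mul, Pi.mul_apply]
      rw [h1, h2, pow_succ, hN, zero_mul, map_zero, map_zero, Pi.zero_apply]
  have hcomm : ∀ v a b, π ε v * a * π ε v * b * π ε v = π ε v * b * π ε v * a * π ε v := by
    intro v a b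
    obtain ⟨a', ha'⟩ := hπ fun _ => a
    obtain ⟨b', hb'⟩ := hπ fun _ => b
    obtain ⟨c, hc⟩ := hlift a'
    obtain ⟨d, hd⟩ := hlift b'
    have h1 : π (f (c * d)) = π (f (d * c)) := by
      rw [← sub_eq_zero, ← map_sub, ← map_sub]
      exact hjac _ (by rw [map_sub, map_mul, map_mul, mul_comm, sub_self])
    have h2 : ∀ x y, ε * x * ε * (ε * y * ε) = ε * x * ε * y * ε := fun x y => by
      calc ε * x * ε * (ε * y * ε) = ε * x * (ε * ε) * y * ε := by simp only [mul_assoc]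
        _ = _ := by rw [hε.eq]
    rw [map_mul f, map_mul f, hc, hd, h2, h2] at h1
    simp only [map_mul, ha', hb'] at h1
    exact congrFun h1 v
  have hne : ∀ v, π ε v ≠ 0 := by
    intro v h0
    have hle : TwoSidedIdeal.span {ε} ≤
        TwoSidedIdeal.ker ((Pi.evalRingHom (fun _ : V => Matrix m m k) v).comp (π : Λ →+* _)) := by
      rw [TwoSidedIdeal.span_le, Set.singleton_subset_iff]
      exact (TwoSidedIdeal.mem_ker _).mpr h0
    rw [hfull] at hle
    have h1 := (TwoSidedIdeal.mem_ker _).mp (hle (show (1 : Λ) ∈ ⊤ from trivial))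
    have h2 : (1 : Matrix m m k) = 0 := by simpa using h1
    have h3 := congrFun (congrFun h2 i₀) i₀
    simp at h3
  choose x y hxy hyx using fun v => exists_rank_one_of_commutative_corner (ε := π ε v)
    (by unfold IsIdempotentElem; rw [← Pi.mul_apply, ← map_mul, hε.eq]) (hne v) (hcomm v) i₀
  obtain ⟨x₀, hx₀⟩ := hπ x
  obtain ⟨y₀, hy₀⟩ := hπ y
  obtain ⟨x', y', h1, h2⟩ := exists_mul_eq_of_map (π : Λ →+* _) hnil hε hε' (x₀ := x₀) (y₀ := y₀)
    (by
      change π x₀ * π y₀ = π ε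
      rw [hx₀, hy₀]; exact funext hxy)
    (by
      change π y₀ * π x₀ = π ε'
      rw [hx₀, hy₀]; exact funext fun v => (hyx v).trans (hπε' v).symm)
  subst h1 h2
  exact nonempty_algEquiv_of_corners f g hf hg hε hε' hfr hgr

end Basic

/-! ### Full matrix algebras and their corners at diagonal matrix units -/

section MatrixAlgebra

variable {k Λ K : Type*} [Field k] [Ring Λ] [Algebra k Λ] [Ring K] [Algebra k K] {m : ℕ}

/-- The embedding of `K` as the corner of a full matrix algebra at a diagonal matrix unit. -/
def cornerEmbedding (i₀ : Fin m) (e : Λ ≃ₐ[k] Matrix (Fin m) (Fin m) K) : K →ₙₐ[k] Λ where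
  toFun c := e.symm (Matrix.single i₀ i₀ c)
  map_smul' r c := by
    rw [← Matrix.smul_single, map_smul]; rfl
  map_zero' := by rw [Matrix.single_zero, map_zero]
  map_add' c d := by rw [Matrix.single_add, map_add]
  map_mul' c d := by rw [← map_mul, Matrix.single_mul_single_same]

theorem cornerEmbedding_injective (i₀ : Fin m) (e : Λ ≃ₐ[k] Matrix (Fin m) (Fin m) K) :
    Function.Injective (cornerEmbedding i₀ e) :=
  fun c d h => by
    have := congrFun (congrFun (e.symm.injective h) i₀) i₀
    simpa using this

theorem range_cornerEmbedding (i₀ : Fin m) (e : Λ ≃ₐ[k] Matrix (Fin m) (Fin m) K) :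
    Set.range (cornerEmbedding i₀ e) = {x | ∃ y, x = e.symm (Matrix.single i₀ i₀ 1) * y *
      e.symm (Matrix.single i₀ i₀ 1)} := by
  ext x
  constructor
  · rintro ⟨c, rfl⟩
    refine ⟨e.symm (Matrix.single i₀ i₀ c), ?_⟩
    rw [← map_mul, ← map_mul, Matrix.single_mul_single_same, Matrix.single_mul_single_same,
      one_mul, mul_one]
    rfl
  · rintro ⟨y, rfl⟩
    refine ⟨e y i₀ i₀, ?_⟩
    change e.symm _ = _
    apply e.injective
    rw [map_mul, map_mul, e.apply_symm_apply, e.apply_symm_apply, Matrix.single_mul_mul_single,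
      one_mul, mul_one]

theorem isIdempotentElem_symm_single (i₀ : Fin m) (e : Λ ≃ₐ[k] Matrix (Fin m) (Fin m) K) :
    IsIdempotentElem (e.symm (Matrix.single i₀ i₀ 1)) := by
  unfold IsIdempotentElem
  rw [← map_mul, Matrix.single_mul_single_same, one_mul]

theorem isBasicAlgebraOf_of_algEquiv_matrix (hK : IsBasic k K) (i₀ : Fin m)
    (e : Λ ≃ₐ[k] Matrix (Fin m) (Fin m) K) : IsBasicAlgebraOf k Λ K := by
  refine ⟨hK, e.symm (Matrix.single i₀ i₀ 1), isIdempotentElem_symm_single i₀ e, ?_,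
    cornerEmbedding i₀ e, cornerEmbedding_injective i₀ e, range_cornerEmbedding i₀ e⟩
  rw [← TwoSidedIdeal.one_mem_iff]
  -- Fullness of a diagonal matrix unit: 1 is the sum of the products E_{i,i₀} E_{i₀,i₀} E_{i₀,i}.
  have h1 : (1 : Λ) = ∑ i, e.symm (Matrix.single i i₀ 1) * e.symm (Matrix.single i₀ i₀ 1) *
      e.symm (Matrix.single i₀ i 1) := by
    apply e.injective
    simp only [map_one, map_sum, map_mul, e.apply_symm_apply, Matrix.single_mul_single_same,
      mul_one]
    exact (Matrix.sum_single_one).symm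
  rw [h1]
  refine sum_mem fun i _ => ?_
  exact TwoSidedIdeal.mul_mem_right _ _ _ (TwoSidedIdeal.mul_mem_left _ _ _
    (TwoSidedIdeal.subset_span rfl))

/-- Apply the augmentation entrywise to map Λ onto a product of matrix algebras over k. A matrix in
the kernel has entries in N, so its n-th power has entries in Nⁿ and the kernel is nil. -/
theorem nonempty_algEquiv_of_algEquiv_matrix {A V : Type*} [Ring A] [Algebra k A]
    (hA : IsBasicAlgebraOf k Λ A) (i₀ : Fin m) (e : Λ ≃ₐ[k] Matrix (Fin m) (Fin m) K)
    (aug : K →ₐ[k] (V → k)) (haug : Function.Surjective aug) {N : Submodule k K}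
    (hker : ∀ x, aug x = 0 → x ∈ N) {d : ℕ} (hN : N ^ d = ⊥) : Nonempty (A ≃ₐ[k] K) := by
  let ev : V → K →ₐ[k] k := fun v => (Pi.evalAlgHom k (fun _ => k) v).comp aug
  let π : Λ →ₐ[k] (V → Matrix (Fin m) (Fin m) k) :=
    (AlgHom.pi fun v => (ev v).mapMatrix).comp (e : Λ →ₐ[k] Matrix (Fin m) (Fin m) K)
  have hπ : ∀ x v i j, π x v i j = aug (e x i j) v := fun x v i j => rfl
  refine nonempty_algEquiv_of_isBasicAlgebraOf hA π ?_ ?_ (isIdempotentElem_symm_single i₀ e) i₀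
    ?_ (cornerEmbedding i₀ e) (cornerEmbedding_injective i₀ e) (range_cornerEmbedding i₀ e)
  · intro M
    choose c hc using fun i j => haug fun v => M v i j
    refine ⟨e.symm (Matrix.of c), ?_⟩
    ext v i j
    rw [hπ, e.apply_symm_apply, Matrix.of_apply, hc]
  · intro x hx
    refine ⟨d, e.injective ?_⟩
    rw [map_pow, map_zero]
    have hmem : ∀ n i j, ((e x) ^ n) i j ∈ N ^ n := by
      intro n
      induction n with
      | zero =>
        intro i j
        rw [pow_zero, pow_zero, Matrix.one_apply]
        split_ifs
        · exact Submodule.one_le.mp le_rfl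
        · exact zero_mem _
      | succ n ih =>
        intro i j
        rw [pow_succ, pow_succ, Matrix.mul_apply]
        refine sum_mem fun l _ => Submodule.mul_mem_mul (ih i l) (hker _ ?_)
        funext v
        rw [← hπ, hx]
        rfl
    ext i j
    simpa [hN] using hmem d i j
  · intro v
    ext i j
    rw [hπ, e.apply_symm_apply, Matrix.single_apply, Matrix.single_apply]
    split_ifs <;> simp

end MatrixAlgebra


/-! ### Linear characters of finite abelian groups of order invertible in the field -/

section Characters

/-- A group with commutative multiplication, as a `CommGroup`. -/
abbrev commGroupOfIsMulCommutative (G : Type*) [Group G] [IsMulCommutative G] : CommGroup G :=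
  { (inferInstance : Group G) with mul_comm := fun a b => IsMulCommutative.is_comm.comm a b }

variable {k : Type*} [Field k]

/-- An element of order p would go to a p-th root of unity in characteristic p, which is 1, against
faithfulness. -/
theorem natCast_card_ne_zero_of_injective (p : ℕ) [Fact p.Prime] [CharP k p] {Z : Type*} [Group Z]
    [Finite Z] {χ : Z →* kˣ} (hχ : Function.Injective χ) : (Nat.card Z : k) ≠ 0 := by
  rw [Ne, CharP.cast_eq_zero_iff k p]
  intro hdvd
  obtain ⟨x, hx⟩ := exists_prime_orderOf_dvd_card' p hdvd
  have h1 : ((χ x : kˣ) : k) ^ p = 1 := by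
    rw [← Units.val_pow_eq_pow_val, ← map_pow, ← hx, pow_orderOf_eq_one, map_one, Units.val_one]
  have h2 : (((χ x : kˣ) : k) - 1) ^ p = 0 := by
    have := ExpChar.prime (R := k) (Fact.out : p.Prime)
    rw [sub_pow_expChar, h1, one_pow, sub_self]
  have h3 : χ x = 1 := Units.ext (by
    simpa using sub_eq_zero.mp (pow_eq_zero_iff (Nat.Prime.ne_zero Fact.out) |>.mp h2))
  have h4 : x = 1 := hχ (h3.trans (map_one χ).symm)
  rw [h4, orderOf_one] at hx
  exact (Fact.out : p.Prime).one_lt.ne hx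

theorem natCast_ne_zero_of_dvd {a b : ℕ} (h : a ∣ b) (hb : (b : k) ≠ 0) : (a : k) ≠ 0 := by
  rintro h0
  obtain ⟨c, rfl⟩ := h
  exact hb (by rw [Nat.cast_mul, h0, zero_mul])

variable [IsAlgClosed k]

theorem hasEnoughRootsOfUnity_exponent {G : Type*} [Group G] [Finite G]
    (hG : (Nat.card G : k) ≠ 0) : HasEnoughRootsOfUnity k (Monoid.exponent G) := by
  have : NeZero ((Monoid.exponent G : ℕ) : k) :=
    ⟨natCast_ne_zero_of_dvd Group.exponent_dvd_nat_card hG⟩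
  infer_instance

/-- A linear character of `G` that vanishes on the kernel of `f : G → A` factors through `f`. -/
theorem exists_character_comp_eq {G A : Type*} [Group G] [CommGroup A] [Finite A]
    (hA : (Nat.card A : k) ≠ 0) (f : G →* A) (η : G →* kˣ) (h : f.ker ≤ η.ker) :
    ∃ ξ : A →* kˣ, ξ.comp f = η := by
  have := hasEnoughRootsOfUnity_exponent (k := k) hA
  let η' : f.range →* kˣ :=
    f.rangeRestrict.liftOfSurjective f.rangeRestrict_surjective ⟨η, by rwa [f.ker_rangeRestrict]⟩
  obtain ⟨ξ, hξ⟩ := MonoidHom.domRestrict_surjective (M := k) f.range η'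
  refine ⟨ξ, MonoidHom.ext fun g => ?_⟩
  have h1 : ξ (f g) = η' (f.rangeRestrict g) := by rw [← hξ]; rfl
  rw [MonoidHom.comp_apply, h1]
  exact MonoidHom.liftOfRightInverse_comp_apply f.rangeRestrict _ _ ⟨η, _⟩ g

end Characters

namespace TwistExtension

variable {p : ℕ} {k : Type v} {L : Type u} [Field k] [Group L] {α : H2 L kˣ}
  (D : TwistExtension.{u, v, w} α)

include D in
theorem finite_quotient : Finite L := Finite.of_surjective D.π D.surjective

theorem card_eq : Nat.card D.H = Nat.card L * Nat.card D.π.ker := by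
  rw [← D.π.ker.index_mul_card, Subgroup.index_ker, MonoidHom.range_eq_top.mpr D.surjective]
  simp

section

variable (p) [Fact p.Prime] [CharP k p] (hL : (Nat.card L).Coprime p)

include p in
theorem card_ker_ne_zero : (Nat.card D.π.ker : k) ≠ 0 :=
  natCast_card_ne_zero_of_injective p D.faithful

include hL

omit [Group L] in
theorem card_base_ne_zero : (Nat.card L : k) ≠ 0 := by
  rw [Ne, CharP.cast_eq_zero_iff k p]
  intro h
  exact (Fact.out : p.Prime).one_lt.ne' (Nat.dvd_one.mp (hL ▸ Nat.dvd_gcd h dvd_rfl))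

theorem card_cover_ne_zero : (Nat.card D.H : k) ≠ 0 := by
  rw [D.card_eq, Nat.cast_mul]
  exact mul_ne_zero (card_base_ne_zero p hL) (D.card_ker_ne_zero p)

theorem card_center_ne_zero : (Nat.card (Subgroup.center D.H) : k) ≠ 0 :=
  natCast_ne_zero_of_dvd (Subgroup.card_subgroup_dvd_card _) (D.card_cover_ne_zero p hL)

variable [IsAlgClosed k]

theorem nonempty_vertex : Nonempty D.Vertex := by
  let _ : CommGroup (Subgroup.center D.H) := commGroupOfIsMulCommutative _
  obtain ⟨φ, hφ⟩ := exists_character_comp_eq (D.card_center_ne_zero p hL)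
    (Subgroup.inclusion D.central) D.χ
    (by
      rw [(MonoidHom.ker_eq_bot_iff _).mpr (Subgroup.inclusion_injective D.central)]
      exact bot_le)
  exact ⟨⟨φ, fun z => DFunLike.congr_fun hφ z⟩⟩

/-- The vertices form a torsor under the characters of Z(H) that are trivial on Z. -/
theorem card_vertex : Nat.card D.Vertex = D.π.ker.relIndex (Subgroup.center D.H) := by
  let _ : CommGroup (Subgroup.center D.H) := commGroupOfIsMulCommutative _
  obtain ⟨φ₀⟩ := D.nonempty_vertex p hL
  have := hasEnoughRootsOfUnity_exponent (D.card_center_ne_zero p hL)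
  set M := D.π.ker.subgroupOf (Subgroup.center D.H)
  have hker : ∀ φ : D.Vertex, φ.1 * φ₀.1⁻¹ ∈ (MonoidHom.domRestrictHom M kˣ).ker := fun φ => by
    rw [MonoidHom.mem_ker]
    ext ⟨⟨z, hz⟩, hz'⟩
    have h1 := φ.2 ⟨z, hz'⟩
    have h2 := φ₀.2 ⟨z, hz'⟩
    have h3 : φ.1 ⟨z, hz⟩ * (φ₀.1 ⟨z, hz⟩)⁻¹ = 1 := by rw [h1, h2, mul_inv_cancel]
    exact congrArg Units.val h3
  have hmem : ∀ η : (MonoidHom.domRestrictHom M kˣ).ker, ∀ z : D.π.ker,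
      (η.1 * φ₀.1) ⟨z, D.central z.2⟩ = D.χ z := fun η z => by
    have h1 : η.1 ⟨z, D.central z.2⟩ = 1 :=
      DFunLike.congr_fun (MonoidHom.mem_ker.mp η.2) (⟨⟨z, D.central z.2⟩, z.2⟩ : M)
    rw [MonoidHom.mul_apply, h1, one_mul, φ₀.2]
  let e : D.Vertex ≃ (MonoidHom.domRestrictHom M kˣ).ker :=
    { toFun := fun φ => ⟨φ.1 * φ₀.1⁻¹, hker φ⟩
      invFun := fun η => ⟨η.1 * φ₀.1, hmem η⟩
      left_inv := fun φ => Subtype.ext (inv_mul_cancel_right φ.1 φ₀.1)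
      right_inv := fun η => Subtype.ext (mul_inv_cancel_right _ _) }
  exact (Nat.card_congr e).trans (CommGroup.card_domRestrictHom_ker (M := k) M)

/-- Both sides count H/Z. This identity closes the dimension count for R. -/
theorem card_vertex_mul_index : Nat.card D.Vertex * (Subgroup.center D.H).index = Nat.card L := by
  rw [D.card_vertex p hL, Subgroup.relIndex_mul_index D.central, Subgroup.index_ker,
    MonoidHom.range_eq_top.mpr D.surjective, Subgroup.card_top]

theorem card_vertex_mul_card_ker :
    Nat.card D.Vertex * Nat.card D.π.ker = Nat.card (Subgroup.center D.H) := by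
  rw [D.card_vertex p hL, mul_comm, ← Subgroup.relIndex_bot_left, ← Subgroup.relIndex_bot_left,
    Subgroup.relIndex_mul_relIndex _ _ _ bot_le D.central]

end

theorem shift_val_apply (φ : D.Vertex) (ψ : L →* kˣ) (z : Subgroup.center D.H) :
    (D.shift φ ψ).1 z = φ.1 z * ψ (D.π z) := rfl

theorem shift_injective (ψ : L →* kˣ) : Function.Injective fun φ => D.shift φ ψ :=
  fun _ _ h => Subtype.ext (mul_right_cancel (congrArg Subtype.val h))

variable [IsMulCommutative L]

theorem pairing_swap (h g : D.H) : D.pairing g h = (D.pairing h g)⁻¹ := by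
  unfold pairing
  rw [← map_inv]
  congr 1
  apply Subtype.ext
  simp only [Subgroup.coe_inv]
  group

/-- The homomorphism `h ↦ χ (h g h⁻¹ g⁻¹)`. -/
def pairingHom (g : D.H) : D.H →* kˣ where
  toFun h := D.pairing h g
  map_one' := by
    simp only [pairing]
    rw [← map_one D.χ]
    congr 1
    apply Subtype.ext
    simp
  map_mul' h h' := by
    rw [D.pairing_swap g, D.pairing_swap g, D.pairing_swap g, D.pairing_mul, mul_inv]

@[simp] theorem pairingHom_apply (h g : D.H) : D.pairingHom g h = D.pairing h g := rfl

theorem pairing_one_right (h : D.H) : D.pairing h 1 = 1 := by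
  rw [D.pairing_swap 1 h, ← D.pairingHom_apply 1 h, map_one, inv_one]

theorem pairing_eq_one_of_mem_center {h g : D.H} (hh : h ∈ Subgroup.center D.H) :
    D.pairing h g = 1 := by
  unfold pairing
  rw [← map_one D.χ]
  congr 1
  apply Subtype.ext
  rw [Subgroup.mem_center_iff] at hh
  simp [← hh g]

/-- Nondegeneracy in the form needed for averaging: a non-trivial character of H sums to zero. -/
theorem pairingHom_ne_one {g : D.H} (hg : g ∉ Subgroup.center D.H) : D.pairingHom g ≠ 1 := by
  intro h
  apply hg
  have := D.mem_center_of_pairing (b := 1) (c := g) fun x => by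
    rw [D.pairing_one_right, ← D.pairingHom_apply x g, h, MonoidHom.one_apply]
  simpa using this

/-- Every linear character of `H` that is trivial on `Z(H)` comes from the commutator pairing. -/
theorem exists_pairing_eq (p : ℕ) [Fact p.Prime] [CharP k p] (hL : (Nat.card L).Coprime p)
    [IsAlgClosed k] (η : D.H →* kˣ) (hη : ∀ z ∈ Subgroup.center D.H, η z = 1) :
    ∃ g, ∀ h, D.pairing h g = η h := by
  let Q := D.H ⧸ Subgroup.center D.H
  let _ : CommGroup Q :=
    { (inferInstance : Group Q) with
      mul_comm := by
        rintro ⟨a⟩ ⟨b⟩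
        refine (QuotientGroup.eq (s := Subgroup.center D.H) (a := a * b) (b := b * a)).mpr ?_
        have : (a * b)⁻¹ * (b * a) = b⁻¹ * a⁻¹ * (b⁻¹)⁻¹ * (a⁻¹)⁻¹ := by group
        rw [this]
        exact D.central (D.commutator_mem_ker _ _) }
  have hQ : (Nat.card Q : k) ≠ 0 := natCast_ne_zero_of_dvd
    (Subgroup.card_quotient_dvd_card (Subgroup.center D.H)) (D.card_cover_ne_zero p hL)
  have := hasEnoughRootsOfUnity_exponent hQ
  -- Nondegeneracy makes this map from Q to its dual injective, and the two finite sets have equal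
  -- size, so it is onto. That it is a homomorphism plays no role, hence arbitrary representatives
  -- do.
  let Φ : Q → (Q →* kˣ) := fun x => QuotientGroup.lift (Subgroup.center D.H) (D.pairingHom x.out)
    fun z hz => D.pairing_eq_one_of_mem_center hz
  have hΦ : ∀ x h, Φ x (QuotientGroup.mk h) = D.pairing h x.out := fun x h => rfl
  have hinj : Function.Injective Φ := by
    intro x y hxy
    rw [← QuotientGroup.out_eq' x, ← QuotientGroup.out_eq' y]
    refine QuotientGroup.eq.mpr (D.mem_center_of_pairing fun h => ?_)
    rw [← hΦ, ← hΦ, hxy]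
  have hfin : Finite (Q →* kˣ) := Nat.finite_of_card_ne_zero (by
    rw [CommGroup.card_monoidHom_of_hasEnoughRootsOfUnity Q k]; exact Nat.card_pos.ne')
  have hbij := hinj.bijective_of_nat_card_le
    (CommGroup.card_monoidHom_of_hasEnoughRootsOfUnity Q k).le
  obtain ⟨x, hx⟩ := hbij.2 (QuotientGroup.lift (Subgroup.center D.H) η hη)
  exact ⟨x.out, fun h => by rw [← hΦ, hx]; rfl⟩

/-- As π(z) ≠ 1, some character ψ of L has ψ(π(z)) ≠ 1. Shifting by ψ permutes the vertices and
multiplies the sum by ψ(π(z)). -/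
theorem sum_vertex_eq_zero [IsAlgClosed k] (hL : (Nat.card L : k) ≠ 0) {z : Subgroup.center D.H}
    (hz : (z : D.H) ∉ D.π.ker) : ∑ φ : D.Vertex, ((φ.1 z : kˣ) : k) = 0 := by
  have hfin := D.finite_quotient
  let _ : CommGroup L := commGroupOfIsMulCommutative L
  have := hasEnoughRootsOfUnity_exponent hL
  obtain ⟨ψ, hψ⟩ := CommGroup.exists_apply_ne_one_of_hasEnoughRootsOfUnity L k
    (a := D.π z) (fun h => hz h)
  have hbij : Function.Bijective fun φ => D.shift φ ψ :=
    Finite.injective_iff_bijective.mp (D.shift_injective ψ)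
  have h1 := Fintype.sum_bijective _ hbij (fun φ => (((D.shift φ ψ).1 z : kˣ) : k))
    (fun φ => ((φ.1 z : kˣ) : k)) fun φ => rfl
  simp only [D.shift_val_apply, Units.val_mul] at h1
  rw [← Finset.sum_mul] at h1
  have h2 : (∑ φ : D.Vertex, ((φ.1 z : kˣ) : k)) * (((ψ (D.π z) : kˣ) : k) - 1) = 0 := by
    rw [mul_sub, h1, mul_one, sub_self]
  refine (mul_eq_zero.mp h2).resolve_right fun h => hψ (Units.ext ?_)
  simpa using sub_eq_zero.mp h

end TwistExtension

/-- The choices that enter the relations exist. -/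
theorem nonempty_choices (p : ℕ) [Fact p.Prime] {k : Type v} [Field k] [IsAlgClosed k] [CharP k p]
    {P : Type u} [CommGroup P] {L : Subgroup (MulAut P)} [IsMulCommutative L]
    (hL : (Nat.card L).Coprime p) {α : H2 L kˣ} (D : TwistExtension.{u, v, w} α)
    (C : Coordinates p k L) : Nonempty (Choices D C) := by
  classical
  obtain ⟨φ₀⟩ := D.nonempty_vertex p hL
  have hfin := D.finite_quotient
  have hξ : ∀ φ : D.Vertex, ∃ ξ : D.H →* kˣ, (∀ z : Subgroup.center D.H, ξ z =
      φ.1 z * (φ₀.1 z)⁻¹) := by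
    intro φ
    let _ : CommGroup L := commGroupOfIsMulCommutative L
    -- The character φφ₀⁻¹ is trivial on Z, so it factors through the image of Z(H) in the abelian
    -- group L and extends to L.
    obtain ⟨ξ, hξ⟩ := exists_character_comp_eq (k := k) (TwistExtension.card_base_ne_zero p hL)
      (D.π.comp (Subgroup.center D.H).subtype) (φ.1 * φ₀.1⁻¹) (by
        intro z hz
        have hz' : (z : D.H) ∈ D.π.ker := hz
        have h1 := φ.2 ⟨z, hz'⟩
        have h2 := φ₀.2 ⟨z, hz'⟩
        change φ.1 z * (φ₀.1 z)⁻¹ = 1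
        exact (congrArg₂ (fun a b : kˣ => a * b⁻¹) h1 h2).trans (mul_inv_cancel _))
    exact ⟨ξ.comp D.π, fun z => DFunLike.congr_fun hξ z⟩
  choose ξ₁ hξ₁ using hξ
  -- The chosen extension at φ₀ need not be trivial, so it is replaced there.
  let ξ : D.Vertex → (D.H →* kˣ) := fun φ => if φ = φ₀ then 1 else ξ₁ φ
  have hξ : ∀ φ (z : Subgroup.center D.H), ξ φ z = φ.1 z * (φ₀.1 z)⁻¹ := fun φ z => by
    by_cases h : φ = φ₀
    · simp [ξ, h]
    · simp [ξ, h, hξ₁]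
  -- On Z(H) the restrictions of ξ at φψ_i and at φ differ exactly by ψ_i, so the right side is
  -- trivial there and is realised by the pairing.
  have hg : ∀ (i : Fin C.r) (φ : D.Vertex), ∃ g : D.H, ∀ h, D.pairing h g =
      ξ (D.shift φ (C.ψ i)) h * (ξ φ h)⁻¹ * (C.ψ i (D.π h))⁻¹ := by
    intro i φ
    refine D.exists_pairing_eq p hL
      (ξ (D.shift φ (C.ψ i)) * (ξ φ)⁻¹ * ((C.ψ i).comp D.π)⁻¹) fun z hz => ?_
    have h1 := hξ φ ⟨z, hz⟩
    have h2 := hξ (D.shift φ (C.ψ i)) ⟨z, hz⟩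
    simp only [D.shift_val_apply] at h1 h2
    simp only [MonoidHom.mul_apply, MonoidHom.inv_apply, MonoidHom.comp_apply, h1, h2, mul_inv,
      inv_inv]
    generalize φ.1 ⟨z, hz⟩ = a
    generalize φ₀.1 ⟨z, hz⟩ = b
    generalize (C.ψ i) (D.π z) = c
    rw [show a * c * b⁻¹ * (a⁻¹ * b) * c⁻¹ = (a * a⁻¹) * (b * b⁻¹) * (c * c⁻¹) by
      simp only [mul_assoc, mul_left_comm, mul_comm]]
    simp
  choose g hg using hg
  exact ⟨⟨φ₀, ξ, hξ, by simp [ξ], g, hg⟩⟩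


/-! ### The twisted group algebra as a direct factor of the group algebra of the cover -/

/-- The class of `a` trivialises along `π`, compatibly with `χ`. -/
theorem TwistExtension.exists_multiplier {L : Type u} {k : Type v} [Group L] [Field k] {α : H2 L kˣ}
    (D : TwistExtension.{u, v, w} α) {a : cocycles L kˣ} (ha : QuotientGroup.mk a = α) :
    ∃ μ : D.H → kˣ, (∀ h h', μ (h * h') = μ h * μ h' * a.1 (D.π h, D.π h')) ∧
      ∀ (z : D.π.ker) (h : D.H), μ (z * h) = D.χ z * μ h := by
  obtain ⟨s, hs, c, hc, hcα⟩ := D.realises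
  obtain ⟨b, hb⟩ := QuotientGroup.eq.mp (hcα.trans ha.symm)
  have hab : ∀ x y, a.1 (x, y) = c.1 (x, y) * (b x * b y * (b (x * y))⁻¹) := fun x y => by
    rw [← hb]
    simp
  have hker : ∀ h, h * (s (D.π h))⁻¹ ∈ D.π.ker := fun h => by simp [MonoidHom.mem_ker, hs]
  -- The Z-part of h relative to the section s. Its χ-value has multiplier c, and dividing by b
  -- passes from c to the cohomologous cocycle a.
  let ρ : D.H → D.π.ker := fun h => ⟨h * (s (D.π h))⁻¹, hker h⟩
  have hρ : ∀ h h', D.χ (ρ (h * h')) = D.χ (ρ h) * D.χ (ρ h') * c.1 (D.π h, D.π h') := by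
    intro h h'
    rw [hc, ← map_mul, ← map_mul]
    congr 1
    apply Subtype.ext
    have hz := Subgroup.mem_center_iff.mp (D.central (hker h')) (s (D.π h))
    simp only [ρ, Subgroup.coe_mul, map_mul]
    calc h * h' * (s (D.π h * D.π h'))⁻¹
        = h * (s (D.π h))⁻¹ * (s (D.π h) * (h' * (s (D.π h'))⁻¹)) * s (D.π h') *
            (s (D.π h * D.π h'))⁻¹ := by group
      _ = h * (s (D.π h))⁻¹ * (h' * (s (D.π h'))⁻¹ * s (D.π h)) * s (D.π h') *
            (s (D.π h * D.π h'))⁻¹ := by rw [hz]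
      _ = _ := by group
  refine ⟨fun h => D.χ (ρ h) * (b (D.π h))⁻¹, fun h h' => ?_, fun z h => ?_⟩
  · simp only []
    rw [hρ, hab, map_mul]
    generalize D.χ (ρ h) = t₁
    generalize D.χ (ρ h') = t₂
    generalize c.1 (D.π h, D.π h') = t₃
    generalize b (D.π h) = t₄
    generalize b (D.π h') = t₅
    generalize b (D.π h * D.π h') = t₆
    rw [show t₁ * t₄⁻¹ * (t₂ * t₅⁻¹) * (t₃ * (t₄ * t₅ * t₆⁻¹)) =
      t₁ * t₂ * t₃ * t₆⁻¹ * (t₄ * t₄⁻¹) * (t₅ * t₅⁻¹) by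
        simp only [mul_assoc, mul_left_comm, mul_comm]]
    simp
  · have hz : D.π (z * h) = D.π h := by
      rw [map_mul, MonoidHom.mem_ker.mp z.2, one_mul]
    have : ρ (z * h) = z * ρ h := Subtype.ext (by simp only [ρ, hz, Subgroup.coe_mul, mul_assoc])
    simp only [this, map_mul, mul_assoc, MonoidHom.mem_ker.mp z.2, one_mul]

theorem TwistedGroupAlgebra.smul_of {k : Type v} {G : Type u} [Field k] [Group G]
    (a : cocycles G kˣ) (x : G) (c d : k) :
    c • TwistedGroupAlgebra.of a x d = TwistedGroupAlgebra.of a x (c * d) :=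
  Finsupp.smul_single (M := k) (α := G) c x d

section Cover

variable {k : Type v} {P : Type u} [Field k] [CommGroup P] {L : Subgroup (MulAut P)} {α : H2 L kˣ}
  (D : TwistExtension.{u, v, w} α)

theorem inr_mul_idempotent (z : D.π.ker) :
    MonoidAlgebra.of k (CoverGroup D) (SemidirectProduct.inr (z : D.H)) * idempotent D =
      ((D.χ z : kˣ) : k) • idempotent D := by
  have : Fintype D.π.ker := Fintype.ofFinite _
  unfold idempotent
  rw [mul_smul_comm, smul_comm]
  congr 1
  rw [finsum_eq_sum_of_fintype, Finset.mul_sum, Finset.smul_sum]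
  refine Fintype.sum_equiv (Equiv.mulLeft z) _ _ fun z' => ?_
  rw [mul_smul_comm, ← map_mul, ← map_mul, smul_smul, Equiv.coe_mulLeft, Subgroup.coe_mul]
  congr 1
  rw [← Units.val_mul, ← map_mul, mul_inv_rev, map_mul, map_mul, mul_left_comm, ← map_mul D.χ z,
    mul_inv_cancel, map_one, mul_one]

/-- The twisted group algebra of `P ⋊ L` is the direct factor of `k(P ⋊ H)` at the central
idempotent `e`: `G` is the projection and `F` the inclusion. -/
theorem exists_projection_inclusion (hZ : (Nat.card D.π.ker : k) ≠ 0) {a : cocycles L kˣ}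
    (ha : QuotientGroup.mk a = α) :
    ∃ (G : MonoidAlgebra k (CoverGroup D) →ₐ[k] TwistedSemidirect a)
      (F : TwistedSemidirect a →ₙₐ[k] MonoidAlgebra k (CoverGroup D)),
      (∀ x, F (G x) = x * idempotent D) ∧ ∀ y, G (F y) = y := by
  have : Fintype D.π.ker := Fintype.ofFinite _
  obtain ⟨μ, hμ, hμz⟩ := D.exists_multiplier ha
  set a' := inflate (SemidirectProduct.rightHom : P ⋊[L.subtype] L →* L) a with ha'
  let q : CoverGroup D → P ⋊[L.subtype] L := fun g => ⟨g.left, D.π g.right⟩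
  have hq : ∀ g g', q (g * g') = q g * q g' := fun g g' => by
    ext <;> simp [q]
  have hμ1 : μ 1 * a.1 (1, 1) = 1 := by
    have := hμ 1 1
    rw [mul_one, map_one, mul_assoc] at this
    exact mul_eq_left.mp this.symm
  let G₀ : CoverGroup D →* TwistedSemidirect a :=
    { toFun := fun g => TwistedGroupAlgebra.of a' (q g) (μ g.right : kˣ)
      map_one' := by
        rw [TwistedGroupAlgebra.one_def]
        have h1 : q 1 = 1 := by ext <;> simp [q]
        rw [h1, SemidirectProduct.one_right, eq_inv_of_mul_eq_one_left hμ1]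
        rfl
      map_mul' := fun g g' => by
        rw [TwistedGroupAlgebra.of_mul_of, hq, SemidirectProduct.mul_right, hμ, Units.val_mul,
          Units.val_mul]
        rfl }
  let G := MonoidAlgebra.lift k (TwistedSemidirect a) (CoverGroup D) G₀
  have hG : ∀ g, G (MonoidAlgebra.of k _ g) = TwistedGroupAlgebra.of a' (q g) (μ g.right : kˣ) :=
    fun g => MonoidAlgebra.lift_of _ _
  let s : L → D.H := Function.surjInv D.surjective
  have hs : ∀ l, D.π (s l) = l := Function.surjInv_eq D.surjective
  -- A basis element goes to a lift times e, divided by the multiplier of the lift; on the factor at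
  -- e this inverts G.
  let F₀ : TwistedSemidirect a →ₗ[k] MonoidAlgebra k (CoverGroup D) :=
    (Finsupp.lsum k fun x : P ⋊[L.subtype] L => LinearMap.toSpanSingleton k _
      ((((μ (s x.right))⁻¹ : kˣ) : k) •
        (MonoidAlgebra.of k (CoverGroup D) ⟨x.left, s x.right⟩ * idempotent D)) :
        ((P ⋊[L.subtype] L) →₀ k) →ₗ[k] MonoidAlgebra k (CoverGroup D))
  have hF₀ : ∀ x c, F₀ (TwistedGroupAlgebra.of a' x c) = c • (((μ (s x.right))⁻¹ : kˣ) : k) •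
        (MonoidAlgebra.of k (CoverGroup D) ⟨x.left, s x.right⟩ * idempotent D) := fun x c => by
    change Finsupp.lsum k _ (Finsupp.single x c) = _
    rw [Finsupp.lsum_single, LinearMap.toSpanSingleton_apply]
  have hFG : ∀ x, F₀ (G x) = x * idempotent D := by
    intro x
    induction x using MonoidAlgebra.induction_on with
    | of g =>
      rw [hG, hF₀]
      have hz : g.right * (s (D.π g.right))⁻¹ ∈ D.π.ker := by simp [MonoidHom.mem_ker, hs]
      set z : D.π.ker := ⟨g.right * (s (D.π g.right))⁻¹, hz⟩ with hzdef
      have hzs : (z : D.H) * s (D.π g.right) = g.right := by simp [hzdef]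
      have hg : g = (⟨g.left, s (D.π g.right)⟩ : CoverGroup D) *
          SemidirectProduct.inr (z : D.H) := by
        ext
        · simp
        · rw [SemidirectProduct.mul_right, SemidirectProduct.right_inr,
            Subgroup.mem_center_iff.mp (D.central z.2) _, hzs]
      have hμg : μ g.right = D.χ z * μ (s (D.π g.right)) := by rw [← hμz, hzs]
      conv_rhs => rw [hg, map_mul, mul_assoc, inr_mul_idempotent, mul_smul_comm]
      rw [smul_smul, ← Units.val_mul]
      congr 2
      rw [hμg]
      exact mul_inv_cancel_right _ _
    | add x y hx hy => rw [map_add, map_add, hx, hy, add_mul]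
    | smul c x hx => rw [map_smul, map_smul, hx, smul_mul_assoc]
  have hGe : G (idempotent D) = 1 := by
    unfold idempotent
    rw [finsum_eq_sum_of_fintype, map_smul, map_sum]
    have h1 : ∀ z : D.π.ker, G (((D.χ z⁻¹ : kˣ) : k) • MonoidAlgebra.of k (CoverGroup D)
        (SemidirectProduct.inr (z : D.H))) = 1 := fun z => by
      have h3 : q (SemidirectProduct.inr (z : D.H)) = 1 := by
        ext <;> simp [q, MonoidHom.mem_ker.mp z.2]
      have h4 : μ (z : D.H) = D.χ z * μ 1 := by rw [← hμz, mul_one]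
      rw [map_smul, hG, h3, SemidirectProduct.right_inr, h4, TwistedGroupAlgebra.one_def]
      rw [TwistedGroupAlgebra.smul_of, ← Units.val_mul, ← mul_assoc, ← map_mul,
        inv_mul_cancel, map_one, one_mul, eq_inv_of_mul_eq_one_left hμ1]
      rfl
    rw [Finset.sum_congr rfl fun z _ => h1 z, Finset.sum_const, Finset.card_univ,
      ← Nat.card_eq_fintype_card, ← Nat.cast_smul_eq_nsmul k, smul_smul, inv_mul_cancel₀ hZ,
      one_smul]
  have hGF : ∀ y, G (F₀ y) = y := by
    intro y
    induction y using TwistedGroupAlgebra.induction with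
    | zero => rw [map_zero, map_zero]
    | add f g hf hg => rw [map_add, map_add, hf, hg]
    | basis x c =>
      rw [hF₀, map_smul, map_smul, map_mul, hGe, mul_one, hG]
      have h1 : q ⟨x.left, s x.right⟩ = x := by ext <;> simp [q, hs]
      rw [h1, TwistedGroupAlgebra.smul_of, TwistedGroupAlgebra.smul_of, Units.inv_mul, mul_one]
  refine ⟨G, { F₀ with
    map_zero' := map_zero F₀
    map_mul' := fun x y => ?_ }, hFG, hGF⟩
  change F₀ (x * y) = F₀ x * F₀ y
  -- Multiplicativity is formal: F(xy) = F(G(F(x)F(y))) = F(x)F(y)e, and F(y)e = F(y).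
  have h1 := hFG (F₀ x * F₀ y)
  have h2 := hFG (F₀ y)
  rw [map_mul, hGF, hGF] at h1
  rw [hGF] at h2
  rw [h1, mul_assoc, ← h2]

theorem finrank_twistedSemidirect [Finite P] [Finite L] (a : cocycles L kˣ) :
    Module.finrank k (TwistedSemidirect a) = Nat.card P * Nat.card L := by
  have : Finite (P ⋊[L.subtype] L) := Finite.of_equiv _ SemidirectProduct.equivProd.symm
  have : Fintype (P ⋊[L.subtype] L) := Fintype.ofFinite _
  change Module.finrank k ((P ⋊[L.subtype] L) →₀ k) = _
  rw [Module.finrank_finsupp_self, ← Nat.card_eq_fintype_card,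
    Nat.card_congr SemidirectProduct.equivProd, Nat.card_prod]

instance [Finite P] [Finite L] (a : cocycles L kˣ) : Module.Finite k (TwistedSemidirect a) := by
  have : Finite (P ⋊[L.subtype] L) := Finite.of_equiv _ SemidirectProduct.equivProd.symm
  exact inferInstanceAs (Module.Finite k ((P ⋊[L.subtype] L) →₀ k))

end Cover


/-! ### The idempotents of the vertices and the elements of the arrows -/

section Elements

variable {p : ℕ} {k : Type v} {P : Type u} [Field k] [CommGroup P] {L : Subgroup (MulAut P)}
  {α : H2 L kˣ} (D : TwistExtension.{u, v, w} α)

/-- The element `h` of `H`, in `k(P ⋊ H)`. -/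
def coverOf : D.H →* MonoidAlgebra k (CoverGroup D) :=
  (MonoidAlgebra.of k (CoverGroup D)).comp SemidirectProduct.inr

/-- The embedding of `kP` into `k(P ⋊ H)`. -/
def baseEmbedding : MonoidAlgebra k P →ₐ[k] MonoidAlgebra k (CoverGroup D) :=
  MonoidAlgebra.mapDomainAlgHom k k (SemidirectProduct.inl : P →* CoverGroup D)

theorem coverOf_mul_baseEmbedding (h : D.H) (x : MonoidAlgebra k P) :
    coverOf D h * baseEmbedding D x =
      baseEmbedding D (MonoidAlgebra.mapDomain (fun y : P => (D.π h : MulAut P) y) x) *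
        coverOf D h := by
  induction x using MonoidAlgebra.induction_on with
  | of y =>
    simp only [coverOf, baseEmbedding, MonoidHom.comp_apply, MonoidAlgebra.of_apply,
      MonoidAlgebra.mapDomainAlgHom_apply, MonoidAlgebra.mapDomain_single,
      MonoidAlgebra.single_mul_single]
    congr 1
    ext <;> simp
  | add x y hx hy => simp only [map_add, mul_add, add_mul, hx, hy, MonoidAlgebra.mapDomain_add]
  | smul c x hx =>
    rw [map_smul, mul_smul_comm, hx, MonoidAlgebra.mapDomain_smul, map_smul, smul_mul_assoc]

theorem vertexIdempotent_eq_sum [Fintype (Subgroup.center D.H)] (φ : D.Vertex) :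
    vertexIdempotent D φ = (Nat.card (Subgroup.center D.H) : k)⁻¹ • ∑ h : Subgroup.center D.H,
      ((φ.1 h⁻¹ : kˣ) : k) • coverOf D (h : D.H) := by
  rw [vertexIdempotent, finsum_eq_sum_of_fintype]
  rfl

theorem coverOf_mul_vertexIdempotent (φ : D.Vertex) (z : Subgroup.center D.H) :
    coverOf D (z : D.H) * vertexIdempotent D φ = ((φ.1 z : kˣ) : k) • vertexIdempotent D φ := by
  have : Fintype (Subgroup.center D.H) := Fintype.ofFinite _
  rw [vertexIdempotent_eq_sum, mul_smul_comm, smul_comm]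
  congr 1
  rw [Finset.mul_sum, Finset.smul_sum]
  refine Fintype.sum_equiv (Equiv.mulLeft z) _ _ fun z' => ?_
  rw [mul_smul_comm, ← map_mul, smul_smul, Equiv.coe_mulLeft, Subgroup.coe_mul]
  congr 1
  rw [← Units.val_mul, mul_inv_rev, map_mul, mul_left_comm, ← map_mul φ.1 z, mul_inv_cancel,
    map_one, mul_one]

theorem commute_coverOf_vertexIdempotent (φ : D.Vertex) (h : D.H) :
    Commute (coverOf D h) (vertexIdempotent D φ) := by
  have : Fintype (Subgroup.center D.H) := Fintype.ofFinite _
  rw [vertexIdempotent_eq_sum]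
  refine Commute.smul_right (Commute.sum_right _ _ _ fun z _ => Commute.smul_right ?_ _) _
  change _ * _ = _ * _
  rw [← map_mul, ← map_mul, Subgroup.mem_center_iff.mp z.2 h]

theorem vertexIdempotent_mul (hZ : (Nat.card (Subgroup.center D.H) : k) ≠ 0) [DecidableEq D.Vertex]
    (φ φ' : D.Vertex) : vertexIdempotent D φ * vertexIdempotent D φ' =
      if φ = φ' then vertexIdempotent D φ else 0 := by
  have : Fintype (Subgroup.center D.H) := Fintype.ofFinite _
  conv_lhs => rw [vertexIdempotent_eq_sum D φ]
  have h1 : ∀ z : Subgroup.center D.H, ((φ.1 z⁻¹ : kˣ) : k) • coverOf D (z : D.H) *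
      vertexIdempotent D φ' = (((φ.1⁻¹ * φ'.1) z : kˣ) : k) • vertexIdempotent D φ' := fun z => by
    rw [smul_mul_assoc, coverOf_mul_vertexIdempotent, smul_smul, ← Units.val_mul, map_inv]
    rfl
  rw [smul_mul_assoc, Finset.sum_mul, Finset.sum_congr rfl fun z _ => h1 z, ← Finset.sum_smul,
    smul_smul]
  split_ifs with h
  · subst h
    have h2 : φ.1⁻¹ * φ.1 = 1 := inv_mul_cancel φ.1
    simp only [h2, MonoidHom.one_apply, Units.val_one, Finset.sum_const, Finset.card_univ,
      nsmul_eq_mul, mul_one]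
    rw [← Nat.card_eq_fintype_card, inv_mul_cancel₀ hZ, one_smul]
  · have h2 := sum_hom_units_eq_zero ((Units.coeHom k).comp (φ.1⁻¹ * φ'.1)) (fun h3 => h (by
      apply Subtype.ext
      have : φ.1⁻¹ * φ'.1 = 1 := by
        ext z
        exact DFunLike.congr_fun h3 z
      exact inv_mul_eq_one.mp this))
    have h3 : ∑ z, (((φ.1⁻¹ * φ'.1) z : kˣ) : k) = 0 := h2
    rw [h3, mul_zero, zero_smul]

/-- After exchanging sums, the coefficient of z is proportional to ∑ φ(z⁻¹). It vanishes off Z and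
is |V|χ(z⁻¹) on Z, and |V||Z| = |Z(H)| adjusts the normalisation. -/
theorem sum_vertexIdempotent (p : ℕ) [Fact p.Prime] [CharP k p] [IsAlgClosed k]
    [IsMulCommutative L] (hL : (Nat.card L).Coprime p) :
    ∑ φ : D.Vertex, vertexIdempotent D φ = idempotent D := by
  classical
  have : Fintype (Subgroup.center D.H) := Fintype.ofFinite _
  have : Fintype D.π.ker := Fintype.ofFinite _
  have hcard := D.card_vertex_mul_card_ker p hL
  have hZ := D.card_center_ne_zero p hL
  have hK := D.card_ker_ne_zero p
  simp only [vertexIdempotent_eq_sum]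
  rw [← Finset.smul_sum, Finset.sum_comm]
  simp only [← Finset.sum_smul]
  have h1 : ∑ z : Subgroup.center D.H, (∑ φ : D.Vertex, ((φ.1 z⁻¹ : kˣ) : k)) •
      coverOf D (z : D.H) = ∑ z : D.π.ker, ((Nat.card D.Vertex : k) * ((D.χ z⁻¹ : kˣ) : k)) •
        coverOf D (z : D.H) := by
    symm
    refine Finset.sum_of_injOn (fun z => ⟨z, D.central z.2⟩)
      (fun z _ z' _ h => Subtype.ext (by simpa using h)) (fun _ _ => Finset.mem_univ _)
      (fun z _ hz => ?_) (fun z _ => ?_)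
    · rw [D.sum_vertex_eq_zero (TwistExtension.card_base_ne_zero p hL), zero_smul]
      intro hz'
      exact hz ⟨⟨z, by simpa using hz'⟩, Finset.mem_coe.mpr (Finset.mem_univ _), rfl⟩
    · congr 1
      have : ∀ φ : D.Vertex, φ.1 (⟨z, D.central z.2⟩⁻¹) = D.χ z⁻¹ := fun φ => φ.2 z⁻¹
      simp [this, Nat.card_eq_fintype_card]
  rw [h1, idempotent, finsum_eq_sum_of_fintype]
  simp only [mul_smul]
  rw [← Finset.smul_sum, smul_smul]
  congr 1
  rw [← hcard] at hZ ⊢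
  push_cast at hZ ⊢
  have hV := left_ne_zero_of_mul hZ
  field_simp

variable (C : Coordinates p k L)

/-- The element `w_i` of `kP`, in `k(P ⋊ H)`. -/
def coordinate (i : Fin C.r) : MonoidAlgebra k (CoverGroup D) := baseEmbedding D (C.w i)

theorem coordinate_mul_comm (i j : Fin C.r) :
    coordinate D C i * coordinate D C j = coordinate D C j * coordinate D C i := by
  unfold coordinate
  rw [← map_mul, mul_comm, map_mul]

theorem coordinate_pow_eq_zero (i : Fin C.r) : coordinate D C i ^ p ^ C.n i = 0 := by
  have h : (MvPolynomial.X i : MvPolynomial (Fin C.r) k) ^ p ^ C.n i ∈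
      RingHom.ker (MvPolynomial.aeval (R := k) C.w) := by
    rw [C.ker_eq]
    exact Ideal.subset_span ⟨i, rfl⟩
  rw [RingHom.mem_ker, map_pow, MvPolynomial.aeval_X] at h
  rw [coordinate, ← map_pow, h, map_zero]

theorem coverOf_mul_coordinate (h : D.H) (i : Fin C.r) :
    coverOf D h * coordinate D C i =
      ((C.ψ i (D.π h) : kˣ) : k) • (coordinate D C i * coverOf D h) := by
  rw [coordinate, coverOf_mul_baseEmbedding, C.eigen, map_smul, smul_mul_assoc]

theorem coordinate_mul_coverOf (h : D.H) (i : Fin C.r) :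
    coordinate D C i * coverOf D h =
      (((C.ψ i (D.π h))⁻¹ : kˣ) : k) • (coverOf D h * coordinate D C i) := by
  rw [coverOf_mul_coordinate, smul_smul, Units.inv_mul, one_smul]

/-- Moving z ∈ Z(H) past w_i costs ψ_i(z), so w_i shifts the character of Z(H) by ψ_i. Hence the
arrows of type i end at φψ_i. -/
theorem vertexIdempotent_mul_coordinate (φ : D.Vertex) (i : Fin C.r) :
    vertexIdempotent D (D.shift φ (C.ψ i)) * coordinate D C i =
      coordinate D C i * vertexIdempotent D φ := by
  have : Fintype (Subgroup.center D.H) := Fintype.ofFinite _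
  rw [vertexIdempotent_eq_sum, vertexIdempotent_eq_sum, smul_mul_assoc, mul_smul_comm,
    Finset.sum_mul, Finset.mul_sum]
  congr 1
  refine Finset.sum_congr rfl fun z _ => ?_
  rw [smul_mul_assoc, coverOf_mul_coordinate, smul_smul, mul_smul_comm, D.shift_val_apply,
    ← Units.val_mul]
  congr 2
  rw [mul_assoc, Subgroup.coe_inv, map_inv, map_inv, map_inv, inv_mul_cancel, mul_one]

variable [IsMulCommutative L] {D C} (X : Choices D C)

theorem arrowElement_eq (i : Fin C.r) (φ : D.Vertex) :
    arrowElement X i φ = coverOf D (X.g i φ) * coordinate D C i * vertexIdempotent D φ := rfl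

theorem vertexIdempotent_mul_arrowElement (i : Fin C.r) (φ : D.Vertex) :
    vertexIdempotent D (D.shift φ (C.ψ i)) * (coverOf D (X.g i φ) * coordinate D C i) =
      arrowElement X i φ := by
  rw [arrowElement_eq, ← mul_assoc, ← (commute_coverOf_vertexIdempotent D _ _).eq, mul_assoc,
    vertexIdempotent_mul_coordinate, mul_assoc]

/-- The quantised commutation relations hold for the elements `g_{i,φ} w_i e_φ`. -/
theorem arrowElement_mul_arrowElement (hZ : (Nat.card (Subgroup.center D.H) : k) ≠ 0)
    (i j : Fin C.r) (φ : D.Vertex) :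
    arrowElement X j (D.shift φ (C.ψ i)) * arrowElement X i φ =
      ((X.q i j φ : kˣ) : k) • (arrowElement X i (D.shift φ (C.ψ j)) * arrowElement X j φ) := by
  classical
  -- Both products are brought to the form scalar · group element · w_j w_i e_φ. The w's commute, so
  -- only the central element z_{i,j,φ} and the two scalars remain; z acts through φψ_iψ_j, as
  -- e_{φψ_iψ_j} stands to the left of the w's.
  have key : ∀ i j, arrowElement X j (D.shift φ (C.ψ i)) * arrowElement X i φ =
      (((C.ψ j (D.π (X.g i φ)))⁻¹ : kˣ) : k) •
        (coverOf D (X.g j (D.shift φ (C.ψ i)) * X.g i φ) *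
          (coordinate D C j * coordinate D C i * vertexIdempotent D φ)) := by
    intro i j
    have hid : vertexIdempotent D (D.shift φ (C.ψ i)) * vertexIdempotent D (D.shift φ (C.ψ i)) =
        vertexIdempotent D (D.shift φ (C.ψ i)) := by rw [vertexIdempotent_mul D hZ, if_pos rfl]
    have h1 : vertexIdempotent D (D.shift φ (C.ψ i)) * arrowElement X i φ = arrowElement X i φ := by
      rw [← vertexIdempotent_mul_arrowElement, ← mul_assoc, hid]
    rw [arrowElement_eq X j, mul_assoc, h1, arrowElement_eq,
      mul_assoc (coverOf D _) (coordinate D C j),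
      ← mul_assoc (coordinate D C j), ← mul_assoc (coordinate D C j), coordinate_mul_coverOf,
      smul_mul_assoc, smul_mul_assoc, mul_smul_comm, map_mul]
    simp only [mul_assoc]
  have hz : X.g j (D.shift φ (C.ψ i)) * X.g i φ =
      X.g i (D.shift φ (C.ψ j)) * X.g j φ * (X.z i j φ : D.H) := by
    simp only [Choices.z]
    group
  have hww : coverOf D (X.z i j φ : D.H) *
      (coordinate D C j * coordinate D C i * vertexIdempotent D φ) =
      (((D.shift (D.shift φ (C.ψ i)) (C.ψ j)).1 (X.z i j φ) : kˣ) : k) •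
        (coordinate D C i * coordinate D C j * vertexIdempotent D φ) := by
    rw [mul_assoc, ← vertexIdempotent_mul_coordinate, ← mul_assoc (coordinate D C j),
      ← vertexIdempotent_mul_coordinate, ← mul_assoc, ← mul_assoc, coverOf_mul_vertexIdempotent,
      smul_mul_assoc, smul_mul_assoc, vertexIdempotent_mul_coordinate, mul_assoc,
      vertexIdempotent_mul_coordinate, ← mul_assoc, coordinate_mul_comm D C j i]
  rw [key i j, key j i, hz, map_mul, mul_assoc, hww, mul_smul_comm, smul_smul, smul_smul,
    ← Units.val_mul, ← Units.val_mul]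
  congr 2
  rw [Choices.q]
  generalize (D.shift (D.shift φ (C.ψ i)) (C.ψ j)).1 (X.z i j φ) = t₁
  generalize (C.ψ i) (D.π (X.g j φ)) = t₂
  generalize (C.ψ j) (D.π (X.g i φ)) = t₃
  rw [mul_right_comm, mul_inv_cancel_right, mul_comm]

end Elements


/-! ### The path algebra -/

namespace PathAlgebra

variable (k : Type*) {V E : Type*} [Field k] [Fintype V] (src tgt : E → V)

theorem vertex_mul_self (v : V) : vertex k src tgt v * vertex k src tgt v = vertex k src tgt v := by
  rw [vertex, ← map_mul]
  exact RingQuot.mkAlgHom_rel k (PathRel.idem v)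

theorem vertex_mul_of_ne {v v' : V} (h : v ≠ v') :
    vertex k src tgt v * vertex k src tgt v' = 0 := by
  rw [vertex, vertex, ← map_mul, RingQuot.mkAlgHom_rel k (PathRel.orth v v' h), map_zero]

theorem sum_vertex : ∑ v, vertex k src tgt v = 1 := by
  simp only [vertex]
  rw [← map_sum, RingQuot.mkAlgHom_rel k PathRel.total, map_one]

theorem arrow_mul_vertex (x : E) : arrow k src tgt x * vertex k src tgt (src x) =
    arrow k src tgt x := by
  rw [arrow, vertex, ← map_mul]
  exact RingQuot.mkAlgHom_rel k (PathRel.source x)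

theorem vertex_mul_arrow (x : E) : vertex k src tgt (tgt x) * arrow k src tgt x =
    arrow k src tgt x := by
  rw [arrow, vertex, ← map_mul]
  exact RingQuot.mkAlgHom_rel k (PathRel.target x)

variable {k src tgt}

theorem exists_lift {B : Type*} [Ring B] [Algebra k B] {ev : V → B} {ar : E → B}
    (hidem : ∀ v, ev v * ev v = ev v) (horth : ∀ v v', v ≠ v' → ev v * ev v' = 0)
    (htotal : ∑ v, ev v = 1) (hsrc : ∀ x, ar x * ev (src x) = ar x)
    (htgt : ∀ x, ev (tgt x) * ar x = ar x) :
    ∃ f : PathAlgebra k src tgt →ₐ[k] B,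
      (∀ v, f (vertex k src tgt v) = ev v) ∧ ∀ x, f (arrow k src tgt x) = ar x := by
  refine ⟨RingQuot.liftAlgHom k ⟨FreeAlgebra.lift k (Sum.elim ev ar), ?_⟩, fun v => ?_, fun x => ?_⟩
  · intro x y h
    cases h with
    | idem v => simp [hidem]
    | orth v v' h => simp [horth v v' h]
    | total => simp [htotal]
    | source x => simp [hsrc]
    | target x => simp [htgt]
  · rw [vertex, RingQuot.liftAlgHom_mkAlgHom_apply, FreeAlgebra.lift_ι_apply, Sum.elim_inl]
  · rw [arrow, RingQuot.liftAlgHom_mkAlgHom_apply, FreeAlgebra.lift_ι_apply, Sum.elim_inr]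

theorem adjoin_eq_top : Algebra.adjoin k
    (Set.range (vertex k src tgt) ∪ Set.range (arrow k src tgt)) = ⊤ := by
  have h1 : (RingQuot.mkAlgHom k (PathRel k src tgt)).range = ⊤ :=
    (AlgHom.range_eq_top _).mpr (RingQuot.mkAlgHom_surjective k _)
  rw [← h1, ← Algebra.map_top, ← FreeAlgebra.adjoin_range_ι, AlgHom.map_adjoin, ← Set.range_comp,
    ← Set.Sum.elim_range]
  congr 2
  funext x
  cases x <;> rfl

end PathAlgebra

/-! ### The quantised algebra -/

section Quantised

variable {p : ℕ} {k : Type v} {P : Type u} [Field k] [CommGroup P] {L : Subgroup (MulAut P)}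
  {α : H2 L kˣ} (D : TwistExtension.{u, v, w} α) (C : Coordinates p k L)

/-- The vertex `φ` in `kQ`. -/
abbrev vertex (φ : D.Vertex) : QuiverAlgebra D C := PathAlgebra.vertex k _ _ φ

theorem arrow_mul_vertex (i : Fin C.r) (φ : D.Vertex) :
    arrow D C i φ * vertex D C φ = arrow D C i φ :=
  PathAlgebra.arrow_mul_vertex k (fun x : D.Vertex × Fin C.r => x.1) _ (φ, i)

theorem vertex_mul_arrow (i : Fin C.r) (φ : D.Vertex) :
    vertex D C (D.shift φ (C.ψ i)) * arrow D C i φ = arrow D C i φ :=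
  PathAlgebra.vertex_mul_arrow k (fun x : D.Vertex × Fin C.r => x.1)
    (fun x : D.Vertex × Fin C.r => D.shift x.1 (C.ψ x.2)) (φ, i)

theorem vertex_mul_arrowPower (i : Fin C.r) (φ : D.Vertex) (m : ℕ) :
    vertex D C ((fun φ' => D.shift φ' (C.ψ i))^[m] φ) * arrowPower D C i φ m =
      arrowPower D C i φ m := by
  cases m with
  | zero => exact PathAlgebra.vertex_mul_self k _ _ φ
  | succ m =>
    rw [arrowPower, Function.iterate_succ_apply', ← mul_assoc, vertex_mul_arrow]

/-- The sum of the arrows of type `i`. -/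
def totalArrow (i : Fin C.r) : QuiverAlgebra D C := ∑ φ, arrow D C i φ

theorem totalArrow_mul_vertex (i : Fin C.r) (φ : D.Vertex) :
    totalArrow D C i * vertex D C φ = arrow D C i φ := by
  rw [totalArrow, Finset.sum_mul, Finset.sum_eq_single φ]
  · exact arrow_mul_vertex D C i φ
  · intro φ' _ h
    rw [← arrow_mul_vertex, mul_assoc, PathAlgebra.vertex_mul_of_ne k _ _ h, mul_zero]
  · simp

theorem vertex_mul_totalArrow (i : Fin C.r) (φ : D.Vertex) :
    vertex D C (D.shift φ (C.ψ i)) * totalArrow D C i = arrow D C i φ := by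
  rw [totalArrow, Finset.mul_sum, Finset.sum_eq_single φ]
  · exact vertex_mul_arrow D C i φ
  · intro φ' _ h
    rw [← vertex_mul_arrow, ← mul_assoc, PathAlgebra.vertex_mul_of_ne, zero_mul]
    exact fun h' => h (D.shift_injective _ h').symm
  · simp

theorem totalArrow_pow_mul_vertex (i : Fin C.r) (φ : D.Vertex) (m : ℕ) :
    totalArrow D C i ^ m * vertex D C φ = arrowPower D C i φ m := by
  induction m with
  | zero => rw [pow_zero, one_mul]; rfl
  | succ m ih =>
    rw [pow_succ', mul_assoc, ih, ← vertex_mul_arrowPower, ← mul_assoc, totalArrow_mul_vertex]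
    rfl

theorem sum_vertex : ∑ φ, vertex D C φ = 1 := PathAlgebra.sum_vertex k _ _

theorem adjoin_totalArrow_eq_top : Algebra.adjoin k
    (Set.range (vertex D C) ∪ Set.range (totalArrow D C)) = ⊤ := by
  rw [eq_top_iff, ← PathAlgebra.adjoin_eq_top]
  refine Algebra.adjoin_le ?_
  rintro x (⟨φ, rfl⟩ | ⟨⟨φ, i⟩, rfl⟩)
  · exact Algebra.subset_adjoin (Or.inl ⟨φ, rfl⟩)
  · change arrow D C i φ ∈ _
    rw [← totalArrow_mul_vertex]
    exact mul_mem (Algebra.subset_adjoin (Or.inr ⟨i, rfl⟩))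
      (Algebra.subset_adjoin (Or.inl ⟨φ, rfl⟩))

theorem arrow_mem_arrowIdeal (i : Fin C.r) (φ : D.Vertex) :
    arrow D C i φ ∈ PathAlgebra.arrowIdeal k (fun x : D.Vertex × Fin C.r => x.1)
      (fun x : D.Vertex × Fin C.r => D.shift x.1 (C.ψ x.2)) :=
  TwoSidedIdeal.subset_span ⟨(φ, i), rfl⟩

variable {D C} [IsMulCommutative L] (X : Choices D C)

theorem relationIdeal_le [Fact p.Prime] :
    relationIdeal X ≤ PathAlgebra.arrowIdealSq k (fun x : D.Vertex × Fin C.r => x.1)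
      (fun x : D.Vertex × Fin C.r => D.shift x.1 (C.ψ x.2)) := by
  refine TwoSidedIdeal.span_le.mpr ?_
  rintro x (⟨i, j, φ, rfl⟩ | ⟨i, φ, rfl⟩)
  · refine sub_mem (TwoSidedIdeal.subset_span
      ⟨_, arrow_mem_arrowIdeal D C _ _, _, arrow_mem_arrowIdeal D C _ _, rfl⟩) ?_
    rw [Algebra.smul_def]
    exact TwoSidedIdeal.mul_mem_left _ _ _ (TwoSidedIdeal.subset_span
      ⟨_, arrow_mem_arrowIdeal D C _ _, _, arrow_mem_arrowIdeal D C _ _, rfl⟩)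
  -- Here n_i ≥ 1 is needed: the power relation then contains at least two arrows.
  · obtain ⟨m, hm⟩ : ∃ m, p ^ C.n i = m + 1 + 1 :=
      ⟨p ^ C.n i - 2, by
        have := Nat.one_lt_pow (Nat.one_le_iff_ne_zero.mp (C.n_pos i)) (Fact.out : p.Prime).one_lt
        omega⟩
    rw [hm, arrowPower]
    refine TwoSidedIdeal.subset_span ⟨_, arrow_mem_arrowIdeal D C _ _, _, ?_, rfl⟩
    rw [arrowPower]
    exact TwoSidedIdeal.mul_mem_right _ _ _ (arrow_mem_arrowIdeal D C _ _)

/-- The projection of `kQ` onto `kQ / I`. -/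
def toQuantised : QuiverAlgebra D C →ₐ[k] QuantisedAlgebra X := (relationIdeal X).ringCon.mkₐ k

theorem toQuantised_surjective : Function.Surjective (toQuantised X) :=
  RingCon.mkₐ_surjective _

theorem toQuantised_eq_zero {x : QuiverAlgebra D C} (hx : x ∈ relationIdeal X) :
    toQuantised X x = 0 := by
  have : (relationIdeal X).ringCon x 0 := hx
  rw [← map_zero (toQuantised X)]
  exact Quotient.sound this

theorem exists_quantised_lift {B : Type*} [Ring B] [Algebra k B] (f : QuiverAlgebra D C →ₐ[k] B)
    (hq : ∀ i j φ, f (arrow D C j (D.shift φ (C.ψ i))) * f (arrow D C i φ) =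
      ((X.q i j φ : kˣ) : k) • (f (arrow D C i (D.shift φ (C.ψ j))) * f (arrow D C j φ)))
    (hpow : ∀ i φ, f (arrowPower D C i φ (p ^ C.n i)) = 0) :
    ∃ f' : QuantisedAlgebra X →ₐ[k] B, ∀ x, f' (toQuantised X x) = f x := by
  have hle : relationIdeal X ≤ TwoSidedIdeal.ker f := by
    refine TwoSidedIdeal.span_le.mpr ?_
    rintro x (⟨i, j, φ, rfl⟩ | ⟨i, φ, rfl⟩)
    · refine (TwoSidedIdeal.mem_ker f).mpr ?_
      rw [map_sub, map_smul, map_mul, map_mul, hq, sub_self]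
    · exact (TwoSidedIdeal.mem_ker f).mpr (hpow i φ)
  refine ⟨(relationIdeal X).ringCon.liftₐ f ?_, fun x => rfl⟩
  intro x y hxy
  have h1 : x - y ∈ relationIdeal X := (TwoSidedIdeal.rel_iff _ x y).mp hxy
  have h2 := (TwoSidedIdeal.mem_ker f).mp (hle h1)
  rw [map_sub, sub_eq_zero] at h2
  exact h2

/-- The parameter depends on the source vertex, so for total arrows it becomes the coefficient ∑
q_{i,j,φ} φ in the span of the vertices. -/
theorem totalArrow_swap (i j : Fin C.r) :
    toQuantised X (totalArrow D C j) * toQuantised X (totalArrow D C i) =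
      toQuantised X (totalArrow D C i) * toQuantised X (totalArrow D C j) *
        ∑ φ, ((X.q i j φ : kˣ) : k) • toQuantised X (vertex D C φ) := by
  have hφ : ∀ φ, toQuantised X (totalArrow D C j * totalArrow D C i * vertex D C φ) =
      toQuantised X (totalArrow D C i * totalArrow D C j *
        (((X.q i j φ : kˣ) : k) • vertex D C φ)) := by
    intro φ
    have h1 : ∀ i j, totalArrow D C j * totalArrow D C i * vertex D C φ =
        arrow D C j (D.shift φ (C.ψ i)) * arrow D C i φ := fun i j => by
      rw [mul_assoc, totalArrow_mul_vertex, ← vertex_mul_arrow, ← mul_assoc, totalArrow_mul_vertex,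
        vertex_mul_arrow]
    rw [mul_smul_comm, h1, h1, ← sub_eq_zero, ← map_sub]
    exact toQuantised_eq_zero X (TwoSidedIdeal.subset_span (Or.inl ⟨i, j, φ, rfl⟩))
  calc toQuantised X (totalArrow D C j) * toQuantised X (totalArrow D C i)
      = toQuantised X (totalArrow D C j * totalArrow D C i * ∑ φ, vertex D C φ) := by
        rw [sum_vertex, mul_one, map_mul]
    _ = ∑ φ, toQuantised X (totalArrow D C j * totalArrow D C i * vertex D C φ) := by
        rw [Finset.mul_sum, map_sum]
    _ = _ := by
        rw [Finset.sum_congr rfl fun φ _ => hφ φ, Finset.mul_sum]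
        simp only [map_mul, map_smul]

theorem totalArrow_pow_eq_zero (i : Fin C.r) :
    toQuantised X (totalArrow D C i) ^ p ^ C.n i = 0 := by
  rw [← map_pow, ← mul_one (totalArrow D C i ^ _), ← sum_vertex, Finset.mul_sum, map_sum]
  refine Finset.sum_eq_zero fun φ _ => ?_
  rw [totalArrow_pow_mul_vertex]
  exact toQuantised_eq_zero X (TwoSidedIdeal.subset_span (Or.inr ⟨i, φ, rfl⟩))

/-- The span of the vertices in `kQ / I`. -/
def vertexSpan : Submodule k (QuantisedAlgebra X) :=
  Submodule.span k (Set.range fun φ => toQuantised X (vertex D C φ))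

/-- Passing from single arrows to total arrows leaves r generators, each nilpotent; single arrows
are recovered by multiplying with vertices, which serve as coefficients. -/
theorem skewGenerated :
    SkewGenerated (vertexSpan X) fun i => toQuantised X (totalArrow D C i) where
  one_le := by
    rw [Submodule.one_le, ← map_one (toQuantised X), ← sum_vertex, map_sum]
    exact sum_mem fun φ _ => Submodule.subset_span ⟨φ, rfl⟩
  mul_le := by
    rw [vertexSpan, Submodule.span_mul_span, Submodule.span_le]
    rintro _ ⟨_, ⟨φ, rfl⟩, _, ⟨φ', rfl⟩, rfl⟩
    simp only [← map_mul]
    by_cases h : φ = φ'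
    · subst h
      rw [PathAlgebra.vertex_mul_self]
      exact Submodule.subset_span ⟨φ, rfl⟩
    · rw [PathAlgebra.vertex_mul_of_ne _ _ _ h, map_zero]
      exact zero_mem _
  coeff_mul_le i := by
    rw [vertexSpan, Submodule.span_mul_span, Submodule.span_le]
    rintro _ ⟨_, ⟨φ, rfl⟩, _, rfl, rfl⟩
    -- Shifting permutes the finite vertex set, so every vertex is the end of an arrow of type i.
    obtain ⟨φ', rfl⟩ := (Finite.injective_iff_surjective.mp (D.shift_injective (C.ψ i))) φ
    simp only [← map_mul]
    rw [vertex_mul_totalArrow, ← totalArrow_mul_vertex, map_mul]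
    exact Submodule.mul_mem_mul (Submodule.mem_span_singleton_self _)
      (Submodule.subset_span ⟨φ', rfl⟩)
  swap_le i j := by
    rw [Submodule.span_mul_span, Set.singleton_mul_singleton, Submodule.span_singleton_le_iff_mem,
      totalArrow_swap]
    exact Submodule.mul_mem_mul (Submodule.mul_mem_mul (Submodule.mem_span_singleton_self _)
      (Submodule.mem_span_singleton_self _))
      (sum_mem fun φ _ => Submodule.smul_mem _ _ (Submodule.subset_span ⟨φ, rfl⟩))
  adjoin_eq_top := by
    rw [eq_top_iff, ← (AlgHom.range_eq_top _).mpr (toQuantised_surjective X), ← Algebra.map_top,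
      ← adjoin_totalArrow_eq_top, AlgHom.map_adjoin]
    refine Algebra.adjoin_mono ?_
    rintro _ ⟨x, ⟨φ, rfl⟩ | ⟨i, rfl⟩, rfl⟩
    · exact Or.inl (Submodule.subset_span ⟨φ, rfl⟩)
    · exact Or.inr ⟨i, rfl⟩

/-- Only an upper bound is available at this stage; equality results from the comparison with R. -/
theorem finite_and_finrank_le : Module.Finite k (QuantisedAlgebra X) ∧
    Module.finrank k (QuantisedAlgebra X) ≤ (∏ i, p ^ C.n i) * Nat.card D.Vertex := by
  classical
  obtain ⟨s, hs, hc⟩ := (skewGenerated X).exists_finset_span_eq_top (totalArrow_pow_eq_zero X)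
    (e := Finset.univ.image fun φ => toQuantised X (vertex D C φ)) (by simp [vertexSpan])
  refine ⟨⟨⟨s, hs⟩⟩, ?_⟩
  calc Module.finrank k (QuantisedAlgebra X)
      = Module.finrank k (Submodule.span k (s : Set (QuantisedAlgebra X))) := by
        rw [hs, finrank_top]
    _ ≤ s.card := finrank_span_finset_le_card s
    _ ≤ _ := hc.trans (Nat.mul_le_mul_left _ (Finset.card_image_le.trans
        (by rw [Finset.card_univ, Nat.card_eq_fintype_card])))

instance : Module.Finite k (QuantisedAlgebra X) := (finite_and_finrank_le X).1

/-- The projection of `kQ / I` onto the span of the vertices. -/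
theorem exists_augmentation [Fact p.Prime] : ∃ f : QuantisedAlgebra X →ₐ[k] (D.Vertex → k),
    Function.Surjective f ∧ ∀ x, f x = 0 →
      x ∈ (⨆ i, Submodule.span k {toQuantised X (totalArrow D C i)}) * ⊤ := by
  classical
  obtain ⟨f₀, hv, ha⟩ := PathAlgebra.exists_lift (k := k) (B := D.Vertex → k)
    (src := fun x : D.Vertex × Fin C.r => x.1)
    (tgt := fun x : D.Vertex × Fin C.r => D.shift x.1 (C.ψ x.2))
    (ev := fun φ => Pi.single φ 1) (ar := fun _ => 0)
    (fun φ => by rw [← Pi.single_mul, one_mul])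
    (fun φ φ' h => by
      funext ρ
      by_cases h1 : ρ = φ
      · subst h1; simp [h]
      · simp [h1])
    (by simpa using! Finset.univ_sum_single (1 : D.Vertex → k)) (fun _ => zero_mul _)
    (fun _ => mul_zero _)
  have ha' : ∀ i φ, f₀ (arrow D C i φ) = 0 := fun i φ => ha (φ, i)
  obtain ⟨f, hf⟩ := exists_quantised_lift X f₀
    (fun i j φ => by simp only [ha', mul_zero, smul_zero])
    (fun i φ => by
      obtain ⟨m, hm⟩ := Nat.exists_eq_succ_of_ne_zero
        (pow_ne_zero (C.n i) (Fact.out : p.Prime).ne_zero)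
      rw [hm, arrowPower, map_mul, ha', zero_mul])
  have hfv : ∀ c : D.Vertex → k, f (∑ φ, c φ • toQuantised X (vertex D C φ)) = c := fun c => by
    rw [map_sum]
    simp only [map_smul, hf, hv]
    funext ρ
    simp [Finset.sum_apply, Pi.single_apply]
  refine ⟨f, fun c => ⟨_, hfv c⟩, fun x hx => ?_⟩
  -- Split x into a combination of vertices and an element of the arrow ideal. The augmentation
  -- kills the latter and reads off the coefficients of the former.
  have hx' : x ∈ vertexSpan X ⊔ (⨆ i, Submodule.span k {toQuantised X (totalArrow D C i)}) * ⊤ := by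
    rw [(skewGenerated X).coeff_sup_eq_top]
    trivial
  obtain ⟨y, hy, z, hz, rfl⟩ := Submodule.mem_sup.mp hx'
  have hfz : f z = 0 := by
    have hle : (⨆ i, Submodule.span k {toQuantised X (totalArrow D C i)}) * ⊤ ≤
        LinearMap.ker f.toLinearMap := by
      rw [Submodule.iSup_mul]
      refine iSup_le fun i => Submodule.mul_le.mpr fun a ha b _ => ?_
      obtain ⟨c, rfl⟩ := Submodule.mem_span_singleton.mp ha
      rw [LinearMap.mem_ker, AlgHom.toLinearMap_apply, map_mul, map_smul, hf, totalArrow, map_sum,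
        Finset.sum_eq_zero fun φ _ => ha' i φ, smul_zero, zero_mul]
    exact hle hz
  rw [map_add, hfz, add_zero] at hx
  obtain ⟨c, rfl⟩ := (Submodule.mem_span_range_iff_exists_fun k).mp hy
  rw [hfv] at hx
  subst hx
  simpa using hz

end Quantised


/-! ### Simplicity by averaging -/

/-- An algebra spanned by a finite group whose centre acts by scalars is simple, if the averages
over conjugates of non-central elements vanish. -/
theorem isSimpleRing_of_average {k H B : Type*} [Field k] [Group H] [Fintype H] [Ring B]
    [Algebra k B] [Nontrivial B] (u : H →* B) (hspan : Submodule.span k (Set.range u) = ⊤)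
    (hscalar : ∀ z ∈ Subgroup.center H, ∃ c : k, u z = algebraMap k B c)
    (havg : ∀ h ∉ Subgroup.center H, ∑ y, u y * u h * u y⁻¹ = 0)
    (hH : (Nat.card H : k) ≠ 0) : IsSimpleRing B := by
  classical
  have hZ : (Nat.card (Subgroup.center H) : k) ≠ 0 :=
    natCast_ne_zero_of_dvd (Subgroup.card_subgroup_dvd_card _) hH
  have hcen : ∀ h ∈ Subgroup.center H, ∑ y, u y * u h * u y⁻¹ = (Nat.card H : k) • u h := by
    intro h hh
    have : ∀ y, u y * u h * u y⁻¹ = u h := fun y => by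
      rw [← map_mul, ← map_mul, Subgroup.mem_center_iff.mp hh y, mul_inv_cancel_right]
    rw [Finset.sum_congr rfl fun y _ => this y, Finset.sum_const, Finset.card_univ,
      ← Nat.card_eq_fintype_card, Nat.cast_smul_eq_nsmul]
  -- Averaging maps B to the scalars, so on a proper two-sided ideal it is zero.
  have hAv : ∀ b : B, ∃ c : k, ∑ y, u y * b * u y⁻¹ = algebraMap k B c := by
    intro b
    have hb : b ∈ Submodule.span k (Set.range u) := hspan ▸ Submodule.mem_top
    induction hb using Submodule.span_induction with
    | mem x hx =>
      obtain ⟨h, rfl⟩ := hx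
      by_cases hh : h ∈ Subgroup.center H
      · obtain ⟨c, hc⟩ := hscalar h hh
        exact ⟨Nat.card H * c, by rw [hcen h hh, hc, Algebra.smul_def, ← map_mul]⟩
      · exact ⟨0, by rw [havg h hh, map_zero]⟩
    | zero => exact ⟨0, by simp⟩
    | add x y _ _ hx hy =>
      obtain ⟨c, hc⟩ := hx
      obtain ⟨d, hd⟩ := hy
      exact ⟨c + d, by simp only [mul_add, add_mul, Finset.sum_add_distrib, hc, hd, map_add]⟩
    | smul r x _ hx =>
      obtain ⟨c, hc⟩ := hx
      refine ⟨r * c, ?_⟩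
      simp only [mul_smul_comm, smul_mul_assoc]
      rw [← Finset.smul_sum, hc, Algebra.smul_def, ← map_mul]
  -- A reconstruction formula: for b = u(g) only the terms with gh⁻¹ central survive, and each gives
  -- |H|u(g). It recovers b from averages of the elements b·u(h⁻¹).
  have hrec : ∀ b : B, ∑ h, (∑ y, u y * (b * u h⁻¹) * u y⁻¹) * u h =
      ((Nat.card H : k) * Nat.card (Subgroup.center H)) • b := by
    intro b
    have hb : b ∈ Submodule.span k (Set.range u) := hspan ▸ Submodule.mem_top
    induction hb using Submodule.span_induction with
    | mem x hx =>
      obtain ⟨g, rfl⟩ := hx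
      have h1 : ∀ h, (∑ y, u y * (u g * u h⁻¹) * u y⁻¹) * u h =
          if g * h⁻¹ ∈ Subgroup.center H then (Nat.card H : k) • u g else 0 := by
        intro h
        rw [← map_mul u g]
        split_ifs with hc
        · rw [hcen _ hc, smul_mul_assoc, ← map_mul, inv_mul_cancel_right]
        · rw [havg _ hc, zero_mul]
      rw [Finset.sum_congr rfl fun h _ => h1 h, ← Finset.sum_filter, Finset.sum_const]
      have h2 : (Finset.univ.filter fun h => g * h⁻¹ ∈ Subgroup.center H).card =
          Nat.card (Subgroup.center H) := by
        rw [← Fintype.card_subtype, ← Nat.card_eq_fintype_card]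
        refine Nat.card_congr
          { toFun := fun h => ⟨g * h.1⁻¹, h.2⟩
            invFun := fun z => ⟨z.1⁻¹ * g, by simp⟩
            left_inv := fun h => by simp
            right_inv := fun z => by simp }
      rw [h2, ← Nat.cast_smul_eq_nsmul k, smul_smul, mul_comm]
    | zero => simp
    | add x y _ _ hx hy => simp only [add_mul, mul_add, Finset.sum_add_distrib, hx, hy, smul_add]
    | smul r x _ hx =>
      rw [smul_comm, ← hx]
      simp only [mul_smul_comm, smul_mul_assoc, Finset.smul_sum, Finset.sum_mul]
  refine ⟨⟨fun I => ?_⟩⟩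
  by_contra! hI
  obtain ⟨hbot, htop⟩ := hI
  apply hbot
  rw [eq_bot_iff]
  intro b hb
  have hzero : ∀ b ∈ I, ∑ y, u y * b * u y⁻¹ = 0 := by
    intro b hb
    obtain ⟨c, hc⟩ := hAv b
    rw [hc]
    have hmem : algebraMap k B c ∈ I := by
      rw [← hc]
      exact sum_mem fun y _ => I.mul_mem_right _ _ (I.mul_mem_left _ _ hb)
    by_contra hne
    have hc0 : c ≠ 0 := fun h => hne (by rw [h, map_zero])
    apply htop
    rw [← TwoSidedIdeal.one_mem_iff]
    have := I.mul_mem_left (algebraMap k B c⁻¹) _ hmem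
    rwa [← map_mul, inv_mul_cancel₀ hc0, map_one] at this
  have h1 := hrec b
  rw [Finset.sum_eq_zero fun h _ => by rw [hzero _ (I.mul_mem_right _ _ hb), zero_mul]] at h1
  exact (smul_eq_zero.mp h1.symm).resolve_left (mul_ne_zero hH hZ)

/-! ### Truncated polynomial algebras -/

/-- The kernel is a monomial ideal, so membership is seen on exponents, and a monomial with all
exponents below N_i is not divisible by any generator. -/
theorem linearIndependent_monomials {k A : Type*} [Field k] [CommRing A] [Algebra k A] {r : ℕ}
    {w : Fin r → A} {N : Fin r → ℕ} (hker : RingHom.ker (MvPolynomial.aeval (R := k) w) =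
      Ideal.span (Set.range fun i => (MvPolynomial.X i : MvPolynomial (Fin r) k) ^ N i)) :
    LinearIndependent k fun s : (i : Fin r) → Fin (N i) =>
      MvPolynomial.aeval w
        (MvPolynomial.monomial (Finsupp.equivFunOnFinite.symm fun i => (s i : ℕ)) (1 : k)) := by
  classical
  rw [Fintype.linearIndependent_iff]
  intro c hc s
  by_contra hcs
  set m : ((i : Fin r) → Fin (N i)) → (Fin r →₀ ℕ) :=
    fun s => Finsupp.equivFunOnFinite.symm fun i => (s i : ℕ) with hm
  have hinj : Function.Injective m := fun s s' h => by
    funext i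
    exact Fin.ext (congrFun (Finsupp.equivFunOnFinite.symm.injective h) i)
  set q : MvPolynomial (Fin r) k := ∑ s, c s • MvPolynomial.monomial (m s) 1 with hq
  have hqker : q ∈ RingHom.ker (MvPolynomial.aeval (R := k) w) := by
    rw [RingHom.mem_ker, hq, map_sum]
    simpa only [map_smul] using hc
  have hgen : (Set.range fun i => (MvPolynomial.X i : MvPolynomial (Fin r) k) ^ N i) =
      (fun s => MvPolynomial.monomial s (1 : k)) '' Set.range fun i => Finsupp.single i (N i) := by
    rw [← Set.range_comp]
    congr 1
    funext i
    rw [MvPolynomial.X_pow_eq_monomial]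
    rfl
  rw [hker, hgen, MvPolynomial.mem_ideal_span_monomial_image] at hqker
  have hsupp : m s ∈ q.support := by
    rw [MvPolynomial.mem_support_iff, hq, MvPolynomial.coeff_sum, Finset.sum_eq_single s]
    · simpa using hcs
    · intro s' _ hs'
      rw [MvPolynomial.coeff_smul, MvPolynomial.coeff_monomial, if_neg fun h => hs' (hinj h),
        smul_zero]
    · simp
  obtain ⟨_, ⟨i, rfl⟩, hle⟩ := hqker _ hsupp
  have h1 := hle i
  simp only [Finsupp.single_eq_same, hm, Finsupp.equivFunOnFinite_symm_apply_apply] at h1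
  exact absurd (s i).2 (not_lt.mpr h1)

theorem finrank_monoidAlgebra (k P : Type*) [Field k] [Finite P] :
    Module.finrank k (MonoidAlgebra k P) = Nat.card P := by
  have : Fintype P := Fintype.ofFinite _
  rw [(MonoidAlgebra.coeffLinearEquiv (S := k) (M := P) k).finrank_eq, Module.finrank_finsupp_self,
    Nat.card_eq_fintype_card]

theorem Coordinates.prod_le_card {p : ℕ} {k : Type v} {P : Type u} [Field k] [CommGroup P]
    [Finite P] {L : Subgroup (MulAut P)} (C : Coordinates p k L) :
    ∏ i, p ^ C.n i ≤ Nat.card P := by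
  have h := (linearIndependent_monomials C.ker_eq).fintype_card_le_finrank
  simpa only [Fintype.card_pi, Fintype.card_fin, finrank_monoidAlgebra] using h


/-! ### The quantised algebra in the twisted group algebra -/

section Main

variable {p : ℕ} {k : Type v} {P : Type u} [Field k] [CommGroup P] {L : Subgroup (MulAut P)}
  [IsMulCommutative L] {α : H2 L kˣ} {D : TwistExtension.{u, v, w} α} {C : Coordinates p k L}
  (X : Choices D C)

omit [IsMulCommutative L] in
theorem iterate_vertexIdempotent_mul_coordinate_pow (i : Fin C.r) (φ : D.Vertex) (m : ℕ) :
    vertexIdempotent D ((fun φ' => D.shift φ' (C.ψ i))^[m] φ) * coordinate D C i ^ m =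
      coordinate D C i ^ m * vertexIdempotent D φ := by
  induction m with
  | zero => simp
  | succ m ih =>
    rw [Function.iterate_succ_apply', pow_succ', ← mul_assoc, vertexIdempotent_mul_coordinate,
      mul_assoc, ih, mul_assoc]

/-- Up to a scalar, a path of m arrows of type i is h w_i^m e_φ for some h ∈ H, so the power
relations follow from the nilpotency of w_i. -/
theorem arrowElement_mul_power (hZ : (Nat.card (Subgroup.center D.H) : k) ≠ 0) (i : Fin C.r)
    (φ : D.Vertex) (m : ℕ) (h : D.H) :
    arrowElement X i ((fun φ' => D.shift φ' (C.ψ i))^[m] φ) *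
        (coverOf D h * coordinate D C i ^ m * vertexIdempotent D φ) =
      (((C.ψ i (D.π h))⁻¹ : kˣ) : k) •
        (coverOf D (X.g i ((fun φ' => D.shift φ' (C.ψ i))^[m] φ) * h) *
          coordinate D C i ^ (m + 1) * vertexIdempotent D φ) := by
  classical
  have hid : vertexIdempotent D φ * vertexIdempotent D φ = vertexIdempotent D φ := by
    rw [vertexIdempotent_mul D hZ, if_pos rfl]
  set ψm := (fun φ' => D.shift φ' (C.ψ i))^[m] φ with hψm
  have h1 : vertexIdempotent D ψm * (coverOf D h * coordinate D C i ^ m * vertexIdempotent D φ) =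
      coverOf D h * coordinate D C i ^ m * vertexIdempotent D φ := by
    rw [mul_assoc (coverOf D h), ← mul_assoc, ← (commute_coverOf_vertexIdempotent D ψm h).eq,
      mul_assoc, ← mul_assoc (vertexIdempotent D ψm), hψm,
      iterate_vertexIdempotent_mul_coordinate_pow, mul_assoc (coordinate D C i ^ m), hid]
  rw [arrowElement_eq, mul_assoc, h1, mul_assoc (coverOf D (X.g i ψm)),
    ← mul_assoc (coordinate D C i), ← mul_assoc (coordinate D C i), coordinate_mul_coverOf,
    smul_mul_assoc, smul_mul_assoc, mul_smul_comm, map_mul, pow_succ']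
  simp only [mul_assoc]

variable {R : Type*} [Ring R] [Algebra k R] (G : MonoidAlgebra k (CoverGroup D) →ₐ[k] R)

omit [IsMulCommutative L] in
theorem eq_of_mul_vertexIdempotent (hsum : ∑ φ, G (vertexIdempotent D φ) = 1) {x y : R}
    (h : ∀ φ, x * G (vertexIdempotent D φ) = y * G (vertexIdempotent D φ)) : x = y := by
  rw [← mul_one x, ← mul_one y, ← hsum, Finset.mul_sum, Finset.mul_sum]
  exact Finset.sum_congr rfl fun φ _ => h φ

theorem exists_quantised_map (hZ : (Nat.card (Subgroup.center D.H) : k) ≠ 0)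
    (hsum : ∑ φ, G (vertexIdempotent D φ) = 1) :
    ∃ f : QuantisedAlgebra X →ₐ[k] R,
      (∀ φ, f (toQuantised X (vertex D C φ)) = G (vertexIdempotent D φ)) ∧
      ∀ i φ, f (toQuantised X (arrow D C i φ)) = G (arrowElement X i φ) := by
  classical
  have hid : ∀ φ, vertexIdempotent D φ * vertexIdempotent D φ = vertexIdempotent D φ := fun φ => by
    rw [vertexIdempotent_mul D hZ, if_pos rfl]
  obtain ⟨f₀, hv, ha⟩ := PathAlgebra.exists_lift (k := k) (B := R)
    (src := fun x : D.Vertex × Fin C.r => x.1)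
    (tgt := fun x : D.Vertex × Fin C.r => D.shift x.1 (C.ψ x.2))
    (ev := fun φ => G (vertexIdempotent D φ)) (ar := fun x => G (arrowElement X x.2 x.1))
    (fun φ => by rw [← map_mul, hid])
    (fun φ φ' h => by rw [← map_mul, vertexIdempotent_mul D hZ, if_neg h, map_zero])
    hsum (fun x => by rw [← map_mul, arrowElement_eq, mul_assoc, hid])
    (fun x => by
      rw [← map_mul, ← vertexIdempotent_mul_arrowElement, ← mul_assoc, hid])
  have ha' : ∀ i φ, f₀ (arrow D C i φ) = G (arrowElement X i φ) := fun i φ => ha (φ, i)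
  obtain ⟨f, hf⟩ := exists_quantised_lift X f₀
    (fun i j φ => by
      rw [ha', ha', ha', ha', ← map_mul, arrowElement_mul_arrowElement X hZ, map_smul, map_mul])
    (fun i φ => by
      have hpow : ∀ m, ∃ (c : k) (h : D.H), f₀ (arrowPower D C i φ m) =
          c • G (coverOf D h * coordinate D C i ^ m * vertexIdempotent D φ) := by
        intro m
        induction m with
        | zero =>
          refine ⟨1, 1, ?_⟩
          rw [map_one, pow_zero, one_mul, one_mul, one_smul]
          exact hv φ
        | succ m ih =>
          obtain ⟨c, h, hc⟩ := ih
          rw [arrowPower, map_mul, ha', hc, mul_smul_comm, ← map_mul,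
            arrowElement_mul_power X hZ, map_smul, smul_smul]
          exact ⟨_, _, rfl⟩
      obtain ⟨c, h, hc⟩ := hpow (p ^ C.n i)
      rw [hc, coordinate_pow_eq_zero, mul_zero, zero_mul, map_zero, smul_zero])
  exact ⟨f, fun φ => (hf _).trans (hv φ), fun i φ => (hf _).trans (ha' i φ)⟩

/-- The element `∑ ξ_φ(h)⁻¹ h e_φ`. -/
def diagonalElement (h : D.H) : R :=
  ∑ φ, (((X.ξ φ h)⁻¹ : kˣ) : k) • G (coverOf D h * vertexIdempotent D φ)

variable (hZ : (Nat.card (Subgroup.center D.H) : k) ≠ 0)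
include hZ

theorem diagonalElement_mul_vertex (h : D.H) (φ : D.Vertex) :
    diagonalElement X G h * G (vertexIdempotent D φ) =
      (((X.ξ φ h)⁻¹ : kˣ) : k) • G (coverOf D h * vertexIdempotent D φ) := by
  classical
  rw [diagonalElement, Finset.sum_mul, Finset.sum_eq_single φ]
  · rw [smul_mul_assoc, ← map_mul, mul_assoc, vertexIdempotent_mul D hZ, if_pos rfl]
  · intro φ' _ hne
    rw [smul_mul_assoc, ← map_mul, mul_assoc, vertexIdempotent_mul D hZ, if_neg hne, mul_zero,
      map_zero, smul_zero]
  · simp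

theorem vertex_mul_diagonalElement (h : D.H) (φ : D.Vertex) :
    G (vertexIdempotent D φ) * diagonalElement X G h =
      (((X.ξ φ h)⁻¹ : kˣ) : k) • G (coverOf D h * vertexIdempotent D φ) := by
  rw [← diagonalElement_mul_vertex X G hZ, diagonalElement, Finset.sum_mul, Finset.mul_sum]
  classical
  refine Finset.sum_congr rfl fun φ' _ => ?_
  rw [mul_smul_comm, smul_mul_assoc, ← map_mul, ← map_mul, ← mul_assoc,
    ← (commute_coverOf_vertexIdempotent D φ h).eq, mul_assoc, mul_assoc, vertexIdempotent_mul D hZ,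
    vertexIdempotent_mul D hZ]
  congr 3
  by_cases hφ : φ = φ'
  · subst hφ; rfl
  · rw [if_neg hφ, if_neg (Ne.symm hφ)]

variable (hsum : ∑ φ, G (vertexIdempotent D φ) = 1)
include hsum

/-- The homomorphism `h ↦ ∑ ξ_φ(h)⁻¹ h e_φ`. -/
def diagonalHom : D.H →* R where
  toFun := diagonalElement X G
  map_one' := eq_of_mul_vertexIdempotent G hsum fun φ => by
    rw [diagonalElement_mul_vertex X G hZ, map_one, map_one, inv_one, Units.val_one, one_smul,
      one_mul, one_mul]
  map_mul' h h' := eq_of_mul_vertexIdempotent G hsum fun φ => by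
    rw [diagonalElement_mul_vertex X G hZ, mul_assoc, diagonalElement_mul_vertex X G hZ,
      mul_smul_comm, (commute_coverOf_vertexIdempotent D φ h').eq, map_mul G _ (coverOf D h'),
      ← mul_assoc, diagonalElement_mul_vertex X G hZ, smul_mul_assoc, smul_smul, ← map_mul G,
      mul_assoc, ← (commute_coverOf_vertexIdempotent D φ h').eq, ← mul_assoc, ← Units.val_mul,
      map_mul (X.ξ φ), map_mul (coverOf D), mul_inv, mul_comm ((X.ξ φ) h)⁻¹]

theorem diagonalHom_mul_vertex (h : D.H) (φ : D.Vertex) :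
    diagonalHom X G hZ hsum h * G (vertexIdempotent D φ) =
      (((X.ξ φ h)⁻¹ : kˣ) : k) • G (coverOf D h * vertexIdempotent D φ) :=
  diagonalElement_mul_vertex X G hZ h φ

/-- On e_φ the central z acts by φ(z), and the twist by ξ_φ⁻¹ = φ⁻¹φ₀ turns this into φ₀(z), the
same for all φ. -/
theorem diagonalHom_center (z : Subgroup.center D.H) :
    diagonalHom X G hZ hsum z = algebraMap k R ((X.φ₀.1 z : kˣ) : k) :=
  eq_of_mul_vertexIdempotent G hsum fun φ => by
    rw [diagonalHom_mul_vertex, coverOf_mul_vertexIdempotent, map_smul, smul_smul,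
      ← Algebra.smul_def, ← Units.val_mul, X.ξ_restrict, mul_inv, inv_inv, mul_right_comm,
      inv_mul_cancel, one_mul]

/-- Moving h past g_{i,φ} w_i e_φ costs χ(hgh⁻¹g⁻¹)ψ_i(h) with g = g_{i,φ}, and the twist changes
from ξ at φ to ξ at φψ_i. The defining equation of g_{i,φ} cancels these factors. -/
theorem commute_diagonalHom_arrowElement (h : D.H) (i : Fin C.r) (φ : D.Vertex) :
    Commute (G (arrowElement X i φ)) (diagonalHom X G hZ hsum h) := by
  classical
  have hid : vertexIdempotent D φ * vertexIdempotent D φ = vertexIdempotent D φ := by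
    rw [vertexIdempotent_mul D hZ, if_pos rfl]
  have hcomm : h * X.g i φ = X.g i φ * h * (h * X.g i φ * h⁻¹ * (X.g i φ)⁻¹) := by
    rw [Subgroup.mem_center_iff.mp (D.central (D.commutator_mem_ker h (X.g i φ)))]
    group
  have hpair : coverOf D (h * X.g i φ * h⁻¹ * (X.g i φ)⁻¹) * vertexIdempotent D φ =
      ((D.pairing h (X.g i φ) : kˣ) : k) • vertexIdempotent D φ := by
    have h1 := φ.2 ⟨_, D.commutator_mem_ker h (X.g i φ)⟩
    have h2 := coverOf_mul_vertexIdempotent D φ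
      ⟨_, D.central (D.commutator_mem_ker h (X.g i φ))⟩
    rw [h1] at h2
    exact h2
  have hcW : coverOf D (h * X.g i φ * h⁻¹ * (X.g i φ)⁻¹) * coordinate D C i =
      coordinate D C i * coverOf D (h * X.g i φ * h⁻¹ * (X.g i φ)⁻¹) := by
    rw [coverOf_mul_coordinate, MonoidHom.mem_ker.mp (D.commutator_mem_ker h (X.g i φ)), map_one,
      Units.val_one, one_smul]
  have hS : coverOf D h * (coverOf D (X.g i φ) * coordinate D C i * vertexIdempotent D φ) =
      ((D.pairing h (X.g i φ) * C.ψ i (D.π h) : kˣ) : k) •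
        (coverOf D (X.g i φ) * coordinate D C i * (coverOf D h * vertexIdempotent D φ)) := by
    calc coverOf D h * (coverOf D (X.g i φ) * coordinate D C i * vertexIdempotent D φ)
        = coverOf D (h * X.g i φ) * coordinate D C i * vertexIdempotent D φ := by
          rw [map_mul]; simp only [mul_assoc]
      _ = coverOf D (X.g i φ) * coverOf D h *
            (coverOf D (h * X.g i φ * h⁻¹ * (X.g i φ)⁻¹) * coordinate D C i) *
              vertexIdempotent D φ := by
          rw [hcomm, map_mul, map_mul, ← hcomm]; simp only [mul_assoc]
      _ = coverOf D (X.g i φ) * (coverOf D h * coordinate D C i) *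
            (coverOf D (h * X.g i φ * h⁻¹ * (X.g i φ)⁻¹) * vertexIdempotent D φ) := by
          rw [hcW]; simp only [mul_assoc]
      _ = _ := by
          rw [hpair, coverOf_mul_coordinate, mul_smul_comm, mul_smul_comm, smul_mul_assoc,
            smul_smul, ← Units.val_mul]
          simp only [mul_assoc]
  change _ * _ = _ * _
  have h1 : G (arrowElement X i φ) * diagonalHom X G hZ hsum h = (((X.ξ φ h)⁻¹ : kˣ) : k) •
      G (coverOf D (X.g i φ) * coordinate D C i * (coverOf D h * vertexIdempotent D φ)) := by
    rw [arrowElement_eq, map_mul, mul_assoc]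
    rw [show G (vertexIdempotent D φ) * diagonalHom X G hZ hsum h = _ from
      vertex_mul_diagonalElement X G hZ h φ, mul_smul_comm, ← map_mul]
  have h2 : diagonalHom X G hZ hsum h * G (arrowElement X i φ) =
      (((X.ξ (D.shift φ (C.ψ i)) h)⁻¹ : kˣ) : k) •
        G (coverOf D h * (coverOf D (X.g i φ) * coordinate D C i * vertexIdempotent D φ)) := by
    rw [← vertexIdempotent_mul_arrowElement, map_mul, ← mul_assoc, diagonalHom_mul_vertex,
      smul_mul_assoc, ← map_mul, mul_assoc, vertexIdempotent_mul_arrowElement, arrowElement_eq]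
  rw [h1, h2, hS, map_smul, smul_smul, ← Units.val_mul, X.g_spec]
  congr 2
  rw [mul_assoc, mul_assoc, ← mul_assoc, inv_mul_cancel, inv_mul_cancel, one_mul, mul_one]

variable (f : QuantisedAlgebra X →ₐ[k] R)
  (hfv : ∀ φ, f (toQuantised X (vertex D C φ)) = G (vertexIdempotent D φ))
  (hfa : ∀ i φ, f (toQuantised X (arrow D C i φ)) = G (arrowElement X i φ))
include hfv hfa

theorem commute_quantised_diagonalHom (x : QuantisedAlgebra X) (h : D.H) :
    Commute (f x) (diagonalHom X G hZ hsum h) := by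
  obtain ⟨y, rfl⟩ := toQuantised_surjective X x
  have hy : y ∈ Algebra.adjoin k (Set.range (vertex D C) ∪
      Set.range (PathAlgebra.arrow k (fun x : D.Vertex × Fin C.r => x.1)
        (fun x : D.Vertex × Fin C.r => D.shift x.1 (C.ψ x.2)))) := by
    rw [PathAlgebra.adjoin_eq_top]; trivial
  induction hy using Algebra.adjoin_induction with
  | mem y hy =>
    rcases hy with ⟨φ, rfl⟩ | ⟨⟨φ, i⟩, rfl⟩
    · rw [hfv]
      exact (vertex_mul_diagonalElement X G hZ h φ).trans
        (diagonalElement_mul_vertex X G hZ h φ).symm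
    · exact (hfa i φ).symm ▸ commute_diagonalHom_arrowElement X G hZ hsum h i φ
  | algebraMap c =>
    rw [AlgHom.commutes, AlgHom.commutes]
    exact Algebra.commutes c _
  | add y z _ _ hy hz => rw [map_add, map_add]; exact hy.add_left hz
  | mul y z _ _ hy hz => rw [map_mul, map_mul]; exact hy.mul_left hz

/-- Undoing the twist gives h e_φ, hence H. Multiplying an arrow by g_{i,φ}⁻¹ gives w_i e_φ, hence
every w_i, and these generate kP. -/
theorem subalgebra_eq_top (hG : Function.Surjective G) {A : Subalgebra k R}
    (hfA : ∀ x, f x ∈ A) (huA : ∀ h, diagonalHom X G hZ hsum h ∈ A) : A = ⊤ := by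
  have hcover : ∀ h, G (coverOf D h) ∈ A := by
    intro h
    rw [← mul_one (coverOf D h), map_mul, map_one, ← hsum, Finset.mul_sum]
    refine sum_mem fun φ _ => ?_
    have h1 := diagonalHom_mul_vertex X G hZ hsum h φ
    rw [← hfv] at h1
    have h2 := A.smul_mem (h1 ▸ A.mul_mem (huA h) (hfA (toQuantised X (vertex D C φ))))
      ((X.ξ φ h : kˣ) : k)
    rwa [smul_smul, Units.mul_inv, one_smul, map_mul] at h2
  have hcoord : ∀ i, G (coordinate D C i) ∈ A := by
    intro i
    rw [← mul_one (coordinate D C i), map_mul, map_one, ← hsum, Finset.mul_sum]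
    refine sum_mem fun φ _ => ?_
    have h1 := A.mul_mem (hcover (X.g i φ)⁻¹) (hfA (toQuantised X (arrow D C i φ)))
    rwa [hfa, ← map_mul, arrowElement_eq, mul_assoc (coverOf D (X.g i φ)), ← mul_assoc, ← map_mul,
      inv_mul_cancel, map_one, one_mul, map_mul] at h1
  have hbase : ∀ x, G (baseEmbedding D x) ∈ A := by
    intro x
    obtain ⟨q, rfl⟩ := C.surjective x
    induction q using MvPolynomial.induction_on with
    | C c =>
      rw [MvPolynomial.algHom_C, AlgHom.commutes, AlgHom.commutes]
      exact A.algebraMap_mem c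
    | add q q' hq hq' => rw [map_add, map_add, map_add]; exact A.add_mem hq hq'
    | mul_X q i hq =>
      rw [map_mul, map_mul, map_mul, MvPolynomial.aeval_X]
      exact A.mul_mem hq (hcoord i)
  rw [eq_top_iff]
  intro y _
  obtain ⟨x, rfl⟩ := hG y
  induction x using MonoidAlgebra.induction_on with
  | of g =>
    have h1 : MonoidAlgebra.of k (CoverGroup D) g =
        baseEmbedding D (MonoidAlgebra.of k P g.left) * coverOf D g.right := by
      simp only [baseEmbedding, coverOf, MonoidHom.comp_apply, MonoidAlgebra.of_apply,
        MonoidAlgebra.mapDomainAlgHom_apply, MonoidAlgebra.mapDomain_single,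
        MonoidAlgebra.single_mul_single, mul_one, SemidirectProduct.inl_left_mul_inr_right]
    rw [h1, map_mul]
    exact A.mul_mem (hbase _) (hcover _)
  | add x y hx hy => rw [map_add]; exact A.add_mem (hx trivial) (hy trivial)
  | smul c x hx => rw [map_smul]; exact A.smul_mem (hx trivial) c

end Main


/-! ### The twisted group algebra as kQ/I tensored with a matrix algebra -/

section MatrixAlgebra

open scoped TensorProduct

variable {p : ℕ} [Fact p.Prime] {k : Type v} [Field k] [IsAlgClosed k] [CharP k p]
  {P : Type u} [CommGroup P] {L : Subgroup (MulAut P)} [IsMulCommutative L]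
  {α : H2 L kˣ} {D : TwistExtension.{u, v, w} α} {C : Coordinates p k L}
  {R : Type*} [Ring R] [Algebra k R]

/-- The elements `∑ ξ_φ(h)⁻¹ h e_φ` span a full matrix algebra. -/
theorem exists_algEquiv_matrix_range (hL : (Nat.card L).Coprime p) (X : Choices D C)
    (G : MonoidAlgebra k (CoverGroup D) →ₐ[k] R) [Nontrivial R]
    (hZ : (Nat.card (Subgroup.center D.H) : k) ≠ 0)
    (hsum : ∑ φ, G (vertexIdempotent D φ) = 1) :
    ∃ (m : ℕ) (_ : NeZero m), m * m ≤ (Subgroup.center D.H).index ∧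
      Nonempty ((MonoidAlgebra.lift k R D.H (diagonalHom X G hZ hsum)).range ≃ₐ[k]
        Matrix (Fin m) (Fin m) k) := by
  classical
  have : Fintype D.H := Fintype.ofFinite _
  set U := MonoidAlgebra.lift k R D.H (diagonalHom X G hZ hsum) with hU
  let uB : D.H →* U.range := (U.rangeRestrict : _ →* U.range).comp (MonoidAlgebra.of k D.H)
  have huB : ∀ h, ((uB h : U.range) : R) = diagonalHom X G hZ hsum h := fun h =>
    MonoidAlgebra.lift_of _ _
  have hscalar : ∀ z (hz : z ∈ Subgroup.center D.H),
      uB z = algebraMap k U.range ((X.φ₀.1 ⟨z, hz⟩ : kˣ) : k) := fun z hz =>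
    Subtype.ext ((huB z).trans (diagonalHom_center X G hZ hsum ⟨z, hz⟩))
  have hspan : Submodule.span k (Set.range uB) = ⊤ := by
    rw [eq_top_iff]
    rintro ⟨_, x, rfl⟩ -
    change U.rangeRestrict x ∈ _
    induction x using MonoidAlgebra.induction_on with
    | of h => exact Submodule.subset_span ⟨h, rfl⟩
    | add x y hx hy => rw [map_add]; exact Submodule.add_mem _ hx hy
    | smul c x hx => rw [map_smul]; exact Submodule.smul_mem _ c hx
  -- Conjugation only rescales by the pairing, so the average of a non-central element is a
  -- character sum equal to zero.
  have hconj : ∀ y h, uB y * uB h * uB y⁻¹ = ((D.pairing y h : kˣ) : k) • uB h := fun y h => by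
    have h1 : y * h * y⁻¹ = (y * h * y⁻¹ * h⁻¹) * h := by group
    have h2 := X.φ₀.2 ⟨_, D.commutator_mem_ker y h⟩
    rw [← map_mul, ← map_mul, h1, map_mul, hscalar _ (D.central (D.commutator_mem_ker y h)), h2,
      Algebra.smul_def]
    rfl
  have hsimple : IsSimpleRing U.range := by
    refine isSimpleRing_of_average uB hspan (fun z hz => ⟨_, hscalar z hz⟩) (fun h hh => ?_)
      (D.card_cover_ne_zero p hL)
    rw [Finset.sum_congr rfl fun y _ => hconj y h, ← Finset.sum_smul]
    have h1 := sum_hom_units_eq_zero ((Units.coeHom k).comp (D.pairingHom h)) (fun h3 =>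
      D.pairingHom_ne_one hh (by
        ext y
        exact DFunLike.congr_fun h3 y))
    have h2 : ∑ y, ((D.pairing y h : kˣ) : k) = 0 := h1
    rw [h2, zero_smul]
  have hfin : Finite (D.H ⧸ Subgroup.center D.H) := inferInstance
  have : Fintype (D.H ⧸ Subgroup.center D.H) := Fintype.ofFinite _
  -- The centre acts by scalars, so representatives of H/Z(H) already span; this gives the upper
  -- bound on m².
  have hspan' : Submodule.span k
      (Set.range fun x : D.H ⧸ Subgroup.center D.H => uB x.out) = ⊤ := by
    rw [eq_top_iff, ← hspan, Submodule.span_le]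
    rintro _ ⟨h, rfl⟩
    obtain ⟨z, hz⟩ := QuotientGroup.mk_out_eq_mul (Subgroup.center D.H) h
    have h1 : h = (QuotientGroup.mk h : D.H ⧸ Subgroup.center D.H).out * (z : D.H)⁻¹ := by
      rw [hz, mul_inv_cancel_right]
    rw [h1, map_mul, hscalar _ (inv_mem z.2), ← Algebra.commutes, ← Algebra.smul_def]
    exact Submodule.smul_mem _ _ (Submodule.subset_span ⟨_, rfl⟩)
  have hfd : FiniteDimensional k U.range :=
    ⟨⟨Finset.univ.image fun x : D.H ⧸ Subgroup.center D.H => uB x.out, by simpa using hspan'⟩⟩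
  obtain ⟨m, hm, ⟨e⟩⟩ := IsSimpleRing.exists_algEquiv_matrix_of_isAlgClosed k U.range
  refine ⟨m, hm, ?_, ⟨e⟩⟩
  have h1 : Module.finrank k U.range = m * m := by
    rw [e.toLinearEquiv.finrank_eq, Module.finrank_matrix]
    simp
  rw [← h1, ← finrank_top, ← hspan', Subgroup.index, Nat.card_eq_fintype_card]
  exact finrank_range_le_card _

/-- The algebra `k_α(P ⋊ L)` is a full matrix algebra over the quantised algebra. -/
theorem exists_algEquiv_matrix [Finite P] (hL : (Nat.card L).Coprime p) (X : Choices D C)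
    (G : MonoidAlgebra k (CoverGroup D) →ₐ[k] R) (hG : Function.Surjective G)
    (hsum : ∑ φ, G (vertexIdempotent D φ) = 1) [Module.Finite k R]
    (hR : Module.finrank k R = Nat.card P * Nat.card L) (f : QuantisedAlgebra X →ₐ[k] R)
    (hfv : ∀ φ, f (toQuantised X (vertex D C φ)) = G (vertexIdempotent D φ))
    (hfa : ∀ i φ, f (toQuantised X (arrow D C i φ)) = G (arrowElement X i φ)) :
    Function.Injective f ∧ ∃ (m : ℕ) (_ : NeZero m), m * m = (Subgroup.center D.H).index ∧
      Nonempty (R ≃ₐ[k] Matrix (Fin m) (Fin m) (QuantisedAlgebra X)) := by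
  have hZ := D.card_center_ne_zero p hL
  have hLfin := D.finite_quotient
  have hpos : 0 < Module.finrank k R := by
    rw [hR]; exact Nat.mul_pos Nat.card_pos Nat.card_pos
  have hnt : Nontrivial R := Module.nontrivial_of_finrank_pos hpos
  obtain ⟨m, hm, hle, ⟨e⟩⟩ := exists_algEquiv_matrix_range hL X G hZ hsum
  set B := (MonoidAlgebra.lift k R D.H (diagonalHom X G hZ hsum)).range with hB
  have hcomm : ∀ (x : QuantisedAlgebra X) (b : B), Commute (f x) (B.val b) := by
    rintro x ⟨_, y, rfl⟩
    change Commute (f x) (MonoidAlgebra.lift k R D.H (diagonalHom X G hZ hsum) y)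
    induction y using MonoidAlgebra.induction_on with
    | of h =>
      rw [MonoidAlgebra.lift_of]
      exact commute_quantised_diagonalHom X G hZ hsum f hfv hfa x h
    | add y z hy hz => rw [map_add]; exact hy.add_right hz
    | smul c y hy => rw [map_smul]; exact hy.smul_right c
  let Θ : QuantisedAlgebra X ⊗[k] B →ₐ[k] R := Algebra.TensorProduct.lift f B.val hcomm
  have hΘ : Function.Surjective Θ := by
    rw [← AlgHom.range_eq_top]
    refine subalgebra_eq_top X G hZ hsum f hfv hfa hG (fun x => ?_) fun h => ?_
    · exact ⟨x ⊗ₜ 1, by simp [Θ]⟩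
    · have hmem : diagonalHom X G hZ hsum h ∈ B :=
        ⟨MonoidAlgebra.of k D.H h, MonoidAlgebra.lift_of _ _⟩
      exact ⟨1 ⊗ₜ ⟨_, hmem⟩, by simp [Θ]⟩
  have hBfin : Module.Finite k B := Module.Finite.equiv e.symm.toLinearEquiv
  have hfB : Module.finrank k B = m * m := by
    rw [e.toLinearEquiv.finrank_eq, Module.finrank_matrix]
    simp
  have hfT : Module.finrank k (QuantisedAlgebra X ⊗[k] B) =
      Module.finrank k (QuantisedAlgebra X) * (m * m) := by
    rw [Module.finrank_tensorProduct, hfB]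
  have hKle : Module.finrank k (QuantisedAlgebra X) ≤ Nat.card P * Nat.card D.Vertex :=
    (finite_and_finrank_le X).2.trans (Nat.mul_le_mul_right _ C.prod_le_card)
  have hge : Module.finrank k R ≤ Module.finrank k (QuantisedAlgebra X ⊗[k] B) :=
    LinearMap.finrank_le_finrank_of_surjective (f := Θ.toLinearMap) hΘ
  have hR' : Module.finrank k R =
      Nat.card P * Nat.card D.Vertex * (Subgroup.center D.H).index := by
    rw [hR, ← D.card_vertex_mul_index p hL, mul_assoc]
  -- Surjectivity of Θ gives |P||V||H:Z(H)| ≤ dim K · m² ≤ |P||V|m², where the common factor |P||V|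
  -- is positive.
  have hidx : m * m = (Subgroup.center D.H).index := by
    refine le_antisymm hle ?_
    have hV : 0 < Nat.card P * Nat.card D.Vertex := by
      refine Nat.pos_of_ne_zero fun h0 => ?_
      rw [hR', h0, zero_mul] at hpos
      exact lt_irrefl _ hpos
    refine Nat.le_of_mul_le_mul_left ?_ hV
    rw [← hR']
    exact hge.trans (hfT.le.trans (Nat.mul_le_mul_right _ hKle))
  have heq : Module.finrank k (QuantisedAlgebra X ⊗[k] B) = Module.finrank k R := by
    refine le_antisymm ?_ hge
    rw [hfT, hR', hidx]
    exact Nat.mul_le_mul_right _ hKle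
  have hinj : Function.Injective Θ :=
    (LinearMap.injective_iff_surjective_of_finrank_eq_finrank heq (f := Θ.toLinearMap)).mpr hΘ
  refine ⟨?_, m, hm, hidx, ⟨?_⟩⟩
  · intro x y hxy
    have hBnt : Nontrivial B := inferInstance
    have hleft : Function.Injective
        (Algebra.TensorProduct.includeLeft : QuantisedAlgebra X →ₐ[k] QuantisedAlgebra X ⊗[k] B) :=
      Algebra.TensorProduct.includeLeft_injective (FaithfulSMul.algebraMap_injective k B)
    refine hleft (hinj ?_)
    simpa [Θ] using hxy
  · exact (AlgEquiv.ofBijective Θ ⟨hinj, hΘ⟩).symm.trans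
      ((Algebra.TensorProduct.congr AlgEquiv.refl e).trans
        (matrixEquivTensor (Fin m) k (QuantisedAlgebra X)).symm)

end MatrixAlgebra


/-! ### Coordinates on the group algebra of an abelian `p`-group -/

section Truncated

variable {k : Type*} [Field k]

/-- The straightening bound with coefficients k: in a commutative algebra the swap condition is
trivial. -/
theorem finite_and_finrank_truncated_le {r : ℕ} (N : Fin r → ℕ) :
    Module.Finite k (MvPolynomial (Fin r) k ⧸ Ideal.span
        (Set.range fun i => (MvPolynomial.X i : MvPolynomial (Fin r) k) ^ N i)) ∧
      Module.finrank k (MvPolynomial (Fin r) k ⧸ Ideal.span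
        (Set.range fun i => (MvPolynomial.X i : MvPolynomial (Fin r) k) ^ N i)) ≤ ∏ i, N i := by
  classical
  set I := Ideal.span (Set.range fun i => (MvPolynomial.X i : MvPolynomial (Fin r) k) ^ N i)
  have hgen : SkewGenerated (1 : Submodule k (MvPolynomial (Fin r) k ⧸ I))
      fun i => Ideal.Quotient.mkₐ k I (MvPolynomial.X i) :=
    { one_le := le_rfl
      mul_le := (one_mul _).le
      coeff_mul_le := fun i => by rw [one_mul, mul_one]
      swap_le := fun i j => by
        rw [mul_one, Submodule.span_mul_span, Submodule.span_mul_span, Set.singleton_mul_singleton,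
          Set.singleton_mul_singleton, mul_comm]
      adjoin_eq_top := by
        rw [eq_top_iff, ← (AlgHom.range_eq_top _).mpr (Ideal.Quotient.mkₐ_surjective k I),
          ← Algebra.map_top, ← MvPolynomial.adjoin_range_X, AlgHom.map_adjoin, ← Set.range_comp]
        exact Algebra.adjoin_mono Set.subset_union_right }
  obtain ⟨s, hs, hc⟩ := hgen.exists_finset_span_eq_top (N := N)
    (fun i => by
      rw [← map_pow]
      exact Ideal.Quotient.eq_zero_iff_mem.mpr (Ideal.subset_span ⟨i, rfl⟩))
    (e := {1}) (by rw [Finset.coe_singleton, Submodule.one_eq_span])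
  refine ⟨⟨⟨s, hs⟩⟩, ?_⟩
  calc Module.finrank k (MvPolynomial (Fin r) k ⧸ I)
      = Module.finrank k (Submodule.span k (s : Set (MvPolynomial (Fin r) k ⧸ I))) := by
        rw [hs, finrank_top]
    _ ≤ s.card := finrank_span_finset_le_card s
    _ ≤ ∏ i, N i := by simpa using hc

/-- The truncated polynomial algebra maps onto A and has dimension at most that of A, so the map is
injective. -/
theorem ker_aeval_eq {A : Type*} [CommRing A] [Algebra k A] [Module.Finite k A] {r : ℕ}
    {w : Fin r → A} {N : Fin r → ℕ} (hw : ∀ i, w i ^ N i = 0)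
    (hsurj : Function.Surjective (MvPolynomial.aeval (R := k) w))
    (hdim : ∏ i, N i ≤ Module.finrank k A) :
    RingHom.ker (MvPolynomial.aeval (R := k) w) =
      Ideal.span (Set.range fun i => (MvPolynomial.X i : MvPolynomial (Fin r) k) ^ N i) := by
  set I := Ideal.span (Set.range fun i => (MvPolynomial.X i : MvPolynomial (Fin r) k) ^ N i)
  have hle : I ≤ RingHom.ker (MvPolynomial.aeval (R := k) w) := by
    refine Ideal.span_le.mpr ?_
    rintro _ ⟨i, rfl⟩
    simp [RingHom.mem_ker, hw]
  refine le_antisymm (fun q hq => ?_) hle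
  have hfin := (finite_and_finrank_truncated_le (k := k) N).1
  let F : MvPolynomial (Fin r) k ⧸ I →ₐ[k] A :=
    Ideal.Quotient.liftₐ I (MvPolynomial.aeval w) fun a ha => hle ha
  have hF : Function.Surjective F := fun a => by
    obtain ⟨q, rfl⟩ := hsurj a
    exact ⟨Ideal.Quotient.mk I q, rfl⟩
  have heq : Module.finrank k (MvPolynomial (Fin r) k ⧸ I) = Module.finrank k A :=
    le_antisymm ((finite_and_finrank_truncated_le (k := k) N).2.trans hdim)
      (LinearMap.finrank_le_finrank_of_surjective (f := F.toLinearMap) hF)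
  have hinj : Function.Injective F :=
    (LinearMap.injective_iff_surjective_of_finrank_eq_finrank heq (f := F.toLinearMap)).mpr hF
  exact Ideal.Quotient.eq_zero_iff_mem.mp (hinj ((show F (Ideal.Quotient.mk I q) = 0 from hq).trans
    (map_zero F).symm))

open Submodule in
theorem exists_span_range_pow_eq_bot {A ι : Type*} [CommRing A] [Algebra k A] [Finite ι] {a : ι → A}
    (ha : ∀ i, IsNilpotent (a i)) : ∃ n, (span k (Set.range a)) ^ n = ⊥ := by
  have hfg : (Ideal.span (Set.range a)).FG := Submodule.fg_span (Set.finite_range a)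
  obtain ⟨n, hn⟩ := (Ideal.FG.isNilpotent_iff_le_nilradical hfg).mpr (Ideal.span_le.mpr (by
    rintro _ ⟨i, rfl⟩
    exact mem_nilradical.mpr (ha i)))
  have hle : ∀ n, (span k (Set.range a)) ^ n ≤
      ((Ideal.span (Set.range a)) ^ n).restrictScalars k := by
    intro n
    induction n with
    | zero => intro x _; simp
    | succ n ih =>
      rw [pow_succ, pow_succ]
      refine Submodule.mul_le.mpr fun x hx y hy => Ideal.mul_mem_mul (ih hx) ?_
      exact Submodule.span_le_restrictScalars k A (Set.range a) hy
  refine ⟨n, eq_bot_iff.mpr ((hle n).trans ?_)⟩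
  intro x hx
  have : x ∈ (Ideal.span (Set.range a)) ^ n := hx
  rw [hn] at this
  exact this

open Submodule in
/-- If `A = k + M A` with `M` the span of nilpotent elements, and if `w` spans `M` modulo `M² A`,
then the elements `w` generate `A`. -/
theorem aeval_surjective_of_le {A : Type*} [CommRing A] [Algebra k A] {r : ℕ} {M : Submodule k A}
    {w : Fin r → A} {n : ℕ} (hM : M ^ n = ⊥) (hw : ∀ i, IsNilpotent (w i)) (htop : 1 ⊔ M * ⊤ = ⊤)
    (hle : M ≤ span k (Set.range w) ⊔ M * M * ⊤) :
    Function.Surjective (MvPolynomial.aeval (R := k) w) := by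
  set Y := span k (Set.range w)
  -- Nakayama by iteration: substitute the hypothesis into the last factor of M until its power
  -- vanishes.
  have h1 : ∀ m, M * ⊤ ≤ Y * ⊤ ⊔ M ^ (m + 1) * ⊤ := by
    intro m
    induction m with
    | zero => rw [zero_add, pow_one]; exact le_sup_right
    | succ m ih =>
      refine ih.trans (sup_le le_sup_left ?_)
      calc M ^ (m + 1) * ⊤ = M ^ m * (M * ⊤) := by rw [pow_succ, mul_assoc]
        _ ≤ M ^ m * ((Y ⊔ M * M * ⊤) * ⊤) := mul_le_mul_right (mul_le_mul_left hle _) _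
        _ = Y * (M ^ m * ⊤) ⊔ M ^ (m + 1 + 1) * (⊤ * ⊤) := by
          rw [Submodule.sup_mul, Submodule.mul_sup, mul_left_comm, pow_succ, pow_succ]
          simp only [mul_assoc]
        _ ≤ _ := sup_le_sup (mul_le_mul_right le_top _) (mul_le_mul_right le_top _)
  have h2 : M * ⊤ ≤ Y * ⊤ := by
    refine (h1 n).trans (sup_le le_rfl ?_)
    rw [pow_succ, hM, bot_mul, bot_mul]
    exact bot_le
  have h3 : (⊤ : Submodule k A) ≤ 1 ⊔ Y * ⊤ := htop.symm.le.trans (sup_le_sup le_rfl h2)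
  obtain ⟨l, hl⟩ := exists_span_range_pow_eq_bot (k := k) hw
  set S := Subalgebra.toSubmodule (MvPolynomial.aeval (R := k) w).range
  have hYS : ∀ m, Y ^ m ≤ S := by
    intro m
    have hY : Y ≤ S := span_le.mpr (by
      rintro _ ⟨i, rfl⟩
      exact ⟨MvPolynomial.X i, by simp⟩)
    induction m with
    | zero =>
      rw [pow_zero]
      exact Submodule.one_le.mpr (one_mem (MvPolynomial.aeval (R := k) w).range)
    | succ m ih =>
      rw [pow_succ]
      exact Submodule.mul_le.mpr fun x hx y hy =>
        mul_mem (S := Subalgebra k A) (s := (MvPolynomial.aeval (R := k) w).range) (ih hx) (hY hy)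
  -- Iterating A = k + YA leaves polynomials in the w's and a remainder in Y^m A, which vanishes for
  -- large m.
  have h4 : ∀ m, (⊤ : Submodule k A) ≤ S ⊔ Y ^ m * ⊤ := by
    intro m
    induction m with
    | zero => rw [pow_zero, one_mul]; exact le_sup_right
    | succ m ih =>
      refine ih.trans (sup_le le_sup_left ?_)
      refine (mul_le_mul_right h3 _).trans ?_
      rw [Submodule.mul_sup, mul_one, ← mul_assoc, ← pow_succ]
      exact sup_le_sup (hYS m) le_rfl
  intro x
  have hx : x ∈ S := by
    have := h4 l (mem_top (x := x))
    rwa [show Y ^ l = ⊥ from hl, bot_mul, sup_bot_eq] at this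
  exact hx

end Truncated


/-! ### Eigenvector coordinates from a basis of the `p`-group -/

section Coordinates

variable {k : Type*} [Field k]

/-- A basis of a finite abelian `p`-group, with the dual basis of homomorphisms to the field. -/
theorem exists_basis_of_isPGroup {p : ℕ} [Fact p.Prime] [CharP k p] {P : Type*} [CommGroup P]
    [Finite P] (hP : IsPGroup p P) :
    ∃ (r : ℕ) (x : Fin r → P) (n : Fin r → ℕ) (d : P →* Multiplicative (Fin r → k)),
      (∀ j, 1 ≤ n j) ∧ (∀ j, x j ^ p ^ n j = 1) ∧ Subgroup.closure (Set.range x) = ⊤ ∧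
      (∀ j, d (x j) = Multiplicative.ofAdd (Pi.single j 1)) ∧ ∏ j, p ^ n j = Nat.card P := by
  classical
  obtain ⟨ι, _, m, hm, ⟨e⟩⟩ := CommGroup.equiv_prod_multiplicative_zmod_of_finite P
  obtain ⟨N, hN⟩ := (IsPGroup.iff_card).mp hP
  have hcard : Nat.card P = ∏ i, m i := by
    rw [Nat.card_congr e.toEquiv, Nat.card_pi]
    exact Finset.prod_congr rfl fun i _ => Nat.card_zmod (m i)
  have hpow : ∀ i, ∃ l, 1 ≤ l ∧ m i = p ^ l := fun i => by
    obtain ⟨l, -, hl⟩ := (Nat.dvd_prime_pow Fact.out).mp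
      ((Finset.dvd_prod_of_mem m (Finset.mem_univ i)).trans (hcard.symm.trans hN).dvd)
    refine ⟨l, Nat.one_le_iff_ne_zero.mpr ?_, hl⟩
    rintro rfl
    exact (hm i).ne' (by rw [hl, pow_zero])
  choose l hl hml using hpow
  let σ := Fintype.equivFin ι
  -- As p divides the order of each cyclic factor, reduction modulo p gives the dual homomorphisms
  -- to k.
  have hchar : ∀ i, p ∣ m i := fun i => by
    rw [hml i]
    exact dvd_pow_self p (Nat.one_le_iff_ne_zero.mp (hl i))
  let x : ι → P := fun i => e.symm (Pi.mulSingle i (Multiplicative.ofAdd 1))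
  let δ : P →* Multiplicative (Fin (Fintype.card ι) → k) :=
    { toFun := fun y => Multiplicative.ofAdd fun j =>
        ZMod.castHom (hchar (σ.symm j)) k (Multiplicative.toAdd (e y (σ.symm j)))
      map_one' := by
        rw [map_one]
        refine congrArg Multiplicative.ofAdd (funext fun j => ?_)
        exact map_zero _
      map_mul' := fun y z => by
        rw [map_mul, ← ofAdd_add]
        refine congrArg Multiplicative.ofAdd (funext fun j => ?_)
        exact map_add (ZMod.castHom (hchar (σ.symm j)) k) _ _ }
  refine ⟨Fintype.card ι, x ∘ σ.symm, l ∘ σ.symm, δ, fun j => hl _, fun j => ?_, ?_,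
    fun j => ?_, ?_⟩
  · change (e.symm _) ^ p ^ l (σ.symm j) = 1
    rw [← hml, ← map_pow, ← Pi.mulSingle_pow, ← ofAdd_nsmul]
    simp
  · rw [σ.symm.surjective.range_comp, eq_top_iff]
    intro y _
    rw [← e.symm_apply_apply y, ← Finset.univ_prod_mulSingle (e y), map_prod]
    refine Subgroup.prod_mem _ fun i _ => ?_
    have : NeZero (m i) := ⟨(Nat.zero_lt_one.trans (hm i)).ne'⟩
    have h1 : e y i =
        Multiplicative.ofAdd (1 : ZMod (m i)) ^ (Multiplicative.toAdd (e y i)).val := by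
      rw [← ofAdd_nsmul]
      simp
    rw [h1, Pi.mulSingle_pow, map_pow]
    exact Subgroup.pow_mem _ (Subgroup.subset_closure (Set.mem_range_self (f := x) i)) _
  · refine congrArg Multiplicative.ofAdd (funext fun i => ?_)
    change ZMod.castHom (hchar (σ.symm i)) k (Multiplicative.toAdd (e (e.symm _) (σ.symm i))) = _
    rw [e.apply_symm_apply]
    by_cases h : i = j
    · subst h
      rw [Pi.mulSingle_eq_same, Pi.single_eq_same, toAdd_ofAdd, map_one]
    · rw [Pi.mulSingle_eq_of_ne (fun h' => h (σ.symm.injective h')), Pi.single_eq_of_ne h,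
        toAdd_one, map_zero]
  · rw [hcard, ← Equiv.prod_comp σ.symm]
    exact Finset.prod_congr rfl fun j _ => (hml _).symm

variable {P : Type*} [CommGroup P]

open Submodule in
-- Induction along yz − 1 = (y − 1)z + (z − 1) and y⁻¹ − 1 = −(y − 1)y⁻¹.
theorem of_sub_one_mem {x : P} {S : Set P} (hS : Subgroup.closure S = ⊤)
    {M : Submodule k (MonoidAlgebra k P)}
    (hM : ∀ s ∈ S, MonoidAlgebra.of k P s - 1 ∈ M) : MonoidAlgebra.of k P x - 1 ∈ M * ⊤ := by
  have hx : x ∈ Subgroup.closure S := hS ▸ Subgroup.mem_top x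
  have hmul : ∀ a ∈ M * ⊤, ∀ b, a * b ∈ M * ⊤ := fun a ha b => by
    have := mul_mem_mul ha (mem_top (x := b))
    rw [mul_assoc] at this
    exact (show M * (⊤ * ⊤) ≤ M * ⊤ from mul_le_mul_right le_top _) this
  induction hx using Subgroup.closure_induction with
  | mem y hy => simpa using mul_mem_mul (hM y hy) (mem_top (x := 1))
  | one => rw [map_one, sub_self]; exact zero_mem _
  | mul y z _ _ hy hz =>
    have := add_mem (hmul _ hy (MonoidAlgebra.of k P z)) hz
    rwa [sub_mul, one_mul, ← map_mul, sub_add_sub_cancel] at this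
  | inv y _ hy =>
    have := neg_mem (hmul _ hy (MonoidAlgebra.of k P y⁻¹))
    rwa [sub_mul, one_mul, ← map_mul, mul_inv_cancel, map_one, neg_sub] at this

open Submodule in
theorem one_sup_mul_top {S : Set P} (hS : Subgroup.closure S = ⊤)
    {M : Submodule k (MonoidAlgebra k P)}
    (hM : ∀ s ∈ S, MonoidAlgebra.of k P s - 1 ∈ M) : 1 ⊔ M * ⊤ = ⊤ := by
  refine eq_top_iff.mpr fun a _ => ?_
  induction a using MonoidAlgebra.induction_on with
  | of y =>
    rw [← add_sub_cancel 1 (MonoidAlgebra.of k P y)]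
    exact add_mem (le_sup_left (a := (1 : Submodule k (MonoidAlgebra k P)))
      (Submodule.one_le.mp le_rfl))
      (le_sup_right (a := (1 : Submodule k (MonoidAlgebra k P))) (of_sub_one_mem hS hM))
  | add a b ha hb => exact add_mem (ha trivial) (hb trivial)
  | smul c a ha => exact smul_mem _ c (ha trivial)

open Submodule in
-- The second component of Δ is a differential at the augmentation; products of two elements of M
-- die because the augmentation part squares to zero.
theorem map_mul_mul_top_eq_bot {A V : Type*} [CommRing A] [Algebra k A] [AddCommGroup V]
    [Module k V] [Module kᵐᵒᵖ V] [IsCentralScalar k V] (Δ : A →ₐ[k] TrivSqZeroExt k V) {M : Submodule k A}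
    (hM : ∀ a ∈ M, (Δ a).fst = 0) {a : A} (ha : a ∈ M * M * ⊤) : (Δ a).snd = 0 := by
  have h2 : ∀ a ∈ M * M, Δ a = 0 := fun a ha => by
    induction ha using Submodule.mul_induction_on' with
    | mem_mul_mem m hm n hn =>
      rw [map_mul]
      ext <;> simp [hM m hm, hM n hn]
    | add x _ y _ hx hy => rw [map_add, hx, hy, add_zero]
  have h3 : Δ a = 0 := by
    induction ha using Submodule.mul_induction_on' with
    | mem_mul_mem m hm n hn => rw [map_mul, h2 m hm, zero_mul]
    | add x _ y _ hx hy => rw [map_add, hx, hy, add_zero]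
  rw [h3, TrivSqZeroExt.snd_zero]

open Submodule in
/-- Elements of `M A` whose differentials are a basis span `M` modulo `M² A`. -/
theorem le_span_sup_of_det_ne_zero {A : Type*} [CommRing A] [Algebra k A] {r : ℕ} {X w : Fin r → A}
    (htop : 1 ⊔ span k (Set.range X) * ⊤ = ⊤) (D : A →ₗ[k] (Fin r → k))
    (hX : ∀ j, D (X j) = Pi.single j 1)
    (hD : ∀ a ∈ span k (Set.range X) * span k (Set.range X) * ⊤, D a = 0)
    (hw : ∀ j, w j ∈ span k (Set.range X) * ⊤)
    (hdet : (Matrix.of fun j => D (w j)).det ≠ 0) :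
    span k (Set.range X) ≤
      span k (Set.range w) ⊔ span k (Set.range X) * span k (Set.range X) * ⊤ := by
  set M := span k (Set.range X)
  have h1 : M * ⊤ ≤ M ⊔ M * M * ⊤ := by
    conv_lhs => rw [← htop]
    rw [Submodule.mul_sup, mul_one, mul_assoc]
  have h2 : ∀ a ∈ M * ⊤, ∀ j, D a = Pi.single j 1 → X j ∈ M * M * ⊤ ⊔ span k {a} := by
    intro a ha j hj
    obtain ⟨m, hm, q, hq, rfl⟩ := mem_sup.mp (h1 ha)
    obtain ⟨c, rfl⟩ := (mem_span_range_iff_exists_fun k).mp hm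
    have h3 : c = Pi.single j 1 := by
      rw [← hj, map_add, hD q hq, add_zero, map_sum]
      simp only [map_smul, hX]
      ext i
      simp [Finset.sum_apply, Pi.single_apply]
    have h4 : ∑ i, c i • X i = X j := by
      rw [h3]
      simp [Pi.single_apply]
    refine mem_sup.mpr ⟨-q, neg_mem hq, X j + q, ?_, by abel⟩
    rw [← h4]
    exact mem_span_singleton_self _
  refine span_le.mpr ?_
  rintro _ ⟨j, rfl⟩
  set B : Matrix (Fin r) (Fin r) k := Matrix.of fun j => D (w j)
  -- The inverse of the matrix of differentials yields a combination of the w's with the same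
  -- differential as X_j, hence equal to X_j modulo M²A.
  have hmem : ∑ i, B⁻¹ j i • w i ∈ span k (Set.range w) :=
    sum_mem fun i _ => smul_mem _ _ (subset_span ⟨i, rfl⟩)
  have h5 := h2 (∑ i, B⁻¹ j i • w i) (sum_mem fun i _ => smul_mem _ _ (hw i)) j (by
    have h6 : B⁻¹ * B = 1 := Matrix.nonsing_inv_mul B (isUnit_iff_ne_zero.mpr hdet)
    ext l
    have h7 := congrFun (congrFun h6 j) l
    rw [Matrix.mul_apply, Matrix.one_eq_pi_single] at h7
    rw [map_sum, Finset.sum_apply, ← h7]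
    refine Finset.sum_congr rfl fun i _ => ?_
    rw [map_smul]
    rfl)
  rw [sup_comm] at h5
  exact sup_le_sup ((span_singleton_le_iff_mem _ _).mpr hmem) le_rfl h5

/-- The component of `a ∈ kP` for a linear character `ψ` of a group of automorphisms of `P`. -/
def eigencomponent {L : Subgroup (MulAut P)} [Fintype L] (ψ : L →* kˣ) (a : MonoidAlgebra k P) :
    MonoidAlgebra k P :=
  (Nat.card L : k)⁻¹ • ∑ x : L, ((ψ x⁻¹ : kˣ) : k) •
    MonoidAlgebra.mapDomainAlgHom k k ((x : MulAut P) : P →* P) a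

theorem mapDomain_eigencomponent {L : Subgroup (MulAut P)} [Fintype L] (ψ : L →* kˣ)
    (a : MonoidAlgebra k P) (x : L) :
    MonoidAlgebra.mapDomainAlgHom k k ((x : MulAut P) : P →* P) (eigencomponent ψ a) =
      ((ψ x : kˣ) : k) • eigencomponent ψ a := by
  unfold eigencomponent
  rw [map_smul, map_sum, smul_comm]
  congr 1
  rw [Finset.smul_sum]
  refine Fintype.sum_equiv (Equiv.mulLeft x) _ _ fun y => ?_
  rw [map_smul, smul_smul, ← Units.val_mul, ← map_mul, Equiv.coe_mulLeft, mul_inv_rev, map_mul,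
    map_mul, map_inv ψ x, mul_comm (ψ y⁻¹), mul_inv_cancel_left]
  congr 1
  exact (DFunLike.congr_fun (MonoidAlgebra.mapDomainAlgHom_comp (R := k) (A := k)
    ((y : MulAut P) : P →* P) ((x : MulAut P) : P →* P)) a).symm

theorem sum_eigencomponent [IsAlgClosed k] {L : Subgroup (MulAut P)} [Fintype L]
    [IsMulCommutative L] [Fintype (L →* kˣ)] (hL : (Nat.card L : k) ≠ 0) (a : MonoidAlgebra k P) :
    ∑ ψ : L →* kˣ, eigencomponent ψ a = a := by
  let _ : CommGroup L := commGroupOfIsMulCommutative L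
  have := hasEnoughRootsOfUnity_exponent hL
  have hsum : ∀ x : L, x ≠ 1 → ∑ ψ : L →* kˣ, ((ψ x⁻¹ : kˣ) : k) = 0 := by
    intro x hx
    obtain ⟨η, hη⟩ := CommGroup.exists_apply_ne_one_of_hasEnoughRootsOfUnity L k
      (a := x⁻¹) (inv_ne_one.mpr hx)
    have h1 := Equiv.sum_comp (Equiv.mulRight η) fun ψ : L →* kˣ => ((ψ x⁻¹ : kˣ) : k)
    simp only [Equiv.coe_mulRight, MonoidHom.mul_apply, Units.val_mul] at h1
    rw [← Finset.sum_mul] at h1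
    have h2 : (∑ ψ : L →* kˣ, ((ψ x⁻¹ : kˣ) : k)) * (((η x⁻¹ : kˣ) : k) - 1) = 0 := by
      rw [mul_sub, h1, mul_one, sub_self]
    refine (mul_eq_zero.mp h2).resolve_right fun h => hη (Units.ext ?_)
    simpa using sub_eq_zero.mp h
  unfold eigencomponent
  rw [← Finset.smul_sum, Finset.sum_comm]
  simp only [← Finset.sum_smul]
  rw [Finset.sum_eq_single 1 (fun x _ hx => by rw [hsum x hx, zero_smul]) (by simp)]
  have hone : ∑ ψ : L →* kˣ, ((ψ (1 : L)⁻¹ : kˣ) : k) = (Nat.card L : k) := by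
    rw [← CommGroup.card_monoidHom_of_hasEnoughRootsOfUnity L k]
    simp
  rw [hone, smul_smul, inv_mul_cancel₀ hL, one_smul]
  exact DFunLike.congr_fun (MonoidAlgebra.mapDomainAlgHom_id (R := k) (A := k) (M := P)) a

/-- Coordinates on `kP` exist. -/
theorem nonempty_coordinates (p : ℕ) [Fact p.Prime] (k : Type v) [Field k] [IsAlgClosed k]
    [CharP k p] {P : Type u} [CommGroup P] [Finite P] (hP : IsPGroup p P) {L : Subgroup (MulAut P)}
    [IsMulCommutative L] (hL : (Nat.card L).Coprime p) : Nonempty (Coordinates p k L) := by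
  classical
  obtain ⟨r, x, n, d, hn, hx, hgen, hd, hcard⟩ := exists_basis_of_isPGroup (k := k) hP
  have hL0 : (Nat.card L : k) ≠ 0 := TwistExtension.card_base_ne_zero p hL
  let _ : Fintype L := Fintype.ofFinite L
  let _ : CommGroup L := commGroupOfIsMulCommutative L
  have : Finite (L →* kˣ) := by
    have := hasEnoughRootsOfUnity_exponent hL0
    infer_instance
  let _ : Fintype (L →* kˣ) := Fintype.ofFinite _
  have : CharP (MonoidAlgebra k P) p :=
    charP_of_injective_algebraMap (algebraMap k (MonoidAlgebra k P)).injective p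
  have := ExpChar.prime (R := MonoidAlgebra k P) (Fact.out : p.Prime)
  let X : Fin r → MonoidAlgebra k P := fun j => MonoidAlgebra.of k P (x j) - 1
  have hXp : ∀ j, X j ^ p ^ n j = 0 := fun j => by
    rw [sub_pow_expChar_pow, ← map_pow, hx, map_one, one_pow, sub_self]
  set M := Submodule.span k (Set.range X)
  have hMx : ∀ y ∈ Set.range x, MonoidAlgebra.of k P y - 1 ∈ M := by
    rintro _ ⟨j, rfl⟩
    exact Submodule.subset_span ⟨j, rfl⟩
  -- A group element y goes to 1 + d(y), so x_j − 1 has the j-th unit vector as its differential.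
  let Δ : MonoidAlgebra k P →ₐ[k] TrivSqZeroExt k (Fin r → k) := MonoidAlgebra.lift k _ _
    { toFun := fun y => TrivSqZeroExt.inl 1 + TrivSqZeroExt.inr (Multiplicative.toAdd (d y))
      map_one' := by simp
      map_mul' := fun y z => by ext <;> simp [add_comm] }
  have hΔ : ∀ j, Δ (X j) = TrivSqZeroExt.inr (Pi.single j 1) := fun j => by
    simp [X, Δ, hd]
  have hfst : ∀ a ∈ M, (Δ a).fst = 0 := fun a ha => by
    induction ha using Submodule.span_induction with
    | mem a ha => obtain ⟨j, rfl⟩ := ha; rw [hΔ, TrivSqZeroExt.fst_inr]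
    | zero => simp
    | add a b _ _ ha hb => rw [map_add, TrivSqZeroExt.fst_add, ha, hb, add_zero]
    | smul c a _ ha => rw [map_smul, TrivSqZeroExt.fst_smul, ha, smul_zero]
  let D : MonoidAlgebra k P →ₗ[k] (Fin r → k) :=
    (TrivSqZeroExt.sndHom k (Fin r → k)).comp Δ.toLinearMap
  have hDX : ∀ j, D (X j) = Pi.single j 1 := fun j => by
    change (Δ (X j)).snd = _
    rw [hΔ, TrivSqZeroExt.snd_inr]
  -- Each X_j is the sum of its eigencomponents, and the X_j have determinant 1. Expanding
  -- multilinearly, some choice of one component per row has non-zero determinant.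
  obtain ⟨ψ, hψ⟩ : ∃ ψ : Fin r → (L →* kˣ),
      (Matrix.of fun j => D (eigencomponent (ψ j) (X j))).det ≠ 0 := by
    have h1 : (Matrix.detRowAlternating (n := Fin r) (R := k)).toMultilinearMap
        (fun j => ∑ ψ : L →* kˣ, D (eigencomponent ψ (X j))) = 1 := by
      simp only [← map_sum, sum_eigencomponent hL0, hDX]
      refine Eq.trans ?_ (Matrix.det_one (n := Fin r) (R := k))
      refine congrArg Matrix.det ?_
      ext i j
      simp [Matrix.one_apply, Pi.single_apply, eq_comm]
    rw [MultilinearMap.map_sum] at h1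
    obtain ⟨ψ, -, h⟩ := Finset.exists_ne_zero_of_sum_ne_zero (h1.trans_ne one_ne_zero)
    exact ⟨ψ, h⟩
  -- The p^n-th power map is additive and commutes with the action of L, so an eigencomponent dies
  -- at the same power as X_j.
  have hpow : ∀ j, eigencomponent (ψ j) (X j) ^ p ^ n j = 0 := fun j => by
    rw [eigencomponent, smul_pow, sum_pow_char_pow]
    simp only [smul_pow, ← map_pow, hXp, map_zero, smul_zero, Finset.sum_const_zero]
  have hmem : ∀ j, eigencomponent (ψ j) (X j) ∈ M * ⊤ := fun j => by
    refine Submodule.smul_mem _ _ (Submodule.sum_mem _ fun y _ => Submodule.smul_mem _ _ ?_)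
    have : MonoidAlgebra.mapDomainAlgHom k k ((y : MulAut P) : P →* P) (X j) =
        MonoidAlgebra.of k P ((y : MulAut P) (x j)) - 1 := by
      rw [map_sub, map_one, MonoidAlgebra.of_apply, MonoidAlgebra.mapDomainAlgHom_apply,
        MonoidAlgebra.mapDomain_single]
      rfl
    rw [this]
    exact of_sub_one_mem hgen hMx
  have htop := one_sup_mul_top hgen hMx
  obtain ⟨N, hN⟩ := exists_span_range_pow_eq_bot (k := k) (a := X) fun j => ⟨_, hXp j⟩
  have hsurj := aeval_surjective_of_le (w := fun j => eigencomponent (ψ j) (X j)) hN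
    (fun j => ⟨_, hpow j⟩) htop
    (le_span_sup_of_det_ne_zero htop D hDX (fun a ha => map_mul_mul_top_eq_bot Δ hfst ha) hmem hψ)
  exact ⟨{
    r := r
    w := fun j => eigencomponent (ψ j) (X j)
    ψ := ψ
    n := n
    n_pos := hn
    eigen := fun y j => mapDomain_eigencomponent (ψ j) (X j) y
    surjective := hsurj
    ker_eq := ker_aeval_eq hpow hsurj (by rw [hcard, finrank_monoidAlgebra]) }⟩

end Coordinates


/-! ### Existence of the central extension -/

section CocycleExtension

variable {L M : Type*} [Group L] [CommGroup M]

theorem cocycle_one_left (a : cocycles L M) (x : L) : a.1 (1, x) = a.1 (1, 1) := by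
  have h := a.2 1 1 x
  simp only [one_mul] at h
  exact (mul_right_cancel (h.trans (mul_comm _ _))).symm

theorem cocycle_one_right (a : cocycles L M) (x : L) : a.1 (x, 1) = a.1 (1, 1) := by
  have h := a.2 x 1 1
  simp only [mul_one] at h
  exact mul_right_cancel h

/-- The central extension of `L` by `M` with cocycle `a`. -/
@[ext]
structure CocycleExtension (a : cocycles L M) where
  fst : M
  snd : L

namespace CocycleExtension

variable (a : cocycles L M)

instance : Mul (CocycleExtension a) :=
  ⟨fun g h => ⟨g.fst * h.fst * a.1 (g.snd, h.snd), g.snd * h.snd⟩⟩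

instance : One (CocycleExtension a) := ⟨⟨(a.1 (1, 1))⁻¹, 1⟩⟩

instance : Inv (CocycleExtension a) :=
  ⟨fun g => ⟨g.fst⁻¹ * (a.1 (1, 1))⁻¹ * (a.1 (g.snd⁻¹, g.snd))⁻¹, g.snd⁻¹⟩⟩

variable {a}

theorem mul_def (g h : CocycleExtension a) :
    g * h = ⟨g.fst * h.fst * a.1 (g.snd, h.snd), g.snd * h.snd⟩ := rfl

theorem one_def : (1 : CocycleExtension a) = ⟨(a.1 (1, 1))⁻¹, 1⟩ := rfl

theorem inv_def (g : CocycleExtension a) :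
    g⁻¹ = ⟨g.fst⁻¹ * (a.1 (1, 1))⁻¹ * (a.1 (g.snd⁻¹, g.snd))⁻¹, g.snd⁻¹⟩ := rfl

instance : Group (CocycleExtension a) := Group.ofLeftAxioms
  (fun g h l => by
    simp only [mul_def, mul_assoc, mk.injEq, and_true, mul_right_inj]
    have := a.2 g.snd h.snd l.snd
    rw [mul_left_comm, this])
  (fun g => by
    simp only [mul_def, one_def, one_mul, cocycle_one_left]
    ext
    · exact inv_mul_cancel_comm _ _
    · rfl)
  (fun g => by
    simp only [mul_def, one_def, inv_def, inv_mul_cancel]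
    ext
    · simp [mul_comm, mul_left_comm]
    · rfl)

variable (a) in
/-- The projection to `L`. -/
def proj : CocycleExtension a →* L where
  toFun := snd
  map_one' := rfl
  map_mul' _ _ := rfl

variable (a) in
/-- The embedding of `M`. -/
def incl : M →* CocycleExtension a where
  toFun m := ⟨m * (a.1 (1, 1))⁻¹, 1⟩
  map_one' := by rw [one_mul]; rfl
  map_mul' m n := by
    rw [mul_def]
    simp [mul_assoc, mul_comm, mul_left_comm]

theorem mk_one_mul_mk_one (x y : L) :
    (⟨1, x⟩ * ⟨1, y⟩ : CocycleExtension a) = incl a (a.1 (x, y)) * ⟨1, x * y⟩ := by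
  simp [mul_def, incl, cocycle_one_left]

theorem incl_injective : Function.Injective (incl a) := fun _ _ h =>
  mul_right_cancel (congrArg fst h)

theorem mem_ker_proj {g : CocycleExtension a} :
    g ∈ (proj a).ker ↔ g = incl a (g.fst * a.1 (1, 1)) := by
  constructor
  · intro h
    ext
    · simp [incl]
    · exact h
  · intro h
    rw [h]
    rfl

theorem incl_mem_center (m : M) : incl a m ∈ Subgroup.center (CocycleExtension a) := by
  refine Subgroup.mem_center_iff.mpr fun g => ?_
  simp only [mul_def, incl, MonoidHom.coe_mk, OneHom.coe_mk, cocycle_one_left, cocycle_one_right,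
    mul_one, one_mul, mul_comm g.fst]

end CocycleExtension

/-- A symmetric cocycle of an abelian group with values in a divisible group is a coboundary. -/
theorem exists_eq_of_symmetric [IsMulCommutative L] (hM : ∀ n : ℕ, n ≠ 0 → ∀ m : M, ∃ l, l ^ n = m)
    (a : cocycles L M) (ha : ∀ x y, a.1 (x, y) = a.1 (y, x)) :
    ∃ c : L → M, ∀ x y, a.1 (x, y) = c x * c y * (c (x * y))⁻¹ := by
  have hsurj : ∀ {n : ℤ}, n ≠ 0 → Function.Surjective fun m : Additive M => n • m := by
    intro n hn m
    obtain ⟨l, hl⟩ := hM n.natAbs (Int.natAbs_ne_zero.mpr hn) (Additive.toMul m)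
    have hl' : n.natAbs • Additive.ofMul l = m := hl
    rcases Int.natAbs_eq n with h | h
    · refine ⟨Additive.ofMul l, ?_⟩
      change n • _ = _
      rw [h, natCast_zsmul]
      exact hl'
    · refine ⟨-Additive.ofMul l, ?_⟩
      change n • _ = _
      rw [h, neg_zsmul, zsmul_neg, neg_neg, natCast_zsmul]
      exact hl'
  let _ : DivisibleBy (Additive M) ℤ := divisibleByOfSMulRightSurj _ _ hsurj
  let _ : CommGroup (CocycleExtension a) :=
    { (inferInstance : Group (CocycleExtension a)) with
      mul_comm := fun g h => by
        rw [CocycleExtension.mul_def, CocycleExtension.mul_def, mul_comm g.fst, ha,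
          IsMulCommutative.is_comm.comm g.snd h.snd] }
  have hinj : Function.Injective (MonoidHom.toAdditive (CocycleExtension.incl a)) :=
    fun _ _ h => CocycleExtension.incl_injective (a := a) h
  -- By symmetry the extension group is abelian, and divisible groups are injective, so M is a
  -- retract of it. The retraction restricted to the section is the required cochain.
  obtain ⟨ρ, hρ⟩ := (Module.Baer.of_divisible (Additive M)).extension_property_addMonoidHom
    (MonoidHom.toAdditive (CocycleExtension.incl a)) hinj (AddMonoidHom.id (Additive M))
  let ρ' : CocycleExtension a →* M := AddMonoidHom.toMultiplicative ρ
  have hρ' : ∀ m, ρ' (CocycleExtension.incl a m) = m := fun m => DFunLike.congr_fun hρ m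
  refine ⟨fun x => ρ' ⟨1, x⟩, fun x y => ?_⟩
  rw [← map_mul, CocycleExtension.mk_one_mul_mk_one, map_mul, hρ', mul_inv_cancel_right]

/-- The commutator pairing of a cocycle of an abelian group. -/
def commutatorHom [IsMulCommutative L] (a : cocycles L M) (x : L) : L →* M where
  toFun y := a.1 (x, y) * (a.1 (y, x))⁻¹
  map_one' := by rw [cocycle_one_left, cocycle_one_right, mul_inv_cancel]
  map_mul' y z := by
    have hc : ∀ x y : L, x * y = y * x := IsMulCommutative.is_comm.comm
    -- The three cocycle identities express a(x,yz), a(yz,x) and a(xy,z) by other values; a(y,xz)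
    -- then cancels.
    have h1 := a.2 x y z
    have h2 := a.2 y z x
    have h3 := a.2 y x z
    rw [hc y x, hc x z] at h3
    rw [eq_inv_mul_of_mul_eq h1.symm, eq_inv_mul_of_mul_eq h2, eq_inv_mul_of_mul_eq h3]
    apply Additive.ofMul.injective
    simp only [ofMul_mul, ofMul_inv]
    abel

end CocycleExtension

/-- The universe of the covering group of an extension may be changed. -/
theorem TwistExtension.nonempty_lift {L : Type u} {k : Type v} [Group L] [Field k] {α : H2 L kˣ}
    (D : TwistExtension.{u, v, t} α) : Nonempty (TwistExtension.{u, v, w} α) := by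
  let f : Shrink.{w} D.H ≃* D.H := Shrink.mulEquiv
  have hmem : ∀ z, z ∈ (D.π.comp f.toMonoidHom).ker ↔ f z ∈ D.π.ker := fun z => Iff.rfl
  obtain ⟨s, hs, c, hc, hα⟩ := D.realises
  exact ⟨{
    H := Shrink.{w} D.H
    finite := Finite.of_equiv D.H f.symm.toEquiv
    π := D.π.comp f.toMonoidHom
    surjective := D.surjective.comp f.surjective
    central := fun z hz => Subgroup.mem_center_iff.mpr fun g => f.injective (by
      rw [map_mul, map_mul]
      exact Subgroup.mem_center_iff.mp (D.central hz) (f g))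
    ker_le_commutator := fun z hz => by
      have h1 : f z ∈ (commutator (Shrink.{w} D.H)).map f.toMonoidHom := by
        rw [map_commutator_eq, MonoidHom.range_eq_top.mpr f.surjective]
        exact D.ker_le_commutator ((hmem z).mp hz)
      obtain ⟨y, hy, hyz⟩ := h1
      exact f.injective hyz ▸ hy
    χ := D.χ.comp ((f.toMonoidHom.domRestrict _).codRestrict _ fun z => z.2)
    faithful := fun y z h => Subtype.ext (f.injective (congrArg Subtype.val (D.faithful h)))
    realises := ⟨fun x => f.symm (s x), fun x => by simp [hs], c, fun x y => by
      rw [hc]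
      refine congrArg D.χ (Subtype.ext ?_)
      change _ = f (f.symm (s x) * f.symm (s y) * (f.symm (s (x * y)))⁻¹)
      simp, hα⟩ }⟩

/-- The central extension exists. -/
theorem nonempty_twistExtension {L : Type u} {k : Type v} [Group L] [Finite L] [IsMulCommutative L]
    [Field k] [IsAlgClosed k] (a : cocycles L kˣ) :
    Nonempty (TwistExtension.{u, v, w} (QuotientGroup.mk a : H2 L kˣ)) := by
  let S : Set kˣ := {b | ∃ x y, commutatorHom a x y = b}
  let B : Subgroup kˣ := Subgroup.closure S
  have hBfin : Finite B := by
    have : NeZero (Nat.card L) := ⟨Nat.card_pos.ne'⟩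
    -- The commutator pairing is a homomorphism in its second argument, so its values are roots of
    -- unity of order dividing |L|.
    have hle : B ≤ rootsOfUnity (Nat.card L) k := (Subgroup.closure_le _).mpr (by
      rintro _ ⟨x, y, rfl⟩
      change _ ^ _ = _
      rw [← map_pow, pow_card_eq_one', map_one])
    exact Finite.of_injective _ (Subgroup.inclusion_injective hle)
  have hc : ∀ x y : L, x * y = y * x := IsMulCommutative.is_comm.comm
  let abar : cocycles L (kˣ ⧸ B) := ⟨fun x => QuotientGroup.mk (a.1 x), fun x y z =>
    congrArg (QuotientGroup.mk (s := B)) (a.2 x y z)⟩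
  have hdiv : ∀ n : ℕ, n ≠ 0 → ∀ m : kˣ ⧸ B, ∃ l, l ^ n = m := by
    intro n hn m
    obtain ⟨m, rfl⟩ := QuotientGroup.mk_surjective m
    obtain ⟨l, hl⟩ := IsAlgClosed.exists_pow_nat_eq (m : k) (Nat.pos_of_ne_zero hn)
    have hl0 : l ≠ 0 := by
      rintro rfl
      rw [zero_pow hn] at hl
      exact m.ne_zero hl.symm
    exact ⟨QuotientGroup.mk (Units.mk0 l hl0), congrArg QuotientGroup.mk
      (Units.ext (by simpa using hl) : Units.mk0 l hl0 ^ n = m)⟩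
  -- Modulo B the cocycle is symmetric, hence a coboundary. Lifting its cochain to kˣ changes a into
  -- a cohomologous cocycle with values in the finite group B.
  obtain ⟨cbar, hcbar⟩ := exists_eq_of_symmetric hdiv abar fun x y => by
    refine QuotientGroup.eq.mpr ?_
    rw [mul_comm]
    exact Subgroup.subset_closure ⟨y, x, rfl⟩
  choose c hcc using fun x => QuotientGroup.mk_surjective (cbar x)
  have hmem : ∀ x y, a.1 (x, y) * (c x * c y * (c (x * y))⁻¹)⁻¹ ∈ B := fun x y => by
    rw [← QuotientGroup.eq_one_iff, QuotientGroup.mk_mul, QuotientGroup.mk_inv, mul_inv_eq_one]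
    refine (hcbar x y).trans ?_
    rw [← hcc, ← hcc, ← hcc]
    rfl
  let cob : cocycles L kˣ := ⟨fun x => c x.1 * c x.2 * (c (x.1 * x.2))⁻¹, fun x y z => by
    simp only [mul_assoc]
    apply Additive.ofMul.injective
    simp only [ofMul_mul, ofMul_inv]
    abel⟩
  let a' : cocycles L kˣ := a * cob⁻¹
  let b : cocycles L B := ⟨fun x => ⟨a'.1 x, hmem x.1 x.2⟩, fun x y z => Subtype.ext (a'.2 x y z)⟩
  have hfin : Finite (CocycleExtension b) := Finite.of_injective
    (fun g : CocycleExtension b => (g.fst, g.snd)) fun g h e =>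
      CocycleExtension.ext (congrArg Prod.fst e) (congrArg Prod.snd e)
  let π := CocycleExtension.proj b
  let χ : π.ker →* kˣ :=
    { toFun := fun z => B.subtype (z.1.fst * b.1 (1, 1))
      map_one' := by
        change B.subtype ((b.1 (1, 1))⁻¹ * b.1 (1, 1)) = 1
        rw [inv_mul_cancel, map_one]
      map_mul' := fun y z => by
        rw [← map_mul]
        refine congrArg B.subtype ?_
        change y.1.fst * z.1.fst * b.1 (y.1.snd, z.1.snd) * b.1 (1, 1) = _
        rw [show y.1.snd = 1 from y.2, show z.1.snd = 1 from z.2]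
        simp only [mul_left_comm, mul_comm] }
  have hχ : ∀ m h, χ ⟨CocycleExtension.incl b m, h⟩ = m := fun m h => by
    change B.subtype (m * (b.1 (1, 1))⁻¹ * b.1 (1, 1)) = m
    rw [inv_mul_cancel_right]
    rfl
  have hinj : Function.Injective χ := fun y z h => by
    have h1 : y.1.fst = z.1.fst := mul_right_cancel (B.subtype_injective h)
    exact Subtype.ext (CocycleExtension.ext h1 (y.2.trans z.2.symm))
  have hs : ∀ x y, (⟨1, x⟩ * ⟨1, y⟩ * (⟨1, x * y⟩)⁻¹ : CocycleExtension b) =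
      CocycleExtension.incl b (b.1 (x, y)) := fun x y => by
    rw [CocycleExtension.mk_one_mul_mk_one, mul_inv_cancel_right]
  have hker : ∀ m, CocycleExtension.incl b m ∈ π.ker := fun m => rfl
  have hcomm : π.ker ≤ commutator (CocycleExtension b) := by
    have hB : ∀ m : B, CocycleExtension.incl b m ∈ commutator (CocycleExtension b) := by
      rintro ⟨m, hm⟩
      induction hm using Subgroup.closure_induction with
      | mem m hm =>
        obtain ⟨x, y, rfl⟩ := hm
        -- Each generator a(x,y)a(y,x)⁻¹ is the commutator of the lifts of x and y; the coboundary
        -- correction is symmetric and drops out.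
        have h1 := Subgroup.commutator_mem_commutator
          (Subgroup.mem_top (⟨1, x⟩ : CocycleExtension b)) (Subgroup.mem_top ⟨1, y⟩)
        refine (congrArg (· ∈ commutator (CocycleExtension b)) ?_).mpr h1
        rw [commutatorElement_def, eq_mul_inv_iff_mul_eq, eq_mul_inv_iff_mul_eq, mul_assoc,
          CocycleExtension.mk_one_mul_mk_one, CocycleExtension.mk_one_mul_mk_one, hc y x,
          ← mul_assoc, ← map_mul]
        congr 2
        refine Subtype.ext ?_
        change a.1 (x, y) * (a.1 (y, x))⁻¹ * (a.1 (y, x) * (c y * c x * (c (y * x))⁻¹)⁻¹) =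
          a.1 (x, y) * (c x * c y * (c (x * y))⁻¹)⁻¹
        rw [mul_assoc, inv_mul_cancel_left, hc y x, mul_comm (c y)]
      | one => exact (map_one (CocycleExtension.incl b)).symm ▸ one_mem _
      | mul m m' hm hm' h h' =>
        have := mul_mem h h'
        rwa [← map_mul] at this
      | inv m hm h =>
        have := inv_mem h
        rwa [← map_inv] at this
    intro g hg
    rw [CocycleExtension.mem_ker_proj.mp hg]
    exact hB _
  let D : TwistExtension.{u, v, max u v} (QuotientGroup.mk a : H2 L kˣ) :=
    { H := CocycleExtension b
      π := π
      surjective := fun x => ⟨⟨1, x⟩, rfl⟩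
      central := fun g hg => by
        rw [CocycleExtension.mem_ker_proj.mp hg]
        exact CocycleExtension.incl_mem_center _
      ker_le_commutator := hcomm
      χ := χ
      faithful := hinj
      realises := ⟨fun x => ⟨1, x⟩, fun x => rfl, a', fun x y => by
        refine Eq.trans ?_ (congrArg χ (Subtype.ext (hs x y).symm :
          (⟨CocycleExtension.incl b (b.1 (x, y)), hker _⟩ : π.ker) = _))
        rw [hχ], by
        refine QuotientGroup.eq.mpr ⟨c, fun x y => ?_⟩
        change (a.1 (x, y) * (c x * c y * (c (x * y))⁻¹)⁻¹)⁻¹ * a.1 (x, y) = _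
        rw [mul_inv_rev, inv_inv, inv_mul_cancel_right]⟩ }
  exact D.nonempty_lift


/-! ### Assembly: the vertex idempotents under e, and basicness of kQ/I -/

section Assembly

variable {p : ℕ} {k : Type v} {P : Type u} [Field k] [CommGroup P] {L : Subgroup (MulAut P)}
  {α : H2 L kˣ} {D : TwistExtension.{u, v, w} α}

theorem vertexIdempotent_mul_idempotent [Fact p.Prime] [CharP k p] [IsAlgClosed k]
    [IsMulCommutative L] (hL : (Nat.card L).Coprime p) (φ : D.Vertex) :
    vertexIdempotent D φ * idempotent D = vertexIdempotent D φ := by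
  classical
  rw [← sum_vertexIdempotent D p hL, Finset.mul_sum]
  simp [vertexIdempotent_mul D (D.card_center_ne_zero p hL)]

/-- The radical of the quantised algebra is nilpotent, and the quotient is a product of copies of
the field. -/
theorem isBasic_quantisedAlgebra [Fact p.Prime] [IsMulCommutative L] {C : Coordinates p k L}
    (X : Choices D C) : IsBasic k (QuantisedAlgebra X) := by
  obtain ⟨f, hf, hker⟩ := exists_augmentation X
  refine isBasic_of_nil_ker f hf fun x hx => ⟨∑ i, p ^ C.n i + 1, ?_⟩
  have h := Submodule.pow_mem_pow _ (hker x hx) (∑ i, p ^ C.n i + 1)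
  rwa [(skewGenerated X).radical_pow_eq_bot (totalArrow_pow_eq_zero X), Submodule.mem_bot] at h

end Assembly

end QuantisedBlock

end

/-- `k` is an algebraically closed field of characteristic `p`, `P` a finite abelian `p`-group, `L`
an abelian `p'`-subgroup of `Aut(P)`, and `α` a class in `H²(L, kˣ)`, represented by the cocycle
`a`. The data that enter the presentation exist, and for every choice of these data the quantised
algebra `kQ / I` is the basic algebra of the twisted group algebra of `P ⋊ L`, which is a full
matrix algebra over its basic algebra. Moreover the twisted group algebra is isomorphic to
`k(P ⋊ H) e`, and `kQ / I` embeds there, with the arrows going to the elements `g_{i,φ} w_i e_φ`. -/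
theorem theorem1p2 (p : ℕ) [Fact p.Prime]
    (k : Type v) [Field k] [IsAlgClosed k] [CharP k p]
    (P : Type u) [CommGroup P] [Finite P] (hP : IsPGroup p P)
    (L : Subgroup (MulAut P)) [IsMulCommutative L] (hL : (Nat.card L).Coprime p)
    (α : H2 L kˣ) (a : cocycles L kˣ) (ha : QuotientGroup.mk a = α) :
    Nonempty (TwistExtension.{u, v, w} α) ∧
    Nonempty (Coordinates p k L) ∧
    ∀ (D : TwistExtension.{u, v, w} α) (C : Coordinates p k L),
      (∃ F : TwistedSemidirect a →ₙₐ[k] MonoidAlgebra k (CoverGroup D),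
        Function.Injective F ∧ Set.range F = {x | ∃ y, x = y * idempotent D}) ∧
      Nonempty (Choices D C) ∧
      ∀ X : Choices D C,
        relationIdeal X ≤ PathAlgebra.arrowIdealSq k _ _ ∧
        (∃ f : QuantisedAlgebra X →ₙₐ[k] MonoidAlgebra k (CoverGroup D),
          Function.Injective f ∧
          (∀ φ, f (PathAlgebra.vertex k _ _ φ : QuiverAlgebra D C) = vertexIdempotent D φ) ∧
          ∀ i φ, f (arrow D C i φ : QuiverAlgebra D C) = arrowElement X i φ) ∧
        IsBasicAlgebraOf k (TwistedSemidirect a) (QuantisedAlgebra X) ∧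
        ∃ m : ℕ, m * m = (Subgroup.center D.H).index ∧
          ∀ (A : Type t) [Ring A] [Algebra k A], IsBasicAlgebraOf k (TwistedSemidirect a) A →
            Nonempty (A ≃ₐ[k] QuantisedAlgebra X) ∧
            Nonempty (TwistedSemidirect a ≃ₐ[k] Matrix (Fin m) (Fin m) A) := by
  refine ⟨ha ▸ nonempty_twistExtension a, nonempty_coordinates p k hP hL, fun D C => ?_⟩
  obtain ⟨G, F, hFG, hGF⟩ := exists_projection_inclusion D (D.card_ker_ne_zero p) ha
  have hFinj : Function.Injective F := Function.LeftInverse.injective hGF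
  refine ⟨⟨F, hFinj, ?_⟩, nonempty_choices p hL D C, fun X => ?_⟩
  · ext x
    constructor
    · rintro ⟨y, rfl⟩
      exact ⟨F y, by rw [← hFG, hGF]⟩
    · rintro ⟨y, rfl⟩
      exact ⟨G y, hFG y⟩
  have hsum : ∑ φ, G (vertexIdempotent D φ) = 1 := by
    rw [← map_sum, sum_vertexIdempotent D p hL, ← one_mul (idempotent D), ← hFG, hGF, map_one]
  obtain ⟨f, hfv, hfa⟩ := exists_quantised_map X G (D.card_center_ne_zero p hL) hsum
  obtain ⟨hfinj, m, hm, hmm, ⟨e⟩⟩ := exists_algEquiv_matrix hL X G (fun y => ⟨F y, hGF y⟩) hsum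
    (finrank_twistedSemidirect a) f hfv hfa
  refine ⟨relationIdeal_le X, ⟨F.comp (f : QuantisedAlgebra X →ₙₐ[k] TwistedSemidirect a),
    hFinj.comp hfinj, fun φ => ?_, fun i φ => ?_⟩,
    isBasicAlgebraOf_of_algEquiv_matrix (isBasic_quantisedAlgebra X) 0 e, m, hmm,
    fun A _ _ hA => ?_⟩
  · exact (congrArg F (hfv φ)).trans ((hFG _).trans (vertexIdempotent_mul_idempotent hL φ))
  · refine (congrArg F (hfa i φ)).trans ((hFG _).trans ?_)
    rw [arrowElement_eq, mul_assoc, vertexIdempotent_mul_idempotent hL]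
  · obtain ⟨aug, haug, hker⟩ := exists_augmentation X
    obtain ⟨σ⟩ := nonempty_algEquiv_of_algEquiv_matrix hA 0 e aug haug hker
      ((skewGenerated X).radical_pow_eq_bot (totalArrow_pow_eq_zero X))
    exact ⟨⟨σ⟩, ⟨e.trans σ.symm.mapMatrix⟩⟩
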